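/- **Conventions.** Vector spaces are over $\mathbb{C}$. For an $\mathbb{R}$-graded space $V=\coprod_{n\in\mathbb{R}}V_{(n)}$ put $\overline V=\prod_n V_{(n)}$, $V'=\coprod_n V_{(n)}^*$, let $P_n$ be the projection to $V_{(n)}$ and $\mathbf d$ the grading operator ($\mathbf d v=nv$ for $v\in V_{(n)}$). Limits and derivatives in $\overline V$ and in $\hom(V,\overline V)$ are weak (after pairing with all $v'\in V'$). An *open-string vertex algebra* is such a $V$ with a vertex map $Y^O:(V\otimes V)\times\mathbb{R}_+\to\overline V$, $(u\otimes v,r)\mapsto Y^O(u,r)v$, linear in $u\otimes v$, a vacuum $\mathbf 1\in V$ and an operator $D\in\operatorname{End}V$ of weight $1$ such that: 1. for $n_1,n_2\in\mathbb{R}$ there is a finite $N\subset\mathbb{R}$ with $Y^O(u,r)v\in\prod_{n\in N+\mathbb{Z}}V_{(n)}$ for all $u\in\coprod_{n\in n_1+\mathbb{Z}}V_{(n)}$, $v\in\coprod_{n\in n_2+\mathbb{Z}}V_{(n)}$, $r>0$; 2. $Y^O(\mathbf 1,r)=\mathrm{id}_V$ and $\lim_{r\to0^+}Y^O(u,r)\mathbf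 1=u$; 3. for every $v'\in V'$ some power of the adjoint $D'$ of $D$ kills $v'$; 4. the sums $\sum_{m_1,\dots,m_{n-1}\in\mathbb{R}}\langle v',Y^O(v_1,r_1)P_{m_1}Y^O(v_2,r_2)\cdots P_{m_{n-1}}Y^O(v_n,r_n)v\rangle$ for $r_1>\dots>r_n>0$, and $\sum_{m\in\mathbb{R}}\langle v',Y^O(P_mY^O(v_1,r_0)v_2,r_2)v\rangle$ for $r_2>r_0>0$, converge absolutely; 5. $\langle v',Y^O(v_1,r_1)Y^O(v_2,r_2)v\rangle=\langle v',Y^O(Y^O(v_1,r_1-r_2)v_2,r_2)v\rangle$ for $r_1>r_2>r_1-r_2>0$; 6. $[\mathbf d,Y^O(u,r)]=Y^O(\mathbf du,r)+r\frac{d}{dr}Y^O(u,r)$; 7. $Y^O(u,r)$ is differentiable in $r$ and $\frac{d}{dr}Y^O(u,r)=[D,Y^O(u,r)]=Y^O(Du,r)$. It is *grading-restricted* if $\dim V_{(n)}<\infty$ for all $n$ and $V_{(n)}=0$ for $n$ sufficiently negative. Its *formal vertex operator map* is $\mathcal Y^f(u,x)=\sum_{n\in\mathbb{R}}u_n^+x^{-n-1}$,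 where $u_n^+v=P_{\mathrm{wt}\,u+\mathrm{wt}\,v-n-1}Y^O(u,1)v$ for homogeneous $u,v$. Its *meromorphic center* is $$C_0(V)=\Big\{u\in\coprod_{n\in\mathbb{Z}}V_{(n)}\ \Big|\ \mathcal Y^f(u,x)\in(\operatorname{End}V)[[x,x^{-1}]],\ \ \mathcal Y^f(v,x)u=e^{xD}\mathcal Y^f(u,-x)v\ \ \forall v\in V\Big\},$$ where $(-x)^n=e^{n\pi i}x^n$. A *grading-restricted vertex algebra* is a $\mathbb{Z}$-graded space $A=\coprod_{n\in\mathbb{Z}}A_{(n)}$ with $\dim A_{(n)}<\infty$ and $A_{(n)}=0$ for $n\ll0$, a vertex operator map $Y(u,x)=\sum_{n\in\mathbb{Z}}u_nx^{-n-1}$ with $u_nv=0$ for $n\gg0$, a vacuum $\mathbf 1\in A_{(0)}$ and an operator $D$ of weight $1$, such that $Y(\mathbf 1,x)=\mathrm{id}$, $Y(u,x)\mathbf 1\in u+xA[[x]]$, $[\mathbf d,Y(u,x)]=Y(\mathbf du,x)+x\frac{d}{dx}Y(u,x)$, $[D,Y(u,x)]=Y(Du,x)=\frac{d}{dx}Y(u,x)$,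 and the Jacobi identity holds: $$x_0^{-1}\delta\Big(\tfrac{x_1-x_2}{x_0}\Big)Y(u,x_1)Y(v,x_2)-x_0^{-1}\delta\Big(\tfrac{x_2-x_1}{-x_0}\Big)Y(v,x_2)Y(u,x_1)=x_2^{-1}\delta\Big(\tfrac{x_1-x_0}{x_2}\Big)Y(Y(u,x_0)v,x_2).$$ An *$A$-module* is an $\mathbb{R}$-graded space $W$ with finite-dimensional homogeneous subspaces that vanish in sufficiently negative weights, an operator $D$ of weight $1$ on $W$, and a map $Y_W:A\otimes W\to W[[x,x^{-1}]]$ with the same truncation, identity, $\mathbf d$-bracket and $D$-derivative/bracket properties and the Jacobi identity. An *intertwining operator of type $\binom{W_3}{W_1W_2}$* for $A$-modules $W_1,W_2,W_3$ is a map $\mathcal Y(w_1,x)w_2=\sum_{n\in\mathbb{R}}(w_1)_nw_2\,x^{-n-1}$, linear in $w_1\otimes w_2\in W_1\otimes W_2$, with $(w_1)_nw_2\in W_3$ and $(w_1)_nw_2=0$ for $n\gg0$, such that the Jacobi identity holds with $Y(v,x_2)$ replaced by $\mathcal Y(w_1,x_2)$ (and $u\in A$ acting on $W_3$, $W_2$,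 $W_1$ in the three terms), $[D,\mathcal Y(w_1,x)]=\mathcal Y(Dw_1,x)=\frac{d}{dx}\mathcal Y(w_1,x)$, and $[\mathbf d,\mathcal Y(w_1,x)]=\mathcal Y(\mathbf dw_1,x)+x\frac{d}{dx}\mathcal Y(w_1,x)$. **Theorem.** Let $V$ be a grading-restricted open-string vertex algebra. Then $\mathcal Y^f(u,x)v\in C_0(V)[[x,x^{-1}]]$ for all $u,v\in C_0(V)$, $D\,C_0(V)\subseteq C_0(V)$ and $\mathbf 1\in C_0(V)$. Moreover: - $(C_0(V),\mathcal Y^f|_{C_0(V)},\mathbf 1,D)$, graded by $C_0(V)_{(n)}=C_0(V)\cap V_{(n)}$ $(n\in\mathbb{Z})$, is a grading-restricted vertex algebra; - $V$, with its grading, its operator $D$ and the vertex operator map $\mathcal Y^f|_{C_0(V)\otimes V}$, is a $C_0(V)$-module; - $\mathcal Y^f$ is an intertwining operator of type $\binom{V}{VV}$ for $C_0(V)$. -/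

import Mathlib

open scoped DirectSum Topology

noncomputable section

namespace OpenString

section Graded

variable {V : Type*} [AddCommGroup V] [Module ℂ V]
variable (𝒱 : ℝ → Submodule ℂ V)

/-- The algebraic completion `∏ₙ V₍ₙ₎` of an `ℝ`-graded vector space. -/
abbrev Completion : Type _ := ∀ n : ℝ, 𝒱 n

/-- The graded dual `⨁ₙ V₍ₙ₎*`. -/
abbrev GradedDual : Type _ := ⨁ n : ℝ, Module.Dual ℂ (𝒱 n)

/-- The pairing between the graded dual and the completion. -/
def pairing : GradedDual 𝒱 →ₗ[ℂ] Completion 𝒱 →ₗ[ℂ] ℂ :=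
  DirectSum.toModule ℂ ℝ _ fun n =>
    LinearMap.lcomp ℂ ℂ (LinearMap.proj n : Completion 𝒱 →ₗ[ℂ] 𝒱 n)

/-- The projection `Pₙ` from the completion to `V₍ₙ₎ ⊆ V`. -/
def proj (n : ℝ) : Completion 𝒱 →ₗ[ℂ] V :=
  (𝒱 n).subtype ∘ₗ LinearMap.proj n

/-- The extension to the completion of an operator of weight `1` on `V`. -/
def extendWeightOne (D : V →ₗ[ℂ] V) (hD : ∀ n : ℝ, ∀ v ∈ 𝒱 n, D v ∈ 𝒱 (n + 1)) :
    Completion 𝒱 →ₗ[ℂ] Completion 𝒱 where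
  toFun x n := ⟨D (x (n - 1)), by simpa using hD (n - 1) (x (n - 1)) (x (n - 1)).2⟩
  map_add' x y := by ext n; simp
  map_smul' c x := by ext n; simp

/-- The extension of the grading operator `𝐝` to the completion: `𝐝` is multiplication by `n` on
the factor `V₍ₙ₎`. -/
def gradingCompletion : Completion 𝒱 →ₗ[ℂ] Completion 𝒱 where
  toFun x n := (n : ℂ) • x n
  map_add' x y := by ext n; simp
  map_smul' c x := by ext n; simpa using smul_comm (n : ℝ) c (x n : V)

variable [DirectSum.Decomposition 𝒱]

/-- The inclusion of `V` in its completion. -/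
def embed : V →ₗ[ℂ] Completion 𝒱 :=
  LinearMap.pi fun n =>
    DirectSum.component ℂ ℝ (fun i => 𝒱 i) n ∘ₗ
      (DirectSum.decomposeLinearEquiv 𝒱 : V →ₗ[ℂ] ⨁ i, 𝒱 i)

/-- The grading operator `𝐝` on `V`: multiplication by `n` on `V₍ₙ₎`. -/
def grading : V →ₗ[ℂ] V :=
  DirectSum.toModule ℂ ℝ V (fun n => (n : ℂ) • (𝒱 n).subtype) ∘ₗ
    (DirectSum.decomposeLinearEquiv 𝒱 : V →ₗ[ℂ] ⨁ i, 𝒱 i)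

end Graded

section Algebra

variable {V : Type*} [AddCommGroup V] [Module ℂ V]

/-- For a map `Y : ℝ → (V → V → V̄)`, the vector
`Y(v₁, r₁) P_{m₁} Y(v₂, r₂) ⋯ P_{m_k} Y(v_{k+1}, r_{k+1}) w` of `V̄`. -/
def productTerm (𝒱 : ℝ → Submodule ℂ V) (Y : ℝ → V →ₗ[ℂ] V →ₗ[ℂ] Completion 𝒱) :
    (k : ℕ) → (Fin (k + 1) → V) → (Fin (k + 1) → ℝ) → (Fin k → ℝ) → V → Completion 𝒱
  | 0, v, r, _, w => Y (r 0) (v 0) w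
  | k + 1, v, r, m, w =>
      Y (r 0) (v 0)
        (proj 𝒱 (m 0)
          (productTerm 𝒱 Y k (fun i => v i.succ) (fun i => r i.succ) (fun i => m i.succ) w))

/-- An open-string vertex algebra with underlying `ℝ`-graded vector space `V = ⨁ₙ 𝒱 n`.
The vertex map is `Y r u v`, where only the values at positive real numbers `r` matter.
Limits and derivatives are taken in the weak topology given by the graded dual.
Sums of complex numbers are absolutely convergent (`Summable`). -/
structure OpenStringVertexAlgebra (𝒱 : ℝ → Submodule ℂ V) [DirectSum.Decomposition 𝒱] where
  /-- The vertex map `Y^O(u, r) v = Y r u v`. -/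
  Y : ℝ → V →ₗ[ℂ] V →ₗ[ℂ] Completion 𝒱
  /-- The vacuum. -/
  vac : V
  /-- The operator `D`. -/
  D : V →ₗ[ℂ] V
  /-- `D` has weight `1`. -/
  D_weight : ∀ n : ℝ, ∀ v ∈ 𝒱 n, D v ∈ 𝒱 (n + 1)
  /-- Vertex map weight property. -/
  weight : ∀ n₁ n₂ : ℝ, ∃ N : Finset ℝ,
    ∀ u ∈ ⨆ k : ℤ, 𝒱 (n₁ + k), ∀ v ∈ ⨆ k : ℤ, 𝒱 (n₂ + k), ∀ r : ℝ, 0 < r →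
      ∀ n : ℝ, Y r u v n ≠ 0 → ∃ m ∈ N, ∃ k : ℤ, n = m + k
  /-- Identity property. -/
  identity : ∀ r : ℝ, 0 < r → ∀ v : V, Y r vac v = embed 𝒱 v
  /-- Creation property. -/
  creation : ∀ (u : V) (f : GradedDual 𝒱),
    Filter.Tendsto (fun r : ℝ => pairing 𝒱 f (Y r u vac)) (𝓝[>] 0)
      (𝓝 (pairing 𝒱 f (embed 𝒱 u)))
  /-- Local truncation property for the adjoint of `D`. -/
  local_truncation : ∀ f : GradedDual 𝒱, ∃ k : ℕ, 0 < k ∧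
    ∀ v : V, pairing 𝒱 f (embed 𝒱 ((D ^ k) v)) = 0
  /-- Absolute convergence of products. -/
  product_summable : ∀ (k : ℕ) (v : Fin (k + 1) → V) (r : Fin (k + 1) → ℝ) (w : V)
    (f : GradedDual 𝒱), StrictAnti r → (∀ i, 0 < r i) →
      Summable fun m : Fin k → ℝ => pairing 𝒱 f (productTerm 𝒱 Y k v r m w)
  /-- Absolute convergence of iterates. -/
  iterate_summable : ∀ (v₁ v₂ w : V) (f : GradedDual 𝒱) (r₀ r₂ : ℝ), 0 < r₀ → r₀ < r₂ →
    Summable fun m : ℝ => pairing 𝒱 f (Y r₂ (proj 𝒱 m (Y r₀ v₁ v₂)) w)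
  /-- Associativity. -/
  associativity : ∀ (v₁ v₂ w : V) (f : GradedDual 𝒱) (r₁ r₂ : ℝ),
    r₂ < r₁ → r₁ - r₂ < r₂ → 0 < r₁ - r₂ →
      ∑' m : ℝ, pairing 𝒱 f (Y r₁ v₁ (proj 𝒱 m (Y r₂ v₂ w))) =
        ∑' m : ℝ, pairing 𝒱 f (Y r₂ (proj 𝒱 m (Y (r₁ - r₂) v₁ v₂)) w)
  /-- The `𝐝`-bracket property `[𝐝, Y(u, r)] = Y(𝐝 u, r) + r d/dr Y(u, r)`; that the derivative
  exists is part of the `D`-derivative property. -/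
  d_bracket : ∀ (u v : V) (f : GradedDual 𝒱) (r : ℝ), 0 < r →
    pairing 𝒱 f (gradingCompletion 𝒱 (Y r u v) - Y r u (grading 𝒱 v)) =
      pairing 𝒱 f (Y r (grading 𝒱 u) v) +
        (r : ℂ) * deriv (fun s : ℝ => pairing 𝒱 f (Y s u v)) r
  /-- The `D`-derivative property, first half: `d/dr Y(u, r) = [D, Y(u, r)]`. -/
  D_derivative : ∀ (u v : V) (f : GradedDual 𝒱) (r : ℝ), 0 < r →
    HasDerivAt (fun s : ℝ => pairing 𝒱 f (Y s u v))
      (pairing 𝒱 f (extendWeightOne 𝒱 D D_weight (Y r u v) - Y r u (D v))) r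
  /-- The `D`-derivative property, second half: `[D, Y(u, r)] = Y(D u, r)`. -/
  D_bracket : ∀ (u v : V) (r : ℝ), 0 < r →
    extendWeightOne 𝒱 D D_weight (Y r u v) - Y r u (D v) = Y r (D u) v

namespace OpenStringVertexAlgebra

variable {𝒱 : ℝ → Submodule ℂ V} [DirectSum.Decomposition 𝒱]

/-- The grading-restriction conditions. -/
def GradingRestricted (_A : OpenStringVertexAlgebra 𝒱) : Prop :=
  (∀ n : ℝ, FiniteDimensional ℂ (𝒱 n)) ∧ ∃ N : ℝ, ∀ n : ℝ, n < N → 𝒱 n = ⊥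

variable (A : OpenStringVertexAlgebra 𝒱)

/-- For `u` of weight `a` and `v` of weight `b`, the vector `P_{a+b-n-1} Y^O(u, 1) v`. -/
def homogeneousMode (n a b : ℝ) : 𝒱 a →ₗ[ℂ] 𝒱 b →ₗ[ℂ] V :=
  ((A.Y 1).domRestrict₁₂ (𝒱 a) (𝒱 b)).compr₂ (proj 𝒱 (a + b - n - 1))

/-- The formal vertex operator map `𝒴^f(u, x) v = ∑_{n ∈ ℝ} (u⁺ₙ v) x^{-n-1}`, given by its
coefficients `u⁺ₙ v = A.mode n u v`: for `u` of weight `a` and `v` of weight `b`,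
`u⁺ₙ v = P_{a+b-n-1} Y^O(u, 1) v`, extended bilinearly. -/
def mode (n : ℝ) : V →ₗ[ℂ] V →ₗ[ℂ] V :=
  (DirectSum.toModule ℂ ℝ ((⨁ i, 𝒱 i) →ₗ[ℂ] V) fun a =>
    (DirectSum.toModule ℂ ℝ (𝒱 a →ₗ[ℂ] V) fun b => (A.homogeneousMode n a b).flip).flip).compl₁₂
      (DirectSum.decomposeLinearEquiv 𝒱 : V →ₗ[ℂ] ⨁ i, 𝒱 i)
      (DirectSum.decomposeLinearEquiv 𝒱 : V →ₗ[ℂ] ⨁ i, 𝒱 i)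

theorem mode_of_mem {a b : ℝ} {u v : V} (hu : u ∈ 𝒱 a) (hv : v ∈ 𝒱 b) (n : ℝ) :
    A.mode n u v = proj 𝒱 (a + b - n - 1) (A.Y 1 u v) := by
  have h1 : DirectSum.decomposeLinearEquiv 𝒱 u = DirectSum.lof ℂ ℝ (fun i => 𝒱 i) a ⟨u, hu⟩ :=
    DirectSum.decompose_of_mem 𝒱 hu
  have h2 : DirectSum.decomposeLinearEquiv 𝒱 v = DirectSum.lof ℂ ℝ (fun i => 𝒱 i) b ⟨v, hv⟩ :=
    DirectSum.decompose_of_mem 𝒱 hv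
  simp only [mode, LinearMap.compl₁₂_apply, LinearEquiv.coe_coe, h1, h2, DirectSum.toModule_lof,
    LinearMap.flip_apply]
  rfl

/-- The meromorphic center `C₀(V)`: the `u ∈ ⨁_{n ∈ ℤ} V₍ₙ₎` such that `𝒴^f(u, x)` has only
integral powers of `x` and `𝒴^f(v, x) u = e^{xD} 𝒴^f(u, -x) v` for all `v ∈ V`, where
`(-x)^m = e^{m π i} x^m`.  The last equation is stated for the coefficient of `x^{-n-1}`, for
each `n`; the coefficient of `x^{-n-1}` in `e^{xD} 𝒴^f(u, -x) v` is
`∑_{j ≥ 0} e^{(-(n+j)-1) π i} (1/j!) D^j u⁺_{n+j} v`, a sum in the weak topology (for each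
element of the graded dual only finitely many terms are nonzero). -/
def meromorphicCenter : Submodule ℂ V where
  carrier := {u |
    u ∈ ⨆ k : ℤ, 𝒱 (k : ℝ) ∧
    (∀ n : ℝ, (∀ k : ℤ, n ≠ k) → A.mode n u = 0) ∧
    ∀ (v : V) (n : ℝ) (f : GradedDual 𝒱),
      HasSum
        (fun j : ℕ => pairing 𝒱 f (embed 𝒱
          ((Complex.exp ((-((n : ℂ) + j) - 1) * Real.pi * Complex.I) * (1 / (j.factorial : ℂ))) •
            (A.D ^ j) (A.mode (n + j) u v))))
        (pairing 𝒱 f (embed 𝒱 (A.mode n v u)))}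
  zero_mem' := by
    refine ⟨zero_mem _, fun n _ => map_zero _, fun v n f => ?_⟩
    simp
  add_mem' := by
    rintro u w ⟨hu1, hu2, hu3⟩ ⟨hw1, hw2, hw3⟩
    refine ⟨add_mem hu1 hw1, fun n hn => by rw [map_add, hu2 n hn, hw2 n hn, add_zero],
      fun v n f => ?_⟩
    simpa only [map_add, LinearMap.add_apply, smul_add] using (hu3 v n f).add (hw3 v n f)
  smul_mem' := by
    rintro c u ⟨hu1, hu2, hu3⟩
    refine ⟨Submodule.smul_mem _ c hu1, fun n hn => by rw [map_smul, hu2 n hn, smul_zero],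
      fun v n f => ?_⟩
    have h := (hu3 v n f).mul_left c
    simpa only [map_smul, LinearMap.smul_apply, smul_eq_mul, mul_left_comm] using h

end OpenStringVertexAlgebra

end Algebra

/-- The restriction of a bilinear map to a subspace that is closed under it. -/
def restrictBilinear {V : Type*} [AddCommGroup V] [Module ℂ V] (C : Submodule ℂ V)
    (B : V →ₗ[ℂ] V →ₗ[ℂ] V) (h : ∀ u ∈ C, ∀ v ∈ C, B u v ∈ C) : C →ₗ[ℂ] C →ₗ[ℂ] C :=
  LinearMap.mk₂ ℂ (fun u v => (⟨B u v, h u u.2 v v.2⟩ : C))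
    (fun u₁ u₂ v => by ext; simp) (fun c u v => by ext; simp)
    (fun u v₁ v₂ => by ext; simp) (fun c u v => by ext; simp)

/-- A grading-restricted vertex algebra `A = ⨁_{n ∈ ℤ} 𝒜 n` with vertex operator map
`Y(u, x) v = ∑_{n ∈ ℤ} (Y n u v) x^{-n-1}`, vacuum `vac` and operator `D`. -/
structure IsGradingRestrictedVertexAlgebra {A : Type*} [AddCommGroup A] [Module ℂ A]
    (𝒜 : ℤ → Submodule ℂ A) (Y : ℤ → A →ₗ[ℂ] A →ₗ[ℂ] A) (vac : A) (D : A →ₗ[ℂ] A) : Prop where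
  /-- `A` is the direct sum of its homogeneous subspaces. -/
  graded : DirectSum.IsInternal 𝒜
  finiteDimensional : ∀ n : ℤ, FiniteDimensional ℂ (𝒜 n)
  lower_truncation : ∃ N : ℤ, ∀ n : ℤ, n < N → 𝒜 n = ⊥
  vac_mem : vac ∈ 𝒜 0
  D_weight : ∀ n : ℤ, ∀ u ∈ 𝒜 n, D u ∈ 𝒜 (n + 1)
  /-- `Y(u, x) v` has only finitely many negative powers of `x`. -/
  truncation : ∀ u v : A, ∃ N : ℤ, ∀ n : ℤ, N ≤ n → Y n u v = 0
  /-- Identity property `Y(1, x) = id`. -/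
  identity : ∀ (n : ℤ) (v : A), Y n vac v = if n = -1 then v else 0
  /-- Creation property: `Y(u, x) 1` is a power series in `x`... -/
  creation_nonneg : ∀ (u : A) (n : ℤ), 0 ≤ n → Y n u vac = 0
  /-- ... with constant term `u`. -/
  creation : ∀ u : A, Y (-1) u vac = u
  /-- The `𝐝`-bracket property `[𝐝, Y(u, x)] = Y(𝐝 u, x) + x d/dx Y(u, x)`, which says that the
  coefficient `uₙ` has weight `wt u - n - 1`. -/
  weight : ∀ (a b n : ℤ), ∀ u ∈ 𝒜 a, ∀ v ∈ 𝒜 b, Y n u v ∈ 𝒜 (a + b - n - 1)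
  /-- `Y(D u, x) = d/dx Y(u, x)`. -/
  D_derivative : ∀ (n : ℤ) (u v : A), Y n (D u) v = (-(n : ℂ)) • Y (n - 1) u v
  /-- `[D, Y(u, x)] = Y(D u, x)`. -/
  D_bracket : ∀ (n : ℤ) (u v : A), D (Y n u v) - Y n u (D v) = Y n (D u) v
  /-- The Jacobi identity
  `x₀⁻¹ δ((x₁ - x₂)/x₀) Y(u, x₁) Y(v, x₂) - x₀⁻¹ δ((x₂ - x₁)/(-x₀)) Y(v, x₂) Y(u, x₁)
    = x₂⁻¹ δ((x₁ - x₀)/x₂) Y(Y(u, x₀) v, x₂)`,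
  as the equality of the coefficients of `x₀^{-l-1} x₁^{-m-1} x₂^{-n-1}`. -/
  jacobi : ∀ (l m n : ℤ) (u v w : A),
    (∑ᶠ i : ℕ, ((-1 : ℤ) ^ i * Ring.choose l i) • Y (m + l - i) u (Y (n + i) v w)) -
      (∑ᶠ i : ℕ, ((l.negOnePow : ℤ) * (-1 : ℤ) ^ i * Ring.choose l i) •
        Y (n + l - i) v (Y (m + i) u w)) =
      ∑ᶠ i : ℕ, (Ring.choose m i) • Y (m + n - i) (Y (l + i) u v) w

/-- `W = ⨁_{n ∈ ℝ} 𝒲 n` is an (`ℝ`-graded, grading-restricted) module for a grading-restricted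
vertex algebra `A` with the given data, with
vertex operator map `Y_W(u, x) w = ∑_{n ∈ ℤ} (YW n u w) x^{-n-1}` and operator `DW` on `W`. -/
structure IsModule {A : Type*} [AddCommGroup A] [Module ℂ A]
    (𝒜 : ℤ → Submodule ℂ A) (Y : ℤ → A →ₗ[ℂ] A →ₗ[ℂ] A) (vac : A) (D : A →ₗ[ℂ] A)
    {W : Type*} [AddCommGroup W] [Module ℂ W]
    (𝒲 : ℝ → Submodule ℂ W) (YW : ℤ → A →ₗ[ℂ] W →ₗ[ℂ] W) (DW : W →ₗ[ℂ] W) : Prop where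
  graded : DirectSum.IsInternal 𝒲
  finiteDimensional : ∀ n : ℝ, FiniteDimensional ℂ (𝒲 n)
  lower_truncation : ∃ N : ℝ, ∀ n : ℝ, n < N → 𝒲 n = ⊥
  D_weight : ∀ n : ℝ, ∀ w ∈ 𝒲 n, DW w ∈ 𝒲 (n + 1)
  truncation : ∀ (u : A) (w : W), ∃ N : ℤ, ∀ n : ℤ, N ≤ n → YW n u w = 0
  identity : ∀ (n : ℤ) (w : W), YW n vac w = if n = -1 then w else 0
  weight : ∀ (a n : ℤ) (b : ℝ), ∀ u ∈ 𝒜 a, ∀ w ∈ 𝒲 b, YW n u w ∈ 𝒲 (a + b - n - 1)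
  D_derivative : ∀ (n : ℤ) (u : A) (w : W), YW n (D u) w = (-(n : ℂ)) • YW (n - 1) u w
  D_bracket : ∀ (n : ℤ) (u : A) (w : W), DW (YW n u w) - YW n u (DW w) = YW n (D u) w
  jacobi : ∀ (l m n : ℤ) (u v : A) (w : W),
    (∑ᶠ i : ℕ, ((-1 : ℤ) ^ i * Ring.choose l i) • YW (m + l - i) u (YW (n + i) v w)) -
      (∑ᶠ i : ℕ, ((l.negOnePow : ℤ) * (-1 : ℤ) ^ i * Ring.choose l i) •
        YW (n + l - i) v (YW (m + i) u w)) =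
      ∑ᶠ i : ℕ, (Ring.choose m i) • YW (m + n - i) (Y (l + i) u v) w

/-- `𝒴(w₁, x) w₂ = ∑_{n ∈ ℝ} (I n w₁ w₂) x^{-n-1}` is an intertwining operator of type
`W₃` over `W₁ W₂`, where `Wᵢ` is a module with vertex operator map `Yᵢ`, operator `Dᵢ` and
grading `𝒲ᵢ` for the same vertex algebra, with underlying space `A`.  The first three conditions
are those of the usual definition for a vertex operator algebra; the last two, which are
compatibility with `D` and with the grading, follow from them in that case by means of
the conformal element, and have to be required in the absence of one. -/
structure IsIntertwiningOperator {A : Type*} [AddCommGroup A] [Module ℂ A]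
    {W₁ : Type*} [AddCommGroup W₁] [Module ℂ W₁]
    {W₂ : Type*} [AddCommGroup W₂] [Module ℂ W₂]
    {W₃ : Type*} [AddCommGroup W₃] [Module ℂ W₃]
    (𝒲₁ : ℝ → Submodule ℂ W₁) (Y₁ : ℤ → A →ₗ[ℂ] W₁ →ₗ[ℂ] W₁) (D₁ : W₁ →ₗ[ℂ] W₁)
    (𝒲₂ : ℝ → Submodule ℂ W₂) (Y₂ : ℤ → A →ₗ[ℂ] W₂ →ₗ[ℂ] W₂) (D₂ : W₂ →ₗ[ℂ] W₂)
    (𝒲₃ : ℝ → Submodule ℂ W₃) (Y₃ : ℤ → A →ₗ[ℂ] W₃ →ₗ[ℂ] W₃) (D₃ : W₃ →ₗ[ℂ] W₃)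
    (I : ℝ → W₁ →ₗ[ℂ] W₂ →ₗ[ℂ] W₃) : Prop where
  truncation : ∀ (w₁ : W₁) (w₂ : W₂), ∃ N : ℝ, ∀ n : ℝ, N ≤ n → I n w₁ w₂ = 0
  /-- The Jacobi identity for `Y(u, x₁)` and `𝒴(w₁, x₂)`. -/
  jacobi : ∀ (l m : ℤ) (n : ℝ) (u : A) (w₁ : W₁) (w₂ : W₂),
    (∑ᶠ i : ℕ, ((-1 : ℤ) ^ i * Ring.choose l i) • Y₃ (m + l - i) u (I (n + i) w₁ w₂)) -
      (∑ᶠ i : ℕ, ((l.negOnePow : ℤ) * (-1 : ℤ) ^ i * Ring.choose l i) •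
        I (n + l - i) w₁ (Y₂ (m + i) u w₂)) =
      ∑ᶠ i : ℕ, (Ring.choose m i) • I (m + n - i) (Y₁ (l + i) u w₁) w₂
  /-- `𝒴(D w₁, x) = d/dx 𝒴(w₁, x)`. -/
  D_derivative : ∀ (n : ℝ) (w₁ : W₁) (w₂ : W₂),
    I n (D₁ w₁) w₂ = (-(n : ℂ)) • I (n - 1) w₁ w₂
  /-- `[D, 𝒴(w₁, x)] = 𝒴(D w₁, x)`. -/
  D_bracket : ∀ (n : ℝ) (w₁ : W₁) (w₂ : W₂),
    D₃ (I n w₁ w₂) - I n w₁ (D₂ w₂) = I n (D₁ w₁) w₂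
  /-- The `𝐝`-bracket property. -/
  weight : ∀ (a b n : ℝ), ∀ w₁ ∈ 𝒲₁ a, ∀ w₂ ∈ 𝒲₂ b, I n w₁ w₂ ∈ 𝒲₃ (a + b - n - 1)

end OpenString

end

/-!
The substance of the theorem is the Jacobi identity for an element `u` of the meromorphic center
and two arbitrary vectors `v` and `w`. It is equivalent to the statement that the three series

* `∑ f_p z^(-p-1)`, with `f_p` a matrix coefficient of `u_p v_{s-p} w`, for `|z| > 1`,
* `∑ g_p (z-1)^(-p-1)`, with `g_p` the matrix coefficient of `(u_p v)_{s-p} w`, for `0 < |z-1| < 1`,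
* `∑ h_p z^(-p-1)`, with `h_p` the matrix coefficient of `v_{s-p} u_p w`, for `0 < |z| < 1`,

are the expansions of one rational function with poles only at `0`, `1` and `∞`. The first two
series agree for `1 < z < 2` by associativity, the last two for `2/3 < z < 1` by associativity and
skew-symmetry of `u` with `v` (`tsum_iterate_skew`). The three domains leave out the part of the
circle `|z| = 1` with `|z - 1| ≥ 1`, on which so far there might be a natural boundary. The gap is
closed by the convergence of products of three vertex operators: with the last one applied to the
vacuum, it shows that the first series, re-expanded around `1/4`, converges for `|z - 1/4| > 3/4`
(`summable_reexpanded_product`), a domain which together with the two others covers the plane.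
After multiplication with powers of `z` and `z - 1` the three functions glue to an entire function
(`exists_entire_of_expansions`); it has polynomial growth, so that it is a polynomial. For the
expansions of a polynomial the Jacobi identity is an induction by means of Pascal's rule
(`jacobiDefect_poly`), and the factors `z` and `z - 1` only shift its exponents
(`jacobiDefect_eq_zero_of_polynomial`). The result is `jacobi_of_mem_center`.

The rest is formal. The commutator and associator formulas, the cases `l = 0` and `m = 0` of the
Jacobi identity, show that skew-symmetry passes from `u` and `v` to `u_n v` (`mode_right_mode`), so
that the meromorphic center is closed under the vertex operators. The creation property gives
`Y(u, x) 1 = e^{xD} u`, which is the skew-symmetry of the vacuum. As `D u = u_{-2} 1`, the operator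
`D` preserves the meromorphic center.
-/

noncomputable section

namespace OpenString

/-! ### The scalar Jacobi identity -/

/-- The difference of the two sides of the Jacobi identity for three families of scalars. Here
`f`, `h` and `g` stand for the expansions `∑ f p z^(-p-1)` at `∞`, `∑ h p z^(-p-1)` at `0` and
`∑ g p (z-1)^(-p-1)` at `1`. -/
def jacobiDefect (f g h : ℤ → ℂ) (l m : ℤ) : ℂ :=
  (∑' i : ℕ, (((-1 : ℤ) ^ i * Ring.choose l i : ℤ) : ℂ) * f (m + l - i)) -
    (∑' i : ℕ, (((l.negOnePow : ℤ) * (-1 : ℤ) ^ i * Ring.choose l i : ℤ) : ℂ) * h (m + i)) -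
      ∑' i : ℕ, ((Ring.choose m i : ℤ) : ℂ) * g (l + i)

/-- `f` vanishes in all sufficiently negative degrees. -/
def BddBelowSupport (f : ℤ → ℂ) : Prop := ∃ N : ℤ, ∀ p < N, f p = 0

/-- `f` vanishes in all sufficiently positive degrees. -/
def BddAboveSupport (f : ℤ → ℂ) : Prop := ∃ N : ℤ, ∀ p ≥ N, f p = 0

theorem BddBelowSupport.shift {f : ℤ → ℂ} (hf : BddBelowSupport f) (k : ℤ) :
    BddBelowSupport fun p => f (p + k) := by
  obtain ⟨N, hN⟩ := hf
  exact ⟨N - k, fun p hp => hN _ (by lia)⟩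

theorem BddAboveSupport.shift {f : ℤ → ℂ} (hf : BddAboveSupport f) (k : ℤ) :
    BddAboveSupport fun p => f (p + k) := by
  obtain ⟨N, hN⟩ := hf
  exact ⟨N - k, fun p hp => hN _ (by lia)⟩

theorem BddBelowSupport.linear {f f' : ℤ → ℂ} (hf : BddBelowSupport f) (hf' : BddBelowSupport f')
    (x : ℂ) : BddBelowSupport fun p => f p + x * f' p := by
  obtain ⟨N, hN⟩ := hf
  obtain ⟨N', hN'⟩ := hf'
  exact ⟨min N N', fun p hp => by simp [hN p (by lia), hN' p (by lia)]⟩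

theorem BddAboveSupport.linear {f f' : ℤ → ℂ} (hf : BddAboveSupport f) (hf' : BddAboveSupport f')
    (x : ℂ) : BddAboveSupport fun p => f p + x * f' p := by
  obtain ⟨N, hN⟩ := hf
  obtain ⟨N', hN'⟩ := hf'
  exact ⟨max N N', fun p hp => by simp [hN p (by lia), hN' p (by lia)]⟩

theorem summable_of_eventually_zero {t : ℕ → ℂ} (N : ℤ) (h : ∀ i : ℕ, N ≤ i → t i = 0) :
    Summable t :=
  summable_of_ne_finset_zero (s := Finset.range N.toNat) fun i hi => h i (by
    simp only [Finset.mem_range, not_lt] at hi; lia)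

theorem BddBelowSupport.summable {f : ℤ → ℂ} (hf : BddBelowSupport f) (c : ℕ → ℂ) (k : ℤ) :
    Summable fun i : ℕ => c i * f (k - i) := by
  obtain ⟨N, hN⟩ := hf
  exact summable_of_eventually_zero (k - N + 1) fun i hi => by rw [hN _ (by lia), mul_zero]

theorem BddAboveSupport.summable {f : ℤ → ℂ} (hf : BddAboveSupport f) (c : ℕ → ℂ) (k : ℤ) :
    Summable fun i : ℕ => c i * f (k + i) := by
  obtain ⟨N, hN⟩ := hf
  exact summable_of_eventually_zero (N - k) fun i hi => by rw [hN _ (by lia), mul_zero]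

/-- Pascal's rule for the expansion at `∞`. -/
theorem tsum_choose_below_succ {f : ℤ → ℂ} (hf : BddBelowSupport f) (l m : ℤ) :
    ∑' i : ℕ, (((-1 : ℤ) ^ i * Ring.choose (l + 1) i : ℤ) : ℂ) * f (m + (l + 1) - i) =
      (∑' i : ℕ, (((-1 : ℤ) ^ i * Ring.choose l i : ℤ) : ℂ) * f (m + 1 + l - i)) -
      ∑' i : ℕ, (((-1 : ℤ) ^ i * Ring.choose l i : ℤ) : ℂ) * f (m + l - i) := by
  have s1 := hf.summable (fun i => (((-1 : ℤ) ^ i * Ring.choose l i : ℤ) : ℂ)) (m + 1 + l)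
  have s2 := hf.summable (fun i => (((-1 : ℤ) ^ i * Ring.choose l i : ℤ) : ℂ)) (m + l)
  rw [(hf.summable (fun i => (((-1 : ℤ) ^ i * Ring.choose (l + 1) i : ℤ) : ℂ)) _).tsum_eq_zero_add,
    s1.tsum_eq_zero_add]
  refine Eq.trans ?_ ((congrArg _ (((summable_nat_add_iff 1).2 s1).tsum_sub s2)).trans
    (add_sub_assoc _ _ _).symm)
  congr 1
  · simp [show m + (l + 1) = m + 1 + l by ring]
  · refine tsum_congr fun i => ?_
    have h1 : m + (l + 1) - ((i + 1 : ℕ) : ℤ) = m + l - i := by push_cast; ring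
    have h2 : m + 1 + l - ((i + 1 : ℕ) : ℤ) = m + l - i := by push_cast; ring
    rw [h1, h2, Ring.choose_succ_succ]
    push_cast
    ring

/-- Pascal's rule for the expansion at `0`. -/
theorem tsum_choose_above_succ {h : ℤ → ℂ} (hh : BddAboveSupport h) (l m : ℤ) :
    ∑' i : ℕ, ((((l + 1).negOnePow : ℤ) * (-1 : ℤ) ^ i * Ring.choose (l + 1) i : ℤ) : ℂ) *
        h (m + i) =
      (∑' i : ℕ, (((l.negOnePow : ℤ) * (-1 : ℤ) ^ i * Ring.choose l i : ℤ) : ℂ) *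
        h (m + 1 + i)) -
      ∑' i : ℕ, (((l.negOnePow : ℤ) * (-1 : ℤ) ^ i * Ring.choose l i : ℤ) : ℂ) * h (m + i) := by
  have s1 := hh.summable
    (fun i => (((l.negOnePow : ℤ) * (-1 : ℤ) ^ i * Ring.choose l i : ℤ) : ℂ)) (m + 1)
  have s2 := hh.summable
    (fun i => (((l.negOnePow : ℤ) * (-1 : ℤ) ^ i * Ring.choose l i : ℤ) : ℂ)) m
  rw [(hh.summable (fun i => ((((l + 1).negOnePow : ℤ) * (-1 : ℤ) ^ i * Ring.choose (l + 1) i : ℤ)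
    : ℂ)) _).tsum_eq_zero_add, s2.tsum_eq_zero_add, sub_add_eq_sub_sub, sub_right_comm,
    sub_eq_neg_add]
  refine Eq.trans ?_ (congrArg _ (s1.tsum_sub ((summable_nat_add_iff 1).2 s2)))
  congr 1
  · simp [Int.negOnePow_succ]
  · refine tsum_congr fun i => ?_
    have h1 : m + ((i + 1 : ℕ) : ℤ) = m + 1 + i := by push_cast; ring
    rw [h1, Ring.choose_succ_succ, Int.negOnePow_succ]
    push_cast
    ring

/-- Pascal's rule for the expansion at `1`. -/
theorem tsum_choose_one_succ {g : ℤ → ℂ} (hg : BddAboveSupport g) (l m : ℤ) :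
    ∑' i : ℕ, ((Ring.choose (m + 1) i : ℤ) : ℂ) * g (l + i) =
      (∑' i : ℕ, ((Ring.choose m i : ℤ) : ℂ) * g (l + i)) +
      ∑' i : ℕ, ((Ring.choose m i : ℤ) : ℂ) * g (l + 1 + i) := by
  have s1 := hg.summable (fun i => ((Ring.choose m i : ℤ) : ℂ)) l
  have s2 := hg.summable (fun i => ((Ring.choose m i : ℤ) : ℂ)) (l + 1)
  rw [(hg.summable (fun i => ((Ring.choose (m + 1) i : ℤ) : ℂ)) l).tsum_eq_zero_add,
    s1.tsum_eq_zero_add, add_assoc]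
  refine Eq.trans ?_ (congrArg _ (((summable_nat_add_iff 1).2 s1).tsum_add s2))
  congr 1
  · simp
  · refine tsum_congr fun i => ?_
    have h1 : l + ((i + 1 : ℕ) : ℤ) = l + 1 + i := by push_cast; ring
    rw [h1, Ring.choose_succ_succ]
    push_cast
    ring

/-- By Pascal's rule, the defects for adjacent exponents determine each other. This reduces the
Jacobi identity of a triple of families to the exponents `l = 0` and `m = 0`. -/
theorem jacobiDefect_succ {f g h : ℤ → ℂ} (hf : BddBelowSupport f) (hg : BddAboveSupport g)
    (hh : BddAboveSupport h) (l m : ℤ) :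
    jacobiDefect f g h (l + 1) m = jacobiDefect f g h l (m + 1) - jacobiDefect f g h l m := by
  simp only [jacobiDefect]
  rw [tsum_choose_below_succ hf, tsum_choose_above_succ hh, tsum_choose_one_succ hg]
  ring

theorem jacobiDefect_linear {f g h f' g' h' : ℤ → ℂ} (hf : BddBelowSupport f)
    (hg : BddAboveSupport g) (hh : BddAboveSupport h) (hf' : BddBelowSupport f')
    (hg' : BddAboveSupport g') (hh' : BddAboveSupport h') (x : ℂ) (l m : ℤ) :
    jacobiDefect (fun p => f p + x * f' p) (fun p => g p + x * g' p) (fun p => h p + x * h' p) l m =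
      jacobiDefect f g h l m + x * jacobiDefect f' g' h' l m := by
  simp only [jacobiDefect, mul_add, mul_sub, mul_left_comm _ x]
  rw [(hf.summable _ _).tsum_add ((hf'.summable _ _).mul_left x),
    (hg.summable _ _).tsum_add ((hg'.summable _ _).mul_left x),
    (hh.summable _ _).tsum_add ((hh'.summable _ _).mul_left x), tsum_mul_left, tsum_mul_left,
    tsum_mul_left]
  ring

/-- Multiplication of the expanded function by `z`. -/
theorem jacobiDefect_mul_z {f g h : ℤ → ℂ} (hg : BddAboveSupport g) (l m : ℤ) :
    jacobiDefect (fun p => f (p + 1)) (fun p => g p + g (p + 1)) (fun p => h (p + 1)) l m =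
      jacobiDefect f g h l (m + 1) := by
  simp only [jacobiDefect, mul_add]
  rw [tsum_choose_one_succ hg, (hg.summable _ l).tsum_add (by
    simpa only [add_right_comm] using hg.summable _ (l + 1))]
  simp only [add_right_comm l _ 1, add_right_comm m _ 1, add_sub_right_comm,
    add_right_comm _ l 1]

/-- Multiplication of the expanded function by `z - 1`. -/
theorem jacobiDefect_mul_z_sub_one {f g h : ℤ → ℂ} (hf : BddBelowSupport f)
    (hh : BddAboveSupport h) (l m : ℤ) :
    jacobiDefect (fun p => f (p + 1) - f p) (fun p => g (p + 1)) (fun p => h (p + 1) - h p) l m =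
      jacobiDefect f g h (l + 1) m := by
  have hf' := hf.shift 1
  have hh' := hh.shift 1
  simp only [jacobiDefect, mul_sub]
  rw [tsum_choose_below_succ hf, tsum_choose_above_succ hh,
    (hf'.summable _ _).tsum_sub (hf.summable _ _), (hh'.summable _ _).tsum_sub (hh.summable _ _)]
  congr! 5
  · ring_nf
  · ring_nf
  · ring_nf

/-- The triple of expansions of the constant function `1` satisfies the Jacobi identity. -/
theorem jacobiDefect_one (l m : ℤ) :
    jacobiDefect (fun p => if p = -1 then 1 else 0) (fun p => if p = -1 then 1 else 0)
      (fun p => if p = -1 then 1 else 0) l m = 0 := by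
  have hb : BddBelowSupport (fun p => if p = -1 then 1 else 0) :=
    ⟨-1, fun p hp => if_neg (by lia)⟩
  have ha : BddAboveSupport (fun p => if p = -1 then 1 else 0) :=
    ⟨0, fun p hp => if_neg (by lia)⟩
  have hrec := jacobiDefect_succ hb ha ha
  set J := jacobiDefect (fun p => if p = -1 then 1 else 0) (fun p => if p = -1 then 1 else 0)
      (fun p => if p = -1 then 1 else 0) with hJ
  have h0 : ∀ m, J 0 m = 0 := by
    intro m
    have e1 : ∀ i : ℕ, i ≠ 0 → Ring.choose (0 : ℤ) i = 0 := fun i hi =>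
      Ring.choose_zero_pos ℤ (Nat.pos_of_ne_zero hi)
    simp only [hJ, jacobiDefect]
    rw [tsum_eq_single 0 (by intro i hi; simp [e1 i hi]),
      tsum_eq_single 0 (by intro i hi; simp [e1 i hi])]
    have e2 : ∀ i : ℕ, ¬ ((i : ℤ) = -1) := by intro i; lia
    simp [e2]
  have h1 : ∀ l, J l 0 = 0 := by
    intro l
    have e1 : ∀ i : ℕ, i ≠ 0 → Ring.choose (0 : ℤ) i = 0 := fun i hi =>
      Ring.choose_zero_pos ℤ (Nat.pos_of_ne_zero hi)
    have e2 : ∀ i : ℕ, ¬ ((i : ℤ) = -1) := by intro i; lia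
    simp only [hJ, jacobiDefect]
    rw [tsum_eq_single 0 (f := fun i : ℕ => ((Ring.choose (0 : ℤ) i : ℤ) : ℂ) * _)
      (by intro i hi; simp [e1 i hi])]
    rcases lt_trichotomy l (-1) with hl | rfl | hl
    · have : ∀ i : ℕ, l - i ≠ -1 := by intro i; lia
      simp [e2, this, hl.ne]
    · rw [tsum_eq_single 0 (by intro i hi; rw [if_neg (by lia), mul_zero])]
      simp [e2]
    · lift l to ℕ using (by lia) with k
      rw [tsum_eq_single (k + 1) (by intro i hi; rw [if_neg (by lia), mul_zero])]
      simp [e2, Ring.choose_natCast]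
  -- the vanishing propagates to all `(l, m)` along the two axes
  have hpos : ∀ k : ℕ, ∀ m, J k m = 0 := by
    intro k
    induction k with
    | zero => exact_mod_cast h0
    | succ k ih => intro m; push_cast; rw [hrec, ih, ih, sub_zero]
  have hneg : ∀ k : ℕ, ∀ m, J (-k) m = 0 := by
    intro k
    induction k with
    | zero => simpa using h0
    | succ k ih =>
      have hstep : ∀ m, J (-(k + 1 : ℕ)) (m + 1) = J (-(k + 1 : ℕ)) m := by
        intro m
        have := hrec (-(k + 1 : ℕ)) m
        rw [show (-((k + 1 : ℕ) : ℤ) + 1) = -(k : ℤ) by push_cast; ring, ih] at this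
        exact (sub_eq_zero.1 this.symm)
      intro m
      induction m using Int.induction_on with
      | zero => exact h1 _
      | succ i hi => rw [hstep, hi]
      | pred i hi =>
        have := hstep (-(i : ℤ) - 1)
        rw [sub_add_cancel] at this
        rw [← this, hi]
  rcases Int.eq_nat_or_neg l with ⟨k, rfl | rfl⟩
  · exact hpos k m
  · exact hneg k m

/-- The coefficients of `z^(-p-1)` in a polynomial, seen as an expansion at `0` or `∞`. -/
def polyCoeff (Q : Polynomial ℂ) (p : ℤ) : ℂ :=
  if p < 0 then Q.coeff (-p - 1).toNat else 0

theorem polyCoeff_bddBelow (Q : Polynomial ℂ) : BddBelowSupport (polyCoeff Q) := by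
  refine ⟨-Q.natDegree - 1, fun p hp => ?_⟩
  rw [polyCoeff, if_pos (by lia)]
  exact Polynomial.coeff_eq_zero_of_natDegree_lt (by lia)

theorem polyCoeff_bddAbove (Q : Polynomial ℂ) : BddAboveSupport (polyCoeff Q) :=
  ⟨0, fun p hp => if_neg (by lia)⟩

theorem polyCoeff_mul_X (Q : Polynomial ℂ) (p : ℤ) :
    polyCoeff (Q * Polynomial.X) p = polyCoeff Q (p + 1) := by
  simp only [polyCoeff]
  rcases lt_trichotomy p (-1) with hp | rfl | hp
  · rw [if_pos (by lia), if_pos (by lia), show (-p - 1).toNat = (-(p + 1) - 1).toNat + 1 by lia,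
      Polynomial.coeff_mul_X]
  · simp
  · rw [if_neg (by lia), if_neg (by lia)]

theorem polyCoeff_add (Q R : Polynomial ℂ) (p : ℤ) :
    polyCoeff (Q + R) p = polyCoeff Q p + polyCoeff R p := by
  simp only [polyCoeff]; split_ifs <;> simp

theorem polyCoeff_C (x : ℂ) (p : ℤ) :
    polyCoeff (Polynomial.C x) p = if p = -1 then x else 0 := by
  simp only [polyCoeff, Polynomial.coeff_C]
  split_ifs <;> first | rfl | lia

/-- The three expansions of a polynomial satisfy the Jacobi identity: it holds for the constant
function `1`, and multiplication by `z` shifts the exponent `m`. -/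
theorem jacobiDefect_poly (Q : Polynomial ℂ) : ∀ l m : ℤ,
    jacobiDefect (polyCoeff Q) (polyCoeff (Polynomial.taylor 1 Q)) (polyCoeff Q) l m = 0 := by
  induction Q using Polynomial.induction_on with
  | C x =>
    intro l m
    have := jacobiDefect_linear (polyCoeff_bddBelow 0) (polyCoeff_bddAbove 0) (polyCoeff_bddAbove 0)
      (polyCoeff_bddBelow (Polynomial.C 1)) (polyCoeff_bddAbove (Polynomial.C 1))
      (polyCoeff_bddAbove (Polynomial.C 1)) x l m
    have h0 : polyCoeff 0 = fun _ => 0 := by funext p; simp [polyCoeff]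
    have h1 : polyCoeff (Polynomial.C 1) = fun p => if p = -1 then 1 else 0 := by
      funext p; rw [polyCoeff_C]
    rw [h0, h1, jacobiDefect_one] at this
    rw [Polynomial.taylor_C]
    convert this using 1
    · congr 1 <;> · funext p; simp [polyCoeff_C]
    · simp [jacobiDefect]
  | add Q R hQ hR =>
    intro l m
    have := jacobiDefect_linear (polyCoeff_bddBelow Q)
      (polyCoeff_bddAbove (Polynomial.taylor 1 Q)) (polyCoeff_bddAbove Q)
      (polyCoeff_bddBelow R) (polyCoeff_bddAbove (Polynomial.taylor 1 R))
      (polyCoeff_bddAbove R) 1 l m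
    rw [hQ, hR] at this
    rw [map_add]
    convert this using 1
    · congr 1 <;> · funext p; simp [polyCoeff_add]
    · simp
  | monomial n x ih =>
    intro l m
    rw [pow_succ, ← mul_assoc, ← ih l (m + 1), ← jacobiDefect_mul_z (polyCoeff_bddAbove _)]
    congr 1
    · funext p; rw [polyCoeff_mul_X]
    · funext p
      rw [Polynomial.taylor_mul, Polynomial.taylor_X, mul_add, polyCoeff_add, polyCoeff_mul_X,
        map_one, mul_one, add_comm]
    · funext p; rw [polyCoeff_mul_X]

/-! ### Binomial re-expansion -/

/-- The binomial series with an arbitrary real exponent. -/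
theorem hasSum_choose_rpow (e : ℝ) {x t : ℝ} (ht : |t| < x) :
    HasSum (fun j : ℕ => Ring.choose e j * x ^ (e - j) * t ^ j) ((x + t) ^ e) := by
  have hx : 0 < x := (abs_nonneg t).trans_lt ht
  have h := (Real.one_add_rpow_hasFPowerSeriesOnBall_zero (a := e)).hasSum (y := t / x) (by
    rw [← ENNReal.ofReal_one, Metric.eball_ofReal, mem_ball_zero_iff, Real.norm_eq_abs, abs_div,
      abs_of_pos hx, div_lt_one hx]
    exact ht)
  have h1 : HasSum (fun j : ℕ => Ring.choose e j * (t / x) ^ j) ((1 + (0 + t / x)) ^ e) := by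
    refine h.congr_fun ?_
    intro j
    rw [binomialSeries_apply]
    simp only [List.ofFn_const, List.prod_replicate, smul_eq_mul]
  have h2 := h1.mul_left (x ^ e)
  have e1 : (fun j : ℕ => Ring.choose e j * x ^ (e - j) * t ^ j) =
      fun j : ℕ => x ^ e * (Ring.choose e j * (t / x) ^ j) := by
    funext j
    rw [Real.rpow_sub_natCast hx.ne', div_pow]
    field_simp
  have e2 : (x + t) ^ e = x ^ e * (1 + (0 + t / x)) ^ e := by
    rw [zero_add, ← Real.mul_rpow hx.le]
    · congr 1; field_simp
    · have := (abs_lt.1 ht).1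
      rw [show 1 + t / x = (x + t) / x by field_simp]
      exact div_nonneg (by linarith) hx.le
  rw [e1, e2]
  exact h2

theorem abs_choose_of_nonpos {e : ℝ} (he : e ≤ 0) (j : ℕ) :
    |Ring.choose e j| = (-1) ^ j * Ring.choose e j := by
  have h1 : Ring.choose e j = (-1) ^ j * Ring.multichoose (-e) j := by
    have := Ring.choose_neg (-e) j
    rw [neg_neg] at this
    rw [this, Ring.multichoose_eq, Int.negOnePow_def]
    simp [Units.smul_def]
  have h2 : 0 ≤ Ring.multichoose (-e) j := by
    have := Ring.factorial_nsmul_multichoose_eq_ascPochhammer (-e) j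
    rw [Polynomial.ascPochhammer_smeval_eq_eval, nsmul_eq_mul] at this
    have h3 : 0 ≤ (ascPochhammer ℝ j).eval (-e) := by
      clear h1 this
      induction j with
      | zero => simp
      | succ j ih =>
        rw [ascPochhammer_succ_eval]
        have : (0 : ℝ) ≤ j := j.cast_nonneg
        exact mul_nonneg ih (by linarith)
    rw [← this] at h3
    exact nonneg_of_mul_nonneg_right h3 (by positivity)
  rw [h1, abs_mul, abs_pow, abs_neg, abs_one, one_pow, one_mul, abs_of_nonneg h2, ← mul_assoc,
    ← mul_pow]
  simp

theorem hasSum_abs_choose_rpow {e : ℝ} (he : e ≤ 0) {x t : ℝ} (ht : |t| < x) :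
    HasSum (fun j : ℕ => |Ring.choose e j * x ^ (e - j) * t ^ j|) ((x - |t|) ^ e) := by
  have hx : 0 < x := (abs_nonneg t).trans_lt ht
  have h := hasSum_choose_rpow e (x := x) (t := -|t|) (by simpa using ht)
  rw [← sub_eq_add_neg] at h
  convert h using 2 with j
  rw [abs_mul, abs_mul, abs_choose_of_nonpos he, abs_of_pos (Real.rpow_pos_of_pos hx _), abs_pow,
    neg_pow |t|]
  ring

theorem hasSum_antidiagonal {F : ℕ × ℕ → ℂ} {a : ℂ} (h : HasSum F a) :
    HasSum (fun m => ∑ x ∈ Finset.HasAntidiagonal.antidiagonal m, F x) a := by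
  have h2 := (Finset.HasAntidiagonal.sigmaAntidiagonalEquivProd.hasSum_iff (f := F)).2 h
  have h3 := h2.sigma (g := fun m => ∑ x ∈ Finset.HasAntidiagonal.antidiagonal m, F x) fun m => by
    have := Finset.hasSum (Finset.HasAntidiagonal.antidiagonal m) F
    exact this
  exact h3

/-- Re-expansion of a series of powers of `x + t` in powers of `x`. -/
theorem hasSum_reexpand (e : ℝ) (c : ℕ → ℂ) {x t : ℝ} (ht : |t| < x)
    (hc : Summable fun n : ℕ => ‖c n‖ * (x - |t|) ^ (e - n)) :
    HasSum (fun m : ℕ => ((x ^ (e - m) : ℝ) : ℂ) * ∑ y ∈ Finset.HasAntidiagonal.antidiagonal m,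
        c y.1 * ((Ring.choose (e - y.1) y.2 * t ^ y.2 : ℝ) : ℂ))
      (∑' n : ℕ, c n * (((x + t) ^ (e - n) : ℝ) : ℂ)) := by
  have hrow : ∀ n : ℕ, HasSum (fun j : ℕ => c n *
      ((Ring.choose (e - n) j * x ^ (e - n - j) * t ^ j : ℝ) : ℂ))
      (c n * (((x + t) ^ (e - n) : ℝ) : ℂ)) := fun n =>
    ((Complex.hasSum_ofReal).2 (hasSum_choose_rpow (e - n) ht)).mul_left _
  have hrow' : ∀ n : ℕ, Summable (fun j : ℕ => ‖c n *
      ((Ring.choose (e - n) j * x ^ (e - n - j) * t ^ j : ℝ) : ℂ)‖) := fun n =>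
    (hrow n).summable.norm
  have hsum : Summable (fun y : ℕ × ℕ => c y.1 *
      ((Ring.choose (e - y.1) y.2 * x ^ (e - y.1 - y.2) * t ^ y.2 : ℝ) : ℂ)) := by
    refine Summable.of_norm ?_
    rw [summable_prod_of_nonneg (fun _ => norm_nonneg _)]
    refine ⟨hrow', ?_⟩
    obtain ⟨n₀, hn₀⟩ := exists_nat_ge e
    rw [← summable_nat_add_iff n₀]
    refine ((summable_nat_add_iff n₀).2 hc).congr fun n => ?_
    have he : e - ((n + n₀ : ℕ) : ℝ) ≤ 0 := by
      push_cast; linarith [(Nat.cast_nonneg n : (0 : ℝ) ≤ n)]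
    have := (hasSum_abs_choose_rpow he ht).mul_left ‖c (n + n₀)‖
    rw [← this.tsum_eq]
    refine tsum_congr fun j => ?_
    rw [norm_mul, Complex.norm_real, Real.norm_eq_abs]
  have htot := hsum.hasSum
  have h1 := htot.prod_fiberwise hrow
  rw [h1.tsum_eq]
  convert hasSum_antidiagonal htot using 2 with m
  rw [Finset.mul_sum]
  refine Finset.sum_congr rfl fun y hy => ?_
  rw [← Finset.HasAntidiagonal.mem_antidiagonal.1 hy]
  push_cast
  rw [show e - ((y.1 : ℝ) + y.2) = e - y.1 - y.2 by ring]
  ring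

/-! ### Power series and polynomials -/

theorem differentiableOn_powerSeries {c : ℕ → ℂ} {R : ℝ}
    (hc : ∀ r : ℝ, 0 < r → r < R → Summable fun n : ℕ => ‖c n‖ * r ^ n) :
    DifferentiableOn ℂ (fun z => ∑' n : ℕ, c n * z ^ n) (Metric.ball 0 R) := by
  intro z hz
  rw [mem_ball_zero_iff] at hz
  obtain ⟨r, hr1, hr2⟩ := exists_between hz
  have hr0 : 0 < r := (norm_nonneg z).trans_lt hr1
  have h := Complex.differentiableOn_tsum_of_summable_norm (F := fun (n : ℕ) (z : ℂ) => c n * z ^ n)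
    (U := Metric.ball 0 r) (hc r hr0 hr2) (fun n => by fun_prop)
    (Metric.isOpen_ball (x := (0 : ℂ)) (ε := r))
    (fun n w hw => by
      rw [norm_mul, norm_pow]
      have := (mem_ball_zero_iff.1 hw).le
      gcongr)
  exact ((h z (mem_ball_zero_iff.2 hr1)).differentiableAt
    (Metric.isOpen_ball.mem_nhds (mem_ball_zero_iff.2 hr1))).differentiableWithinAt

/-- A convergent power series that vanishes for small positive arguments is zero. -/
theorem powerSeries_eq_zero {c : ℕ → ℂ} {ε : ℝ} (hε : 0 < ε)
    (h : ∀ y : ℝ, 0 < y → y < ε → HasSum (fun n : ℕ => c n * (y : ℂ) ^ n) 0) : c = 0 := by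
  have hsum : ∀ r : ℝ, 0 < r → r < ε → Summable fun n : ℕ => ‖c n‖ * r ^ n := by
    intro r h0 h1
    refine (h r h0 h1).summable.norm.congr fun n => ?_
    rw [norm_mul, norm_pow, Complex.norm_real, Real.norm_of_nonneg h0.le]
  obtain ⟨r, hr0, hr⟩ := exists_between hε
  have hrad : ENNReal.ofReal r ≤ (FormalMultilinearSeries.ofScalars ℂ c).radius := by
    refine FormalMultilinearSeries.le_radius_of_summable_norm _ (r := r.toNNReal) ?_
    refine (hsum r hr0 hr).congr fun n => ?_
    rw [FormalMultilinearSeries.ofScalars_norm, Real.coe_toNNReal _ hr0.le]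
  have hps := (FormalMultilinearSeries.ofScalars ℂ c).hasFPowerSeriesOnBall
    ((ENNReal.ofReal_pos.2 hr0).trans_le hrad)
  have hev : ∀ᶠ z in 𝓝 (0 : ℂ), (FormalMultilinearSeries.ofScalars ℂ c).sum z = 0 := by
    refine (hps.analyticAt.frequently_zero_iff_eventually_zero).1 ?_
    have hlim : Filter.Tendsto (fun y : ℝ => (y : ℂ)) (𝓝[>] 0) (𝓝[≠] 0) := by
      refine tendsto_nhdsWithin_iff.2 ⟨?_, ?_⟩
      · exact (Complex.continuous_ofReal.tendsto' 0 0 (by simp)).mono_left nhdsWithin_le_nhds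
      · filter_upwards [self_mem_nhdsWithin] with y hy
        simpa using (ne_of_gt hy)
    refine hlim.frequently (Filter.Eventually.frequently ?_)
    filter_upwards [Ioo_mem_nhdsGT hε] with y hy
    rw [← (h y hy.1 hy.2).tsum_eq, ← FormalMultilinearSeries.ofScalarsSum,
      FormalMultilinearSeries.ofScalarsSum_eq_tsum]
    simp
  have hz := (hps.hasFPowerSeriesAt.congr hev).eq_zero
  exact (FormalMultilinearSeries.ofScalars_series_eq_zero ℂ).1 hz

/-- A convergent Laurent series with finitely many negative powers is zero if it vanishes for small
positive arguments. -/
theorem laurentSeries_eq_zero {c : ℤ → ℂ} (N : ℤ) (hN : ∀ p < N, c p = 0) {ε : ℝ} (hε : 0 < ε)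
    (h : ∀ y : ℝ, 0 < y → y < ε → HasSum (fun p : ℤ => c p * (y : ℂ) ^ p) 0) : c = 0 := by
  have h1 : (fun n : ℕ => c (N + n)) = 0 := by
    refine powerSeries_eq_zero hε fun y hy0 hy => ?_
    have hy' : (y : ℂ) ≠ 0 := by exact_mod_cast hy0.ne'
    have hinj : Function.Injective fun n : ℕ => N + (n : ℤ) := fun a b hab => by simpa using hab
    have h2 := (hinj.hasSum_iff (f := fun p : ℤ => c p * (y : ℂ) ^ p) (a := 0) (fun p hp => by
      rw [hN p, zero_mul]
      by_contra! hle
      exact hp ⟨(p - N).toNat, by simp only; lia⟩)).2 (h y hy0 hy)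
    have h3 := h2.mul_left ((y : ℂ) ^ (-N))
    rw [mul_zero] at h3
    refine h3.congr_fun fun n => ?_
    simp only [Function.comp_apply]
    rw [zpow_add₀ hy', zpow_neg, zpow_natCast, mul_left_comm, ← mul_assoc (_⁻¹),
      inv_mul_cancel₀ (zpow_ne_zero _ hy'), one_mul]
  funext p
  by_cases hp : p < N
  · exact hN p hp
  · have := congrFun h1 (p - N).toNat
    rwa [show N + ((p - N).toNat : ℤ) = p by lia] at this

/-- An entire function of polynomial growth is a polynomial. -/
theorem exists_polynomial_of_growth (K : ℕ) : ∀ {f : ℂ → ℂ}, Differentiable ℂ f →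
    ∀ {C R : ℝ}, (∀ z, R ≤ ‖z‖ → ‖f z‖ ≤ C * ‖z‖ ^ K) →
      ∃ Q : Polynomial ℂ, ∀ z, f z = Q.eval z := by
  induction K with
  | zero =>
    intro f hf C R h
    obtain ⟨B, hB⟩ := (isCompact_closedBall (0 : ℂ) R).exists_bound_of_continuousOn
      hf.continuous.continuousOn
    obtain ⟨c, hc⟩ := hf.exists_const_forall_eq_of_bounded (by
      refine (Metric.isBounded_closedBall (x := (0 : ℂ)) (r := max B C)).subset ?_
      rintro _ ⟨z, rfl⟩
      rw [mem_closedBall_zero_iff]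
      rcases le_total R ‖z‖ with hz | hz
      · exact (by simpa using h z hz : ‖f z‖ ≤ C).trans (le_max_right _ _)
      · exact (hB z (mem_closedBall_zero_iff.2 hz)).trans (le_max_left _ _))
    exact ⟨Polynomial.C c, fun z => by simp [hc z]⟩
  | succ K ih =>
    intro f hf C R h
    have hd : Differentiable ℂ (dslope f 0) := by
      intro z
      have := (Complex.differentiableOn_dslope (f := f) (s := Set.univ) (c := 0)
        Filter.univ_mem).2 hf.differentiableOn
      exact differentiableOn_univ.1 this z
    obtain ⟨Q, hQ⟩ := ih hd (C := |C| + ‖f 0‖) (R := max R 1) (by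
      intro z hz
      have hz1 : 1 ≤ ‖z‖ := (le_max_right _ _).trans hz
      have hz0 : z ≠ 0 := norm_pos_iff.1 (by linarith)
      rw [dslope_of_ne _ hz0, slope_def_field, sub_zero, norm_div, div_le_iff₀ (by linarith)]
      calc ‖f z - f 0‖ ≤ ‖f z‖ + ‖f 0‖ := norm_sub_le _ _
        _ ≤ |C| * ‖z‖ ^ (K + 1) + ‖f 0‖ * ‖z‖ ^ (K + 1) := by
          refine add_le_add ((h z ((le_max_left _ _).trans hz)).trans ?_) ?_
          · exact mul_le_mul_of_nonneg_right (le_abs_self C) (by positivity)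
          · exact le_mul_of_one_le_right (norm_nonneg _) (one_le_pow₀ hz1)
        _ = (|C| + ‖f 0‖) * ‖z‖ ^ K * ‖z‖ := by ring)
    refine ⟨Polynomial.C (f 0) + Polynomial.X * Q, fun z => ?_⟩
    have := sub_smul_dslope f 0 z
    simp only [Polynomial.eval_add, Polynomial.eval_C, Polynomial.eval_mul, Polynomial.eval_X]
    rw [← hQ, eq_comm, ← eq_sub_iff_add_eq', ← this, sub_zero, smul_eq_mul]

/-! ### Gluing the three expansions -/

/-- In the coordinate `w = 1 / (1 - z)` the unit disc `‖z‖ < 1` is the half plane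
`1/2 < Re w`. -/
theorem norm_one_sub_inv_lt_one_iff {w : ℂ} (hw : w ≠ 0) : ‖1 - w⁻¹‖ < 1 ↔ 1 / 2 < w.re := by
  rw [show 1 - w⁻¹ = (w - 1) / w by field_simp, norm_div, div_lt_one (norm_pos_iff.2 hw),
    ← sq_lt_sq₀ (norm_nonneg _) (norm_nonneg _), Complex.sq_norm, Complex.sq_norm,
    Complex.normSq_apply, Complex.normSq_apply]
  simp only [Complex.sub_re, Complex.one_re, Complex.sub_im, Complex.one_im]
  constructor <;> intro h <;> nlinarith

/-- In the coordinate `w = 1 / (1 - z)` the exterior of the disc with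
center `1/4` and radius `3/4` is the half plane `Re w < 2/3`. -/
theorem lt_norm_three_quarters_sub_inv_iff {w : ℂ} (hw : w ≠ 0) :
    3 / 4 < ‖1 - w⁻¹ - 1 / 4‖ ↔ w.re < 2 / 3 := by
  have h : 1 - w⁻¹ - 1 / 4 = (3 / 4 : ℝ) * (w - (4 / 3 : ℝ)) / w := by
    push_cast; field_simp; ring
  rw [h, norm_div, lt_div_iff₀ (norm_pos_iff.2 hw), norm_mul, Complex.norm_real,
    Real.norm_of_nonneg (by norm_num), mul_lt_mul_iff_right₀ (by norm_num),
    ← sq_lt_sq₀ (norm_nonneg _) (norm_nonneg _), Complex.sq_norm, Complex.sq_norm,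
    Complex.normSq_apply, Complex.normSq_apply]
  simp only [Complex.sub_re, Complex.ofReal_re, Complex.sub_im, Complex.ofReal_im]
  constructor <;> intro h <;> nlinarith

/-- Identity theorem: holomorphic functions on a convex open set that agree on a nonempty open
subset are equal. -/
theorem eqOn_convex_of_eqOn_open {f g : ℂ → ℂ} {C D : Set ℂ} (hCo : IsOpen C) (hC : Convex ℝ C)
    (hf : DifferentiableOn ℂ f C) (hg : DifferentiableOn ℂ g C) (hD : IsOpen D) {w₀ : ℂ}
    (h0 : w₀ ∈ C) (h0' : w₀ ∈ D) (h : ∀ w ∈ C, w ∈ D → f w = g w) : ∀ w ∈ C, f w = g w :=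
  (hf.analyticOnNhd hCo).eqOn_of_preconnected_of_eventuallyEq (hg.analyticOnNhd hCo)
    hC.isPreconnected h0 (by
      filter_upwards [hCo.mem_nhds h0, hD.mem_nhds h0'] with w h1 h2 using h w h1 h2)

/-- Identity theorem: holomorphic functions on a convex open set that agree on a real interval with
a point of the set inside it are equal. -/
theorem eqOn_convex_of_eqOn_real {f g : ℂ → ℂ} {C : Set ℂ} (hCo : IsOpen C) (hC : Convex ℝ C)
    (hf : DifferentiableOn ℂ f C) (hg : DifferentiableOn ℂ g C) {a b x₀ : ℝ} (ha : a < x₀)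
    (hb : x₀ < b) (h0 : (x₀ : ℂ) ∈ C) (h : ∀ x : ℝ, a < x → x < b → f x = g x) :
    ∀ w ∈ C, f w = g w := by
  refine (hf.analyticOnNhd hCo).eqOn_of_preconnected_of_frequently_eq (hg.analyticOnNhd hCo)
    hC.isPreconnected h0 ?_
  have hlim : Filter.Tendsto (fun y : ℝ => (y : ℂ)) (𝓝[>] x₀) (𝓝[≠] (x₀ : ℂ)) := by
    refine tendsto_nhdsWithin_iff.2 ⟨?_, ?_⟩
    · exact (Complex.continuous_ofReal.tendsto x₀).mono_left nhdsWithin_le_nhds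
    · filter_upwards [self_mem_nhdsWithin] with y hy
      simpa using (ne_of_gt hy)
  refine hlim.frequently (Filter.Eventually.frequently ?_)
  filter_upwards [Ioo_mem_nhdsGT hb] with y hy using h y (ha.trans hy.1) hy.2

/-- Three holomorphic functions, on the exterior of the disc with diameter `[-1/2, 1]`, on the unit
disc around `1` and on the unit disc around `0`, which agree pairwise on intervals of the real
line, are the restrictions of an entire function. The coordinate `w = 1 / (1 - z)` turns the
first and the last domain into the half planes `Re w < 2/3` and `Re w > 1/2`, and the middle
one into the exterior of the unit disc. -/
theorem exists_entire_of_expansions {fA fG fH : ℂ → ℂ}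
    (hA : ∀ z, 3 / 4 < ‖z - 1 / 4‖ → DifferentiableAt ℂ fA z)
    (hG : ∀ z, ‖z - 1‖ < 1 → DifferentiableAt ℂ fG z)
    (hH : ∀ z, ‖z‖ < 1 → DifferentiableAt ℂ fH z)
    (hAG : ∀ x : ℝ, 3 / 2 < x → x < 2 → fA x = fG x)
    (hGH : ∀ x : ℝ, 2 / 3 < x → x < 1 → fG x = fH x) :
    ∃ Ψ : ℂ → ℂ, Differentiable ℂ Ψ ∧ (∀ z, 3 / 4 < ‖z - 1 / 4‖ → Ψ z = fA z) ∧
      (∀ z, ‖z - 1‖ < 1 / 2 → Ψ z = fG z) ∧ ∀ z, ‖z‖ < 1 → Ψ z = fH z := by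
  have hφ : ∀ w : ℂ, w ≠ 0 → DifferentiableAt ℂ (fun w : ℂ => 1 - w⁻¹) w := fun w hw =>
    (differentiableAt_const _).sub (differentiableAt_inv hw)
  have ne0 : ∀ {w : ℂ}, 1 < ‖w‖ → w ≠ 0 := fun h h0 => by
    rw [h0, norm_zero] at h; linarith
  have dA : ∀ w : ℂ, w ≠ 0 → w.re < 2 / 3 → DifferentiableAt ℂ (fun w => fA (1 - w⁻¹)) w :=
    fun w hw h => (hA _ ((lt_norm_three_quarters_sub_inv_iff hw).2 h)).comp w (hφ w hw)
  have dH : ∀ w : ℂ, 1 / 2 < w.re → DifferentiableAt ℂ (fun w => fH (1 - w⁻¹)) w := by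
    intro w h
    have hw : w ≠ 0 := fun h0 => by rw [h0, Complex.zero_re] at h; linarith
    exact (hH _ ((norm_one_sub_inv_lt_one_iff hw).2 h)).comp w (hφ w hw)
  have dG : ∀ w : ℂ, 1 < ‖w‖ → DifferentiableAt ℂ (fun w => fG (1 - w⁻¹)) w := by
    intro w h
    refine (hG _ ?_).comp w (hφ w (ne0 h))
    rw [sub_sub_cancel_left, norm_neg, norm_inv]
    exact inv_lt_one_of_one_lt₀ h
  have hre : ∀ {w : ℂ}, 1 < |w.re| → 1 < ‖w‖ := fun h => h.trans_le (Complex.abs_re_le_norm _)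
  have him : ∀ {w : ℂ}, 1 < |w.im| → 1 < ‖w‖ := fun h => h.trans_le (Complex.abs_im_le_norm _)
  have oreg : ∀ a : ℝ, IsOpen {w : ℂ | a < w.re} := fun a =>
    isOpen_lt continuous_const Complex.continuous_re
  have orel : ∀ a : ℝ, IsOpen {w : ℂ | w.re < a} := fun a =>
    isOpen_lt Complex.continuous_re continuous_const
  have oims : ∀ s : ℝ, IsOpen {w : ℂ | 1 < s * w.im} := fun s =>
    isOpen_lt continuous_const (continuous_const.mul Complex.continuous_im)
  have cims : ∀ s : ℝ, Convex ℝ {w : ℂ | 1 < s * w.im} := fun s =>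
    convex_halfSpace_gt (IsLinearMap.mk (fun x y => by simp [mul_add])
      (fun c x => by simp [mul_left_comm])) 1
  have lims : ∀ {s : ℝ} {w : ℂ}, (s = 1 ∨ s = -1) → 1 < s * w.im → 1 < ‖w‖ := by
    rintro s w (rfl | rfl) h
    · exact him (by rw [one_mul] at h; exact h.trans_le (le_abs_self _))
    · exact him (by rw [neg_one_mul] at h; exact h.trans_le (neg_le_abs _))
  have S1 : ∀ w : ℂ, w ∈ {w : ℂ | 1 < w.re} → fG (1 - w⁻¹) = fH (1 - w⁻¹) := by
    refine eqOn_convex_of_eqOn_real (a := 3) (b := 7) (x₀ := 6) (oreg 1)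
      (convex_halfSpace_re_gt 1)
      (fun w hw => (dG w (hre (lt_of_lt_of_le hw (le_abs_self _)))).differentiableWithinAt)
      (fun w hw => (dH w (lt_trans (by norm_num) hw)).differentiableWithinAt)
      (by norm_num) (by norm_num) (by norm_num) ?_
    intro x h3 _
    have := hGH (1 - x⁻¹) (by
      have : x⁻¹ < 3⁻¹ := (inv_lt_inv₀ (by linarith) (by norm_num)).2 h3
      linarith) (by
      have : 0 < x⁻¹ := inv_pos.2 (by linarith)
      linarith)
    exact_mod_cast this
  have S2 : ∀ s : ℝ, (s = 1 ∨ s = -1) → ∀ w : ℂ, w ∈ {w : ℂ | 1 / 2 < w.re} ∩ {w | 1 < s * w.im} →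
      fG (1 - w⁻¹) = fH (1 - w⁻¹) := by
    intro s hs
    refine eqOn_convex_of_eqOn_open (w₀ := 2 + 2 * s * Complex.I) ((oreg _).inter (oims s))
      ((convex_halfSpace_re_gt _).inter (cims s))
      (fun w hw => (dG w (lims hs hw.2)).differentiableWithinAt)
      (fun w hw => (dH w hw.1).differentiableWithinAt) (oreg 1) ?_ ?_ (fun w _ h => S1 w h)
    · rcases hs with rfl | rfl <;> constructor <;> simp <;> norm_num
    · simp
  have S3 : ∀ w : ℂ, w ∈ {w : ℂ | w.re < -1} → fA (1 - w⁻¹) = fG (1 - w⁻¹) := by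
    refine eqOn_convex_of_eqOn_real (a := -2) (b := -1) (x₀ := -3 / 2) (orel _)
      (convex_halfSpace_re_lt _)
      (fun w hw => (dA w (fun h0 => ?_) (lt_trans hw (by norm_num))).differentiableWithinAt)
      (fun w hw => (dG w (hre ?_)).differentiableWithinAt)
      (by norm_num) (by norm_num) (by norm_num) ?_
    · rw [h0] at hw; norm_num at hw
    · have : w.re < -1 := hw
      exact lt_of_lt_of_le (by linarith) (neg_le_abs _)
    · intro x h1 h2
      have := hAG (1 - x⁻¹) (by
        have : x⁻¹ < -2⁻¹ := by
          rw [← inv_neg]; exact (inv_lt_inv_of_neg (by linarith) (by norm_num)).2 h1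
        linarith) (by
        have : (-1)⁻¹ < x⁻¹ := (inv_lt_inv_of_neg (by norm_num) (by linarith)).2 h2
        norm_num at this
        linarith)
      exact_mod_cast this
  have S4 : ∀ s : ℝ, (s = 1 ∨ s = -1) → ∀ w : ℂ, w ∈ {w : ℂ | w.re < 2 / 3} ∩ {w | 1 < s * w.im} →
      fA (1 - w⁻¹) = fG (1 - w⁻¹) := by
    intro s hs
    refine eqOn_convex_of_eqOn_open (w₀ := -2 + 2 * s * Complex.I) ((orel _).inter (oims s))
      ((convex_halfSpace_re_lt _).inter (cims s))
      (fun w hw => (dA w (ne0 (lims hs hw.2)) hw.1).differentiableWithinAt)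
      (fun w hw => (dG w (lims hs hw.2)).differentiableWithinAt) (orel (-1)) ?_ ?_
      (fun w _ h => S3 w h)
    · rcases hs with rfl | rfl <;> constructor <;> simp <;> norm_num
    · simp
  have S5 : ∀ w : ℂ, w ∈ {w : ℂ | w.re < 2 / 3} ∩ {w | 1 / 2 < w.re} →
      fA (1 - w⁻¹) = fH (1 - w⁻¹) := by
    refine eqOn_convex_of_eqOn_open (w₀ := (3 / 5 : ℝ) + 2 * Complex.I) ((orel _).inter (oreg _))
      ((convex_halfSpace_re_lt _).inter (convex_halfSpace_re_gt _))
      (fun w hw => (dA w (fun h0 => ?_) hw.1).differentiableWithinAt)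
      (fun w hw => (dH w hw.2).differentiableWithinAt) (oims 1) ?_ ?_
      (fun w hw h => (S4 1 (Or.inl rfl) w ⟨hw.1, h⟩).trans (S2 1 (Or.inl rfl) w ⟨hw.2, h⟩))
    · have := hw.2
      rw [h0] at this; norm_num at this
    · constructor <;> simp <;> norm_num
    · simp
  -- translation back to the coordinate `z`
  have back : ∀ z : ℂ, z ≠ 1 → (1 - z)⁻¹ ≠ 0 ∧ 1 - ((1 - z)⁻¹)⁻¹ = z := fun z hz =>
    ⟨inv_ne_zero (sub_ne_zero.2 hz.symm), by rw [inv_inv, sub_sub_cancel]⟩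
  have bH : ∀ z : ℂ, z ≠ 1 → (‖z‖ < 1 ↔ 1 / 2 < ((1 - z)⁻¹).re) := fun z hz => by
    rw [← norm_one_sub_inv_lt_one_iff (back z hz).1, (back z hz).2]
  have bA : ∀ z : ℂ, z ≠ 1 → (3 / 4 < ‖z - 1 / 4‖ ↔ ((1 - z)⁻¹).re < 2 / 3) := fun z hz => by
    rw [← lt_norm_three_quarters_sub_inv_iff (back z hz).1, (back z hz).2]
  classical
  set Ψ : ℂ → ℂ := fun z => if z = 1 then fG 1 else if ‖z‖ < 1 then fH z else fA z with hΨ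
  have eH : ∀ z, ‖z‖ < 1 → Ψ z = fH z := by
    intro z hz
    have : z ≠ 1 := fun h => by rw [h, norm_one] at hz; exact lt_irrefl _ hz
    simp [hΨ, this, hz]
  have eA : ∀ z, 3 / 4 < ‖z - 1 / 4‖ → Ψ z = fA z := by
    intro z hz
    have hz1 : z ≠ 1 := fun h => by rw [h] at hz; norm_num at hz
    by_cases h : ‖z‖ < 1
    · rw [eH z h]
      have := S5 (1 - z)⁻¹ ⟨(bA z hz1).1 hz, (bH z hz1).1 h⟩
      rw [(back z hz1).2] at this
      exact this.symm
    · simp [hΨ, hz1, h]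
  have eG : ∀ z, ‖z - 1‖ < 1 / 2 → Ψ z = fG z := by
    intro z hz
    by_cases hz1 : z = 1
    · simp [hΨ, hz1]
    · have hw : 2 < ‖(1 - z)⁻¹‖ := by
        rw [norm_inv, norm_sub_rev, lt_inv_comm₀ (by norm_num)
          (norm_pos_iff.2 (sub_ne_zero.2 hz1))]
        linarith
      have hb := back z hz1
      have hH' := bH z hz1
      have hA' := bA z hz1
      generalize (1 - z)⁻¹ = w at hw hb hH' hA'
      have hw2 : 4 < w.re * w.re + w.im * w.im := by
        rw [← Complex.normSq_apply, ← Complex.sq_norm]; nlinarith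
      -- away from the unit disc, a point with small imaginary part has large real part
      have him' : w.re * w.re ≤ 1 → ∃ s : ℝ, (s = 1 ∨ s = -1) ∧ 1 < s * w.im := by
        intro h
        rcases le_total 0 w.im with h0 | h0
        · exact ⟨1, Or.inl rfl, by nlinarith⟩
        · exact ⟨-1, Or.inr rfl, by nlinarith⟩
      by_cases h : ‖z‖ < 1
      · rw [eH z h]
        have h12 := hH'.1 h
        have : fG (1 - w⁻¹) = fH (1 - w⁻¹) := by
          by_cases h1 : 1 < w.re
          · exact S1 w h1
          · obtain ⟨s, hs, hs'⟩ := him' (by nlinarith)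
            exact S2 s hs w ⟨h12, hs'⟩
        rw [hb.2] at this
        exact this.symm
      · have h12 : w.re ≤ 1 / 2 := not_lt.1 (fun h' => h (hH'.2 h'))
        rw [eA z (hA'.2 (by linarith))]
        have : fA (1 - w⁻¹) = fG (1 - w⁻¹) := by
          by_cases h1 : w.re < -1
          · exact S3 w h1
          · obtain ⟨s, hs, hs'⟩ := him' (by nlinarith)
            exact S4 s hs w ⟨lt_of_le_of_lt h12 (by norm_num), hs'⟩
        rw [hb.2] at this
        exact this
  refine ⟨Ψ, fun z => ?_, eA, eG, eH⟩
  by_cases h1 : ‖z - 1‖ < 1 / 2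
  · refine (hG z (by linarith)).congr_of_eventuallyEq ?_
    filter_upwards [(isOpen_lt (by fun_prop) continuous_const :
      IsOpen {z : ℂ | ‖z - 1‖ < 1 / 2}).mem_nhds h1] with y hy using eG y hy
  have hz1 : z ≠ 1 := fun h => h1 (by rw [h]; norm_num)
  by_cases h2 : ‖z‖ < 1
  · refine (hH z h2).congr_of_eventuallyEq ?_
    filter_upwards [(isOpen_lt (by fun_prop) continuous_const :
      IsOpen {z : ℂ | ‖z‖ < 1}).mem_nhds h2] with y hy using eH y hy
  · have h3 : 3 / 4 < ‖z - 1 / 4‖ := (bA z hz1).2 (by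
      have := not_lt.1 (fun h' => h2 ((bH z hz1).2 h'))
      linarith)
    refine (hA z h3).congr_of_eventuallyEq ?_
    filter_upwards [(isOpen_lt continuous_const (by fun_prop) :
      IsOpen {z : ℂ | 3 / 4 < ‖z - 1 / 4‖}).mem_nhds h3] with y hy using eA y hy

/-! ### From expansions of a function to the Jacobi identity -/

theorem hasSum_polyCoeff (Q : Polynomial ℂ) (z : ℂ) :
    HasSum (fun p : ℤ => polyCoeff Q p * z ^ (-p - 1)) (Q.eval z) := by
  have hinj : Function.Injective fun n : ℕ => -(n : ℤ) - 1 := fun a b hab => by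
    simpa using hab
  refine (hinj.hasSum_iff fun p hp => ?_).1 ?_
  · rw [polyCoeff, if_neg, zero_mul]
    intro h
    exact hp ⟨(-p - 1).toNat, by simp only; lia⟩
  · rw [Polynomial.eval_eq_sum_range]
    refine (hasSum_sum_of_ne_finset_zero (s := Finset.range (Q.natDegree + 1))
      fun n hn => ?_).congr_fun ?_
    · rw [Polynomial.coeff_eq_zero_of_natDegree_lt (by simpa using hn), zero_mul]
    · intro n
      simp only [Function.comp_apply, polyCoeff]
      rw [if_pos (by lia), show (-(-(n : ℤ) - 1) - 1) = (n : ℤ) by ring, Int.toNat_natCast,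
        zpow_natCast]

/-- Multiplication of an expansion by `z` shifts the index of its coefficients. -/
theorem hasSum_zpow_shift {f : ℤ → ℂ} {z s : ℂ} (hz : z ≠ 0)
    (h : HasSum (fun p : ℤ => f p * z ^ (-p - 1)) s) :
    HasSum (fun p : ℤ => f (p + 1) * z ^ (-p - 1)) (z * s) := by
  refine (((Equiv.addRight (1 : ℤ)).hasSum_iff.2 h).mul_left z).congr_fun fun p => ?_
  simp only [Function.comp_apply, Equiv.coe_addRight]
  rw [show -p - 1 = -(p + 1) - 1 + 1 by ring, zpow_add_one₀ hz]
  ring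

/-- If the families are the expansions of one function at `∞`, `1` and `0`, and this function
becomes a polynomial after multiplication with powers of `z` and `z - 1`, then the Jacobi
identity holds. -/
theorem jacobiDefect_eq_zero_of_polynomial (M N : ℕ) : ∀ {f g h : ℤ → ℂ},
    BddBelowSupport f → BddAboveSupport g → BddAboveSupport h →
    ∀ {F G H : ℝ → ℂ} {Q : Polynomial ℂ},
    (∀ z : ℝ, 3 / 2 < z → HasSum (fun p : ℤ => f p * (z : ℂ) ^ (-p - 1)) (F z)) →
    (∀ z : ℝ, 0 < z → z < 1 / 2 → HasSum (fun p : ℤ => g p * (z : ℂ) ^ (-p - 1)) (G z)) →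
    (∀ z : ℝ, 0 < z → z < 1 → HasSum (fun p : ℤ => h p * (z : ℂ) ^ (-p - 1)) (H z)) →
    (∀ z : ℝ, 3 / 2 < z → (z : ℂ) ^ M * ((z : ℂ) - 1) ^ N * F z = Q.eval (z : ℂ)) →
    (∀ z : ℝ, 0 < z → z < 1 / 2 → (1 + z : ℂ) ^ M * (z : ℂ) ^ N * G z = Q.eval (1 + z : ℂ)) →
    (∀ z : ℝ, 0 < z → z < 1 → (z : ℂ) ^ M * ((z : ℂ) - 1) ^ N * H z = Q.eval (z : ℂ)) →
    ∀ l m : ℤ, jacobiDefect f g h l m = 0 := by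
  induction M with
  | zero =>
    induction N with
    | zero =>
      intro f g h hf hg hh F G H Q hF hG hH hFQ hGQ hHQ l m
      simp only [pow_zero, one_mul] at hFQ hGQ hHQ
      have ef : f = polyCoeff Q := by
        obtain ⟨P, hP⟩ := hf.linear (polyCoeff_bddBelow Q) (-1)
        have := laurentSeries_eq_zero (c := fun q => f (q - 1) + (-1) * polyCoeff Q (q - 1))
          (P + 1) (fun p hp => hP _ (by lia)) (ε := 2 / 3) (by norm_num) fun y h0 h1 => by
            have hz : 3 / 2 < y⁻¹ := by
              rwa [lt_inv_comm₀ (by norm_num) h0, show (3 / 2 : ℝ)⁻¹ = 2 / 3 by norm_num]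
            have h2 := (hF y⁻¹ hz).sub (hasSum_polyCoeff Q ((y⁻¹ : ℝ) : ℂ))
            rw [hFQ _ hz, sub_self] at h2
            refine ((Equiv.subRight (1 : ℤ)).hasSum_iff.2 h2).congr_fun fun q => ?_
            simp only [Function.comp_apply, Equiv.subRight_apply]
            rw [show -(q - 1) - 1 = -q by ring, Complex.ofReal_inv, inv_zpow, zpow_neg, inv_inv]
            ring
        funext p
        have := congrFun this (p + 1)
        simp only [add_sub_cancel_right, Pi.zero_apply] at this
        linear_combination this
      have eh : h = polyCoeff Q := by
        obtain ⟨P, hP⟩ := hh.linear (polyCoeff_bddAbove Q) (-1)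
        have := laurentSeries_eq_zero (c := fun q => h (-q - 1) + (-1) * polyCoeff Q (-q - 1))
          (-P) (fun p hp => hP _ (by lia)) one_pos fun y h0 h1 => by
            have h2 := (hH y h0 h1).sub (hasSum_polyCoeff Q (y : ℂ))
            rw [hHQ _ h0 h1, sub_self] at h2
            refine ((Equiv.subLeft (-1 : ℤ)).hasSum_iff.2 h2).congr_fun fun q => ?_
            simp only [Function.comp_apply, Equiv.subLeft_apply]
            rw [show -(-1 - q) - 1 = q by ring, show -1 - q = -q - 1 by ring]
            ring
        funext p
        have := congrFun this (-p - 1)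
        simp only [show -(-p - 1) - 1 = p by ring, Pi.zero_apply] at this
        linear_combination this
      have eg : g = polyCoeff (Polynomial.taylor 1 Q) := by
        obtain ⟨P, hP⟩ := hg.linear (polyCoeff_bddAbove (Polynomial.taylor 1 Q)) (-1)
        have := laurentSeries_eq_zero
          (c := fun q => g (-q - 1) + (-1) * polyCoeff (Polynomial.taylor 1 Q) (-q - 1))
          (-P) (fun p hp => hP _ (by lia)) (ε := 1 / 2) (by norm_num) fun y h0 h1 => by
            have h2 := (hG y h0 h1).sub (hasSum_polyCoeff (Polynomial.taylor 1 Q) (y : ℂ))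
            rw [hGQ _ h0 h1, Polynomial.taylor_eval, add_comm (1 : ℂ), sub_self] at h2
            refine ((Equiv.subLeft (-1 : ℤ)).hasSum_iff.2 h2).congr_fun fun q => ?_
            simp only [Function.comp_apply, Equiv.subLeft_apply]
            rw [show -(-1 - q) - 1 = q by ring, show -1 - q = -q - 1 by ring]
            ring
        funext p
        have := congrFun this (-p - 1)
        simp only [show -(-p - 1) - 1 = p by ring, Pi.zero_apply] at this
        linear_combination this
      rw [ef, eg, eh]
      exact jacobiDefect_poly Q l m
    | succ N ih =>
      intro f g h hf hg hh F G H Q hF hG hH hFQ hGQ hHQ l m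
      rw [← sub_add_cancel l 1, ← jacobiDefect_mul_z_sub_one hf hh]
      refine ih (F := fun z => z * F z - F z) (G := fun z => z * G z) (H := fun z => z * H z - H z)
        (Q := Q) ?_ (hg.shift 1) ?_ ?_ ?_ ?_ ?_ ?_ ?_ (l - 1) m
      · simpa [sub_eq_add_neg] using (hf.shift 1).linear hf (-1)
      · simpa [sub_eq_add_neg] using (hh.shift 1).linear hh (-1)
      · intro z hz
        have hz0 : (z : ℂ) ≠ 0 := by exact_mod_cast (by linarith : z ≠ 0)
        simpa only [sub_mul] using (hasSum_zpow_shift hz0 (hF z hz)).sub (hF z hz)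
      · intro z h0 h1
        exact hasSum_zpow_shift (by exact_mod_cast h0.ne') (hG z h0 h1)
      · intro z h0 h1
        simpa only [sub_mul] using
          (hasSum_zpow_shift (by exact_mod_cast h0.ne') (hH z h0 h1)).sub (hH z h0 h1)
      · intro z hz; rw [← hFQ z hz]; ring
      · intro z h0 h1; rw [← hGQ z h0 h1]; ring
      · intro z h0 h1; rw [← hHQ z h0 h1]; ring
  | succ M ih =>
    intro f g h hf hg hh F G H Q hF hG hH hFQ hGQ hHQ l m
    rw [← sub_add_cancel m 1, ← jacobiDefect_mul_z hg]
    refine ih (F := fun z => z * F z) (G := fun z => G z + z * G z) (H := fun z => z * H z)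
      (Q := Q) (hf.shift 1) ?_ (hh.shift 1) ?_ ?_ ?_ ?_ ?_ ?_ l (m - 1)
    · simpa using hg.linear (hg.shift 1) 1
    · intro z hz
      exact hasSum_zpow_shift (by exact_mod_cast (by linarith : z ≠ 0)) (hF z hz)
    · intro z h0 h1
      simpa only [add_mul] using
        (hG z h0 h1).add (hasSum_zpow_shift (by exact_mod_cast h0.ne') (hG z h0 h1))
    · intro z h0 h1
      exact hasSum_zpow_shift (by exact_mod_cast h0.ne') (hH z h0 h1)
    · intro z hz; rw [← hFQ z hz]; ring
    · intro z h0 h1; rw [← hGQ z h0 h1]; ring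
    · intro z h0 h1; rw [← hHQ z h0 h1]; ring

/-- A Laurent series with a pole of order at most `N` at the origin as a power series. -/
theorem hasSum_laurent_powerSeries {g : ℤ → ℂ} {N : ℕ} (hN : ∀ p : ℤ, N ≤ p → g p = 0) {z : ℂ}
    (hz : z ≠ 0) (hs : Summable fun p : ℤ => ‖g p‖ * ‖z‖ ^ (-p - 1)) :
    HasSum (fun p : ℤ => g p * z ^ (-p - 1)) (∑' p : ℤ, g p * z ^ (-p - 1)) ∧
      (Summable fun n : ℕ => ‖g (N - 1 - n)‖ * ‖z‖ ^ n) ∧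
      z ^ N * ∑' p : ℤ, g p * z ^ (-p - 1) = ∑' n : ℕ, g (N - 1 - n) * z ^ n := by
  have hinj : Function.Injective fun n : ℕ => (N : ℤ) - 1 - n := fun a b hab => by simpa using hab
  have hsum : Summable fun p : ℤ => g p * z ^ (-p - 1) :=
    Summable.of_norm (hs.congr fun p => by rw [norm_mul, norm_zpow])
  refine ⟨hsum.hasSum, ?_, ?_⟩
  · refine ((hs.comp_injective hinj).mul_left (‖z‖ ^ N)).congr fun n => ?_
    simp only [Function.comp_apply]
    rw [show -((N : ℤ) - 1 - n) - 1 = n - N by ring, zpow_sub₀ (norm_ne_zero_iff.2 hz),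
      zpow_natCast, zpow_natCast]
    field_simp
  · rw [← hinj.tsum_eq, ← tsum_mul_left]
    · refine tsum_congr fun n => ?_
      rw [show -((N : ℤ) - 1 - n) - 1 = n - N by ring, zpow_sub₀ hz, zpow_natCast, zpow_natCast]
      field_simp
    · intro p hp
      by_contra h
      refine hp ?_
      simp only
      rw [hN p, zero_mul]
      by_contra! hle
      exact h ⟨(N - 1 - p).toNat, by simp only; lia⟩

/-- The Jacobi identity for three families of scalars, from the convergence of the three
expansions, from their agreement on intervals of the real line, and from the convergence outside
the disc with diameter `[-1/2, 1]` of the re-expansion around `1/4` of the expansion at `∞`. -/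
theorem jacobiDefect_eq_zero_of_convergence {f g h : ℤ → ℂ} {K N M : ℕ}
    (hf : ∀ p : ℤ, p < -(K : ℤ) - 1 → f p = 0) (hg : ∀ p : ℤ, N ≤ p → g p = 0)
    (hh : ∀ p : ℤ, M ≤ p → h p = 0)
    (hfs : ∀ r : ℝ, 1 < r → Summable fun p : ℤ => ‖f p‖ * r ^ (-p - 1))
    (hgs : ∀ r : ℝ, 0 < r → r < 1 → Summable fun p : ℤ => ‖g p‖ * r ^ (-p - 1))
    (hhs : ∀ r : ℝ, 0 < r → r < 1 → Summable fun p : ℤ => ‖h p‖ * r ^ (-p - 1))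
    (hα : ∀ r : ℝ, 0 < r → r < 4 / 3 → Summable fun m : ℕ =>
      ‖∑ y ∈ Finset.HasAntidiagonal.antidiagonal m, f (-K - 1 + y.1) *
        ((Ring.choose ((K : ℝ) - y.1) y.2 * (1 / 4) ^ y.2 : ℝ) : ℂ)‖ * r ^ m)
    (hFG : ∀ z : ℝ, 1 < z → z < 2 → ∑' p : ℤ, f p * (z : ℂ) ^ (-p - 1) =
      ∑' p : ℤ, g p * ((z - 1 : ℝ) : ℂ) ^ (-p - 1))
    (hGH : ∀ z : ℝ, 2 / 3 < z → z < 1 → ∑' p : ℤ, g p * ((z - 1 : ℝ) : ℂ) ^ (-p - 1) =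
      ∑' p : ℤ, h p * (z : ℂ) ^ (-p - 1)) (l m : ℤ) :
    jacobiDefect f g h l m = 0 := by
  set α : ℕ → ℂ := fun m => ∑ y ∈ Finset.HasAntidiagonal.antidiagonal m, f (-K - 1 + y.1) *
        ((Ring.choose ((K : ℝ) - y.1) y.2 * (1 / 4) ^ y.2 : ℝ) : ℂ) with hαdef
  set β : ℕ → ℂ := fun n => g (N - 1 - n) with hβ
  set γ : ℕ → ℂ := fun n => h (M - 1 - n) with hγ
  have hfinj : Function.Injective fun n : ℕ => -(K : ℤ) - 1 + n := fun a b hab => by simpa using hab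
  -- re-expansion of the series at infinity
  have hF : ∀ z : ℝ, 3 / 2 < z → ∑' p : ℤ, f p * (z : ℂ) ^ (-p - 1) =
      ((z : ℂ) - 1 / 4) ^ K * ∑' n : ℕ, α n * (((z : ℂ) - 1 / 4)⁻¹) ^ n := by
    intro z hz
    have hx0 : z - 1 / 4 ≠ 0 := by linarith
    have key := hasSum_reexpand (K : ℝ) (fun n => f (-K - 1 + n)) (x := z - 1 / 4) (t := 1 / 4)
      (by rw [abs_of_pos (by norm_num)]; linarith) (by
        rw [abs_of_pos (by norm_num)]
        refine ((hfs (z - 1 / 4 - 1 / 4) (by linarith)).comp_injective hfinj).congr fun n => ?_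
        simp only [Function.comp_apply]
        rw [show -(-(K : ℤ) - 1 + n) - 1 = (K : ℤ) - n by ring, ← Real.rpow_intCast]
        push_cast
        rfl)
    rw [← hfinj.tsum_eq, ← tsum_mul_left]
    · refine Eq.trans (tsum_congr fun n => ?_) (key.tsum_eq.symm.trans (tsum_congr fun n => ?_))
      · rw [sub_add_cancel, show -(-(K : ℤ) - 1 + n) - 1 = (K : ℤ) - n by ring,
          ← Complex.ofReal_zpow, ← Real.rpow_intCast]
        push_cast
        rfl
      · rw [Real.rpow_sub_natCast hx0, Real.rpow_natCast]
        push_cast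
        simp only [hαdef, inv_pow]
        push_cast
        field_simp
    · intro p hp
      by_contra hc
      refine hp ?_
      simp only
      rw [hf p, zero_mul]
      by_contra! hle
      exact hc ⟨(p + K + 1).toNat, by simp only; lia⟩
  have hgz : ∀ z : ℝ, z ≠ 0 → |z| < 1 →
      Summable fun p : ℤ => ‖g p‖ * ‖(z : ℂ)‖ ^ (-p - 1) := fun z h0 h1 => by
    rw [Complex.norm_real]; exact hgs _ (abs_pos.2 h0) h1
  have hhz : ∀ z : ℝ, 0 < z → z < 1 →
      Summable fun p : ℤ => ‖h p‖ * ‖(z : ℂ)‖ ^ (-p - 1) := fun z h0 h1 => by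
    rw [Complex.norm_real, Real.norm_of_nonneg h0.le]; exact hhs _ h0 h1
  have sβ : ∀ r : ℝ, 0 < r → r < 1 → Summable fun n : ℕ => ‖β n‖ * r ^ n := fun r h0 h1 => by
    have := (hasSum_laurent_powerSeries hg (z := r) (by exact_mod_cast h0.ne')
      (hgz r h0.ne' (by rwa [abs_of_pos h0]))).2.1
    rwa [Complex.norm_real, Real.norm_of_nonneg h0.le] at this
  have sγ : ∀ r : ℝ, 0 < r → r < 1 → Summable fun n : ℕ => ‖γ n‖ * r ^ n := fun r h0 h1 => by
    have := (hasSum_laurent_powerSeries hh (z := r) (by exact_mod_cast h0.ne')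
      (hhz r h0 h1)).2.1
    rwa [Complex.norm_real, Real.norm_of_nonneg h0.le] at this
  have dα := differentiableOn_powerSeries hα
  have dβ := differentiableOn_powerSeries sβ
  have dγ := differentiableOn_powerSeries sγ
  have hin : ∀ z : ℂ, 3 / 4 < ‖z - 1 / 4‖ → (z - 1 / 4)⁻¹ ∈ Metric.ball (0 : ℂ) (4 / 3) := by
    intro z hz
    rwa [mem_ball_zero_iff, norm_inv, inv_lt_comm₀ (by linarith) (by norm_num),
      show (4 / 3 : ℝ)⁻¹ = 3 / 4 by norm_num]
  obtain ⟨Ψ, hΨ, hΨA, hΨG, hΨH⟩ := exists_entire_of_expansions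
    (fA := fun z => z ^ M * (z - 1) ^ N * ((z - 1 / 4) ^ K *
      ∑' n : ℕ, α n * ((z - 1 / 4)⁻¹) ^ n))
    (fG := fun z => z ^ M * ∑' n : ℕ, β n * (z - 1) ^ n)
    (fH := fun z => (z - 1) ^ N * ∑' n : ℕ, γ n * z ^ n)
    (fun z hz => by
      have h0 : z - 1 / 4 ≠ 0 := norm_pos_iff.1 (by linarith)
      have h1 : DifferentiableAt ℂ (fun z : ℂ => (z - 1 / 4)⁻¹) z :=
        (by fun_prop : DifferentiableAt ℂ (fun z : ℂ => z - 1 / 4) z).inv h0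
      have h2 := (dα.differentiableAt (Metric.isOpen_ball.mem_nhds (hin z hz))).comp z h1
      have h3 : DifferentiableAt ℂ (fun z : ℂ => ∑' n : ℕ, α n * ((z - 1 / 4)⁻¹) ^ n) z := h2
      fun_prop)
    (fun z hz => by
      have h2 := (dβ.differentiableAt (Metric.isOpen_ball.mem_nhds
        (mem_ball_zero_iff.2 hz))).comp z (by fun_prop : DifferentiableAt ℂ (fun z : ℂ => z - 1) z)
      have h3 : DifferentiableAt ℂ (fun z : ℂ => ∑' n : ℕ, β n * (z - 1) ^ n) z := h2
      fun_prop)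
    (fun z hz => by
      have h3 := dγ.differentiableAt (Metric.isOpen_ball.mem_nhds (mem_ball_zero_iff.2 hz))
      fun_prop)
    (fun z h1 h2 => by
      rw [← hF z h1, hFG z (by linarith) h2, mul_assoc]
      have := (hasSum_laurent_powerSeries hg (z := (z - 1 : ℝ))
        (by exact_mod_cast (by linarith : z - 1 ≠ 0))
        (hgz _ (by linarith) (by rw [abs_of_pos] <;> linarith))).2.2
      push_cast at this ⊢
      rw [this])
    (fun z h1 h2 => by
      have e1 := (hasSum_laurent_powerSeries hg (z := (z - 1 : ℝ))
        (by exact_mod_cast (by linarith : z - 1 ≠ 0))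
        (hgz _ (by linarith) (by rw [abs_of_neg] <;> linarith))).2.2
      have e2 := (hasSum_laurent_powerSeries hh (z := z)
        (by exact_mod_cast (by linarith : z ≠ 0)) (hhz _ (by linarith) h2)).2.2
      rw [← hGH z h1 h2] at e2
      push_cast at e1 e2
      rw [← e1, ← e2]
      ring)
  -- polynomial growth at infinity
  have sα1 : Summable fun m : ℕ => ‖α m‖ := by
    have := hα 1 one_pos (by norm_num)
    simp only [one_pow, mul_one] at this
    exact this
  obtain ⟨Q, hQ⟩ := exists_polynomial_of_growth (M + N + K) hΨ
    (C := 2 ^ (N + K) * ∑' m : ℕ, ‖α m‖) (R := 2) (by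
      intro z hz
      have hge : 1 ≤ ‖z - 1 / 4‖ := by
        have := norm_sub_norm_le z (1 / 4)
        norm_num at this
        linarith
      rw [hΨA z (by linarith), norm_mul, norm_mul, norm_mul, norm_pow, norm_pow, norm_pow]
      have b1 : ‖z - 1‖ ≤ 2 * ‖z‖ := (norm_sub_le _ _).trans (by rw [norm_one]; linarith)
      have b2 : ‖z - 1 / 4‖ ≤ 2 * ‖z‖ := (norm_sub_le _ _).trans (by norm_num; linarith)
      have b3 : ‖∑' n : ℕ, α n * ((z - 1 / 4)⁻¹) ^ n‖ ≤ ∑' m : ℕ, ‖α m‖ := by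
        refine tsum_of_norm_bounded sα1.hasSum fun n => ?_
        rw [norm_mul, norm_pow, norm_inv]
        exact mul_le_of_le_one_right (norm_nonneg _)
          (pow_le_one₀ (by positivity) (inv_le_one_of_one_le₀ hge))
      calc ‖z‖ ^ M * ‖z - 1‖ ^ N * (‖z - 1 / 4‖ ^ K * ‖∑' n : ℕ, α n * ((z - 1 / 4)⁻¹) ^ n‖)
          ≤ ‖z‖ ^ M * (2 * ‖z‖) ^ N * ((2 * ‖z‖) ^ K * ∑' m : ℕ, ‖α m‖) := by gcongr
        _ = _ := by ring)
  refine jacobiDefect_eq_zero_of_polynomial M N ⟨_, hf⟩ ⟨_, hg⟩ ⟨_, hh⟩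
    (F := fun z => ∑' p : ℤ, f p * (z : ℂ) ^ (-p - 1))
    (G := fun z => ∑' p : ℤ, g p * (z : ℂ) ^ (-p - 1))
    (H := fun z => ∑' p : ℤ, h p * (z : ℂ) ^ (-p - 1)) (Q := Q) ?_ ?_ ?_ ?_ ?_ ?_ l m
  · intro z hz
    refine (Summable.of_norm ((hfs z (by linarith)).congr fun p => ?_)).hasSum
    rw [norm_mul, norm_zpow, Complex.norm_real, Real.norm_of_nonneg (by linarith)]
  · intro z h0 h1
    exact (hasSum_laurent_powerSeries hg (by exact_mod_cast h0.ne')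
      (hgz z h0.ne' (by rw [abs_of_pos h0]; linarith))).1
  · intro z h0 h1
    exact (hasSum_laurent_powerSeries hh (by exact_mod_cast h0.ne') (hhz z h0 h1)).1
  · intro z hz
    rw [hF z hz, ← hQ, hΨA]
    rw [show (z : ℂ) - 1 / 4 = ((z - 1 / 4 : ℝ) : ℂ) by push_cast; ring, Complex.norm_real,
      Real.norm_of_nonneg] <;> linarith
  · intro z h0 h1
    rw [← hQ, hΨG, mul_assoc, (hasSum_laurent_powerSeries hg (z := z) (by exact_mod_cast h0.ne')
      (hgz z h0.ne' (by rw [abs_of_pos h0]; linarith))).2.2, add_sub_cancel_left]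
    rw [add_sub_cancel_left, Complex.norm_real, Real.norm_of_nonneg h0.le]
    exact h1
  · intro z h0 h1
    rw [← hQ, hΨH, mul_comm (_ ^ M), mul_assoc, (hasSum_laurent_powerSeries hh (z := z)
      (by exact_mod_cast h0.ne') (hhz z h0 h1)).2.2]
    rw [Complex.norm_real, Real.norm_of_nonneg h0.le]
    exact h1

/-! ### The coefficients of the formal vertex operator map -/

section Graded

variable {V : Type*} [AddCommGroup V] [Module ℂ V] {𝒱 : ℝ → Submodule ℂ V}

@[simp]
theorem pairing_lof (n : ℝ) (φ : Module.Dual ℂ (𝒱 n)) (x : Completion 𝒱) :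
    pairing 𝒱 (DirectSum.lof ℂ ℝ (fun n => Module.Dual ℂ (𝒱 n)) n φ) x = φ (x n) := by
  simp [pairing]

theorem proj_apply (n : ℝ) (x : Completion 𝒱) : proj 𝒱 n x = (x n : V) := rfl

theorem proj_mem (n : ℝ) (x : Completion 𝒱) : proj 𝒱 n x ∈ 𝒱 n := (x n).2

theorem eq_of_forall_dual {n : ℝ} {v w : V} (hv : v ∈ 𝒱 n) (hw : w ∈ 𝒱 n)
    (h : ∀ φ : Module.Dual ℂ (𝒱 n), φ ⟨v, hv⟩ = φ ⟨w, hw⟩) : v = w := by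
  have : (⟨v, hv⟩ : 𝒱 n) = ⟨w, hw⟩ := by
    rw [← sub_eq_zero, ← Module.forall_dual_apply_eq_zero_iff ℂ]
    intro φ
    rw [map_sub, h, sub_self]
  simpa using this

variable [DirectSum.Decomposition 𝒱]

theorem embed_apply (v : V) (n : ℝ) : embed 𝒱 v n = DirectSum.decompose 𝒱 v n := rfl

theorem coe_embed_of_mem {b : ℝ} {v : V} (hv : v ∈ 𝒱 b) (n : ℝ) :
    ((embed 𝒱 v n : 𝒱 n) : V) = if n = b then v else 0 := by
  rw [embed_apply]
  split_ifs with h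
  · subst h; exact DirectSum.decompose_of_mem_same 𝒱 hv
  · exact DirectSum.decompose_of_mem_ne 𝒱 hv (Ne.symm h)

theorem grading_of_mem {b : ℝ} {v : V} (hv : v ∈ 𝒱 b) : grading 𝒱 v = (b : ℂ) • v := by
  have h2 : DirectSum.decomposeLinearEquiv 𝒱 v = DirectSum.lof ℂ ℝ (fun i => 𝒱 i) b ⟨v, hv⟩ :=
    DirectSum.decompose_of_mem 𝒱 hv
  simp [grading, h2]

theorem eq_of_forall_component {v w : V} (h : ∀ n, (embed 𝒱 v n : V) = embed 𝒱 w n) : v = w := by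
  apply (DirectSum.decompose 𝒱).injective
  ext n
  exact h n

theorem eq_of_forall_pairing {v w : V}
    (h : ∀ f : GradedDual 𝒱, pairing 𝒱 f (embed 𝒱 v) = pairing 𝒱 f (embed 𝒱 w)) : v = w := by
  refine eq_of_forall_component (𝒱 := 𝒱) fun n => ?_
  refine eq_of_forall_dual (𝒱 := 𝒱) (embed 𝒱 v n).2 (embed 𝒱 w n).2 fun φ => ?_
  have := h (DirectSum.lof ℂ ℝ (fun n => Module.Dual ℂ (𝒱 n)) n φ)
  simpa using this

/-- Linear maps that agree on homogeneous vectors are equal. -/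
theorem linearMap_ext_of_homogeneous {M : Type*} [AddCommGroup M] [Module ℂ M] {F G : V →ₗ[ℂ] M}
    (h : ∀ b, ∀ v ∈ 𝒱 b, F v = G v) : F = G := by
  ext v
  induction v using DirectSum.Decomposition.inductionOn 𝒱 with
  | zero => simp
  | homogeneous v => exact h _ _ v.2
  | add v w hv hw => rw [map_add, map_add, hv, hw]

end Graded

namespace OpenStringVertexAlgebra

variable {V : Type*} [AddCommGroup V] [Module ℂ V] {𝒱 : ℝ → Submodule ℂ V}
  [DirectSum.Decomposition 𝒱] (A : OpenStringVertexAlgebra 𝒱)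

theorem mode_mem {a b : ℝ} {u v : V} (hu : u ∈ 𝒱 a) (hv : v ∈ 𝒱 b) (n : ℝ) :
    A.mode n u v ∈ 𝒱 (a + b - n - 1) := by
  rw [A.mode_of_mem hu hv]; exact proj_mem _ _

theorem D_pow_mem {b : ℝ} {v : V} (hv : v ∈ 𝒱 b) (k : ℕ) : (A.D ^ k) v ∈ 𝒱 (b + k) := by
  induction k with
  | zero => simpa using hv
  | succ k ih =>
    rw [pow_succ', Module.End.mul_apply]
    have := A.D_weight _ _ ih
    rwa [Nat.cast_succ, ← add_assoc]

/-- The bracket property for the grading operator determines the dependence on `r`. -/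
theorem coe_Y_apply {a b : ℝ} {u v : V} (hu : u ∈ 𝒱 a) (hv : v ∈ 𝒱 b) {r : ℝ} (hr : 0 < r)
    (n : ℝ) : (A.Y r u v n : V) = ((r ^ (n - a - b) : ℝ) : ℂ) • A.mode (a + b - n - 1) u v := by
  have hm : A.mode (a + b - n - 1) u v = A.Y 1 u v n := by
    rw [A.mode_of_mem hu hv, show a + b - (a + b - n - 1) - 1 = n by ring, proj_apply]
  rw [hm, ← Submodule.coe_smul]
  congr 1
  rw [← sub_eq_zero, ← Module.forall_dual_apply_eq_zero_iff ℂ]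
  intro φ
  rw [map_sub, map_smul, sub_eq_zero, smul_eq_mul]
  set G : ℝ → ℂ := fun s => φ (A.Y s u v n) with hG
  set f := DirectSum.lof ℂ ℝ (fun n => Module.Dual ℂ (𝒱 n)) n φ with hf
  have hpair : (fun s : ℝ => pairing 𝒱 f (A.Y s u v)) = G := by
    funext s; simp [hf, hG]
  have hder : ∀ s : ℝ, 0 < s → HasDerivAt G (((n - a - b : ℝ) : ℂ) * G s / s) s := by
    intro s hs
    have h1 := A.D_derivative u v f s hs
    have h2 := A.d_bracket u v f s hs
    rw [hpair] at h1 h2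
    rw [h1.deriv, grading_of_mem hu, grading_of_mem hv] at h2
    simp only [map_sub, map_smul, LinearMap.smul_apply, smul_eq_mul, hf, pairing_lof] at h2
    simp only [map_sub, hf, pairing_lof] at h1
    convert h1 using 1
    have hs' : (s : ℂ) ≠ 0 := by exact_mod_cast hs.ne'
    have h3 : φ (gradingCompletion 𝒱 (A.Y s u v) n) = (n : ℂ) * G s := by
      simp [gradingCompletion, hG]
    rw [h3] at h2
    rw [div_eq_iff hs']
    push_cast
    simp only [hG] at h2 ⊢
    linear_combination h2
  have hconst : ∀ s : ℝ, 0 < s → HasDerivAt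
      (fun s : ℝ => ((s ^ (-(n - a - b)) : ℝ) : ℂ) * G s) 0 s := by
    intro s hs
    have h1 := (Real.hasDerivAt_rpow_const (x := s) (p := -(n - a - b)) (Or.inl hs.ne')).ofReal_comp
    have h2 := h1.mul (hder s hs)
    refine h2.congr_deriv ?_
    rw [Real.rpow_sub_one hs.ne']
    have hs' : (s : ℂ) ≠ 0 := by exact_mod_cast hs.ne'
    push_cast
    field_simp
    ring
  have heq := (convex_Ioi (0 : ℝ)).is_const_of_fderivWithin_eq_zero (𝕜 := ℝ)
    (f := fun s : ℝ => ((s ^ (-(n - a - b)) : ℝ) : ℂ) * G s)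
    (fun s hs => (hconst s hs).differentiableAt.differentiableWithinAt)
    (fun s hs => by
      rw [fderivWithin_of_isOpen isOpen_Ioi hs]
      ext
      simpa using (hconst s hs).deriv) hr (Set.mem_Ioi.2 one_pos)
  simp only [Real.one_rpow, Complex.ofReal_one, one_mul] at heq
  have : G r = ((r ^ (n - a - b) : ℝ) : ℂ) * G 1 := by
    rw [← heq, ← mul_assoc, ← Complex.ofReal_mul, ← Real.rpow_add hr, add_neg_cancel,
      Real.rpow_zero, Complex.ofReal_one, one_mul]
  exact this

/-- Equality of bilinear expressions in the coefficients can be tested on homogeneous vectors. -/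
theorem bilinear_ext {M : Type*} [AddCommGroup M] [Module ℂ M] {F G : V →ₗ[ℂ] V →ₗ[ℂ] M}
    (h : ∀ a b, ∀ u ∈ 𝒱 a, ∀ v ∈ 𝒱 b, F u v = G u v) : F = G :=
  linearMap_ext_of_homogeneous fun a u hu => linearMap_ext_of_homogeneous fun b v hv =>
    h a b u hu v hv

theorem D_mode (n : ℝ) (u v : V) :
    A.D (A.mode n u v) = A.mode n u (A.D v) + A.mode n (A.D u) v := by
  have : (A.mode n).compr₂ A.D = (A.mode n).compl₂ A.D + (A.mode n) ∘ₗ A.D := by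
    refine bilinear_ext (𝒱 := 𝒱) fun a b u hu v hv => ?_
    simp only [LinearMap.compr₂_apply, LinearMap.add_apply, LinearMap.compl₂_apply,
      LinearMap.comp_apply]
    have h := congrFun (A.D_bracket u v 1 one_pos) (a + b - n)
    have h2 := congrArg (Subtype.val) h
    rw [A.mode_of_mem hu hv, A.mode_of_mem hu (A.D_weight _ _ hv),
      A.mode_of_mem (A.D_weight _ _ hu) hv]
    simp only [proj_apply]
    rw [show a + (b + 1) - n - 1 = a + b - n by ring, show a + 1 + b - n - 1 = a + b - n by ring]
    rw [← h2]
    simp [extendWeightOne]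
  exact congrArg (fun F : V →ₗ[ℂ] V →ₗ[ℂ] V => F u v) this

theorem mode_D (n : ℝ) (u v : V) : A.mode n (A.D u) v = (-(n : ℂ)) • A.mode (n - 1) u v := by
  have : (A.mode n) ∘ₗ A.D = (-(n : ℂ)) • A.mode (n - 1) := by
    refine bilinear_ext (𝒱 := 𝒱) fun a b u hu v hv => ?_
    simp only [LinearMap.comp_apply, LinearMap.smul_apply]
    refine eq_of_forall_dual (𝒱 := 𝒱) (n := a + b - n) ?_ ?_ fun φ => ?_
    · convert A.mode_mem (A.D_weight _ _ hu) hv n using 2; ring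
    · refine Submodule.smul_mem _ _ ?_
      convert A.mode_mem hu hv (n - 1) using 2; ring
    set f := DirectSum.lof ℂ ℝ (fun n => Module.Dual ℂ (𝒱 n)) (a + b - n) φ with hf
    have h1 := A.D_derivative u v f 1 one_pos
    rw [A.D_bracket u v 1 one_pos] at h1
    have h2 : HasDerivAt (fun s : ℝ => pairing 𝒱 f (A.Y s u v))
        ((-n : ℝ) * φ (A.Y 1 u v (a + b - n))) 1 := by
      have h3 := ((Real.hasDerivAt_rpow_const (x := 1) (p := -n)
        (Or.inl one_ne_zero)).ofReal_comp).mul_const (φ (A.Y 1 u v (a + b - n)))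
      rw [Real.one_rpow, mul_one] at h3
      refine h3.congr_of_eventuallyEq ?_
      filter_upwards [lt_mem_nhds (zero_lt_one (α := ℝ))] with s hs
      rw [hf, pairing_lof]
      have h4 := A.coe_Y_apply hu hv hs (a + b - n)
      have h5 := A.coe_Y_apply hu hv one_pos (a + b - n)
      rw [Real.one_rpow, Complex.ofReal_one, one_smul] at h5
      rw [← h5, ← Submodule.coe_smul] at h4
      rw [Subtype.ext h4, map_smul, smul_eq_mul, show a + b - n - a - b = -n by ring]
    have h3 := h1.unique h2
    rw [hf, pairing_lof] at h3
    have e1 : A.Y 1 (A.D u) v (a + b - n) = ⟨A.mode n (A.D u) v, by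
        convert A.mode_mem (A.D_weight _ _ hu) hv n using 2; ring⟩ := by
      ext
      simp only
      rw [A.mode_of_mem (A.D_weight _ _ hu) hv, proj_apply,
        show a + 1 + b - n - 1 = a + b - n by ring]
    have e2 : A.Y 1 u v (a + b - n) = ⟨A.mode (n - 1) u v, by
        convert A.mode_mem hu hv (n - 1) using 2; ring⟩ := by
      ext
      simp only
      rw [A.mode_of_mem hu hv, proj_apply, show a + b - (n - 1) - 1 = a + b - n by ring]
    rw [e1, e2] at h3
    rw [h3, ← smul_eq_mul, ← map_smul]
    push_cast
    rfl
  exact congrArg (fun F : V →ₗ[ℂ] V →ₗ[ℂ] V => F u v) this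

/-- `(D^k u)ₙ = (-1)^k k! (n choose k) u_{n-k}`. -/
theorem mode_D_pow (n : ℝ) (k : ℕ) (u v : V) : A.mode n ((A.D ^ k) u) v =
    ((((-1) ^ k * k.factorial * Ring.choose n k : ℝ)) : ℂ) • A.mode (n - k) u v := by
  induction k generalizing n with
  | zero => simp
  | succ k ih =>
    rw [pow_succ', Module.End.mul_apply, A.mode_D, ih, smul_smul, Nat.cast_succ,
      show n - 1 - (k : ℝ) = n - (k + 1) by ring]
    congr 1
    have h1 : ((k + 1).factorial : ℝ) * Ring.choose n (k + 1) =
        n * (k.factorial * Ring.choose (n - 1) k) := by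
      have e1 := Ring.descPochhammer_eq_factorial_smul_choose n (k + 1)
      have e2 := Ring.descPochhammer_eq_factorial_smul_choose (n - 1) k
      rw [nsmul_eq_mul] at e1 e2
      rw [← e1, ← e2, descPochhammer_succ_left, Polynomial.smeval_X_mul,
        Polynomial.smeval_comp]
      simp
    rw [mul_assoc ((-1 : ℝ) ^ (k + 1)), h1]
    push_cast
    ring

variable {A}

/-- For homogeneous vectors, `u_n v` has weight `wt u + wt v - n - 1`, and there are no vectors of
sufficiently negative weight. -/
theorem GradingRestricted.mode_truncation (hA : A.GradingRestricted) (u v : V) :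
    ∃ N : ℝ, ∀ n : ℝ, N ≤ n → A.mode n u v = 0 := by
  obtain ⟨-, L, hL⟩ := hA
  induction u using DirectSum.Decomposition.inductionOn 𝒱 with
  | zero => exact ⟨0, fun n _ => by simp⟩
  | add u u' hu hu' =>
    obtain ⟨N, hN⟩ := hu
    obtain ⟨N', hN'⟩ := hu'
    exact ⟨max N N', fun n hn => by
      rw [map_add, LinearMap.add_apply, hN n ((le_max_left _ _).trans hn),
        hN' n ((le_max_right _ _).trans hn), add_zero]⟩
  | @homogeneous a u =>
    induction v using DirectSum.Decomposition.inductionOn 𝒱 with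
    | zero => exact ⟨0, fun n _ => by simp⟩
    | add v v' hu hu' =>
      obtain ⟨N, hN⟩ := hu
      obtain ⟨N', hN'⟩ := hu'
      exact ⟨max N N', fun n hn => by
        rw [map_add, hN n ((le_max_left _ _).trans hn),
          hN' n ((le_max_right _ _).trans hn), add_zero]⟩
    | @homogeneous b v =>
      refine ⟨a + b - L, fun n hn => ?_⟩
      have := A.mode_mem u.2 v.2 n
      rwa [hL _ (by linarith), Submodule.mem_bot] at this

variable (A)

/-! ### The vacuum -/

/-- Since `Y(1, r)` is constant, the `𝐝`-bracket property gives `Y(𝐝 1, r) 1 = 0`, and the creation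
property then gives `𝐝 1 = 0`. -/
theorem vac_mem : A.vac ∈ 𝒱 0 := by
  have h1 : grading 𝒱 A.vac = 0 := by
    refine eq_of_forall_pairing (𝒱 := 𝒱) fun f => ?_
    have h2 : ∀ r : ℝ, 0 < r → pairing 𝒱 f (A.Y r (grading 𝒱 A.vac) A.vac) = 0 := by
      intro r hr
      have h3 := A.d_bracket A.vac A.vac f r hr
      rw [A.identity r hr, A.identity r hr] at h3
      have h4 : deriv (fun s : ℝ => pairing 𝒱 f (A.Y s A.vac A.vac)) r = 0 := by
        have : (fun s : ℝ => pairing 𝒱 f (A.Y s A.vac A.vac)) =ᶠ[𝓝 r]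
            fun _ => pairing 𝒱 f (embed 𝒱 A.vac) := by
          filter_upwards [lt_mem_nhds hr] with s hs
          rw [A.identity s hs]
        rw [this.deriv_eq, deriv_const]
      have h5 : gradingCompletion 𝒱 (embed 𝒱 A.vac) = embed 𝒱 (grading 𝒱 A.vac) := by
        have : gradingCompletion 𝒱 ∘ₗ embed 𝒱 = embed 𝒱 ∘ₗ grading 𝒱 := by
          refine linearMap_ext_of_homogeneous (𝒱 := 𝒱) fun b v hv => ?_
          funext n
          ext
          simp only [LinearMap.comp_apply, grading_of_mem hv, map_smul, Pi.smul_apply,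
            Submodule.coe_smul, gradingCompletion, LinearMap.coe_mk, AddHom.coe_mk]
          rw [coe_embed_of_mem hv]
          split_ifs with h
          · rw [h]
          · simp
        exact LinearMap.congr_fun this A.vac
      rw [h4, mul_zero, add_zero, h5, sub_self, map_zero] at h3
      exact h3.symm
    have h6 := A.creation (grading 𝒱 A.vac) f
    have h7 : Filter.Tendsto (fun r : ℝ => pairing 𝒱 f (A.Y r (grading 𝒱 A.vac) A.vac)) (𝓝[>] 0)
        (𝓝 0) := by
      refine Filter.Tendsto.congr' ?_ tendsto_const_nhds
      filter_upwards [self_mem_nhdsWithin] with r hr using (h2 r hr).symm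
    rw [tendsto_nhds_unique h6 h7, map_zero, map_zero]
  -- a vector killed by the grading operator has weight zero
  have hkey : ∀ n : ℝ, n ≠ 0 → (embed 𝒱 A.vac n : V) = 0 := by
    intro n hn
    have : (LinearMap.proj n : Completion 𝒱 →ₗ[ℂ] 𝒱 n) ∘ₗ embed 𝒱 ∘ₗ grading 𝒱 =
        (n : ℂ) • (LinearMap.proj n : Completion 𝒱 →ₗ[ℂ] 𝒱 n) ∘ₗ embed 𝒱 := by
      refine linearMap_ext_of_homogeneous (𝒱 := 𝒱) fun b v hv => ?_
      ext
      simp only [LinearMap.comp_apply, grading_of_mem hv, map_smul, LinearMap.smul_apply,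
        LinearMap.proj_apply, Submodule.coe_smul]
      rw [coe_embed_of_mem hv]
      split_ifs with h
      · rw [h]
      · simp
    have h2 := LinearMap.congr_fun this A.vac
    simp only [LinearMap.comp_apply, h1, map_zero, LinearMap.smul_apply,
        LinearMap.proj_apply] at h2
    have h3 := (smul_eq_zero.1 h2.symm).resolve_left (by exact_mod_cast hn)
    rw [h3]; rfl
  have : A.vac = (embed 𝒱 A.vac 0 : V) := by
    refine eq_of_forall_component (𝒱 := 𝒱) fun n => ?_
    rw [coe_embed_of_mem (embed 𝒱 A.vac 0).2]
    split_ifs with h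
    · rw [h]
    · exact hkey n h
  rw [this]
  exact (embed 𝒱 A.vac 0).2

theorem mode_vac_left (n : ℝ) (v : V) : A.mode n A.vac v = if n = -1 then v else 0 := by
  have : A.mode n A.vac = if n = -1 then LinearMap.id else 0 := by
    refine linearMap_ext_of_homogeneous (𝒱 := 𝒱) fun b v hv => ?_
    rw [A.mode_of_mem A.vac_mem hv, A.identity 1 one_pos, proj_apply, coe_embed_of_mem hv]
    by_cases h : n = -1
    · simp [h]
    · rw [if_neg h, if_neg (fun h' => h (by linarith))]; rfl
  rw [this]
  split_ifs <;> rfl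

theorem mode_neg_one_vac (u : V) : A.mode (-1) u A.vac = u := by
  have : (A.mode (-1)).flip A.vac = LinearMap.id := by
    refine linearMap_ext_of_homogeneous (𝒱 := 𝒱) fun a u hu => ?_
    simp only [LinearMap.flip_apply, LinearMap.id_apply]
    have hm : A.mode (-1) u A.vac ∈ 𝒱 a := by
      convert A.mode_mem hu A.vac_mem (-1) using 2; ring
    refine eq_of_forall_dual (𝒱 := 𝒱) hm hu fun φ => ?_
    have h1 := A.creation u (DirectSum.lof ℂ ℝ (fun n => Module.Dual ℂ (𝒱 n)) a φ)
    simp only [pairing_lof] at h1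
    have h2 : (embed 𝒱 u a) = ⟨u, hu⟩ := by
      ext; rw [coe_embed_of_mem hu, if_pos rfl]
    rw [h2] at h1
    refine tendsto_nhds_unique (Filter.Tendsto.congr' ?_ tendsto_const_nhds) h1
    filter_upwards [self_mem_nhdsWithin] with r hr
    congr 1
    ext
    simp only
    rw [A.coe_Y_apply hu A.vac_mem hr]
    simp
  exact LinearMap.congr_fun this u

theorem D_vac : A.D A.vac = 0 := by
  rw [← A.mode_neg_one_vac (A.D A.vac), A.mode_D, A.mode_vac_left, if_neg (by norm_num), smul_zero]

/-- By the creation property, `Y(u, r) 1` is bounded for `r → 0`, so that it contains no negative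
powers of `r`. -/
theorem mode_vac_of_neg_one_lt {n : ℝ} (hn : -1 < n) (u : V) : A.mode n u A.vac = 0 := by
  have : (A.mode n).flip A.vac = 0 := by
    refine linearMap_ext_of_homogeneous (𝒱 := 𝒱) fun a u hu => ?_
    simp only [LinearMap.flip_apply, LinearMap.zero_apply]
    have hm : A.mode n u A.vac ∈ 𝒱 (a - n - 1) := by
      convert A.mode_mem hu A.vac_mem n using 2; ring
    refine eq_of_forall_dual (𝒱 := 𝒱) hm (zero_mem _) fun φ => ?_
    have h1 := A.creation u (DirectSum.lof ℂ ℝ (fun n => Module.Dual ℂ (𝒱 n)) (a - n - 1) φ)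
    simp only [pairing_lof] at h1
    have h2 : (embed 𝒱 u (a - n - 1)) = 0 := by
      ext; rw [coe_embed_of_mem hu, if_neg (by linarith)]; rfl
    rw [h2, map_zero] at h1
    have h3 : Filter.Tendsto (fun r : ℝ => ((r ^ (n + 1) : ℝ) : ℂ)) (𝓝[>] 0) (𝓝 0) := by
      have := (Real.continuousAt_rpow_const 0 (n + 1) (Or.inr (by linarith))).tendsto
      rw [Real.zero_rpow (by linarith)] at this
      have h4 := (Complex.continuous_ofReal.tendsto 0).comp (this.mono_left
        (nhdsWithin_le_nhds (s := Set.Ioi 0)))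
      rw [Complex.ofReal_zero] at h4
      exact h4
    have h4 := h3.mul h1
    rw [zero_mul] at h4
    have h0 : (⟨0, zero_mem _⟩ : 𝒱 (a - n - 1)) = 0 := rfl
    rw [h0, map_zero]
    refine tendsto_nhds_unique (Filter.Tendsto.congr' ?_ tendsto_const_nhds) h4
    filter_upwards [self_mem_nhdsWithin] with r hr
    rw [← smul_eq_mul, ← map_smul]
    congr 1
    ext
    rw [Submodule.coe_smul, A.coe_Y_apply hu A.vac_mem hr, smul_smul, ← Complex.ofReal_mul,
      ← Real.rpow_add hr]
    simp only
    rw [show n + 1 + (a - n - 1 - a - 0) = 0 by ring, Real.rpow_zero, Complex.ofReal_one, one_smul]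
    congr 2
    ring_nf
  exact LinearMap.congr_fun this u

/-- As `D 1 = 0`, the coefficients of `Y(u, r) 1` are determined by applying `D` repeatedly. -/
theorem mode_vac_step {n : ℝ} (hn : n ≠ 0) (u : V) :
    A.mode (n - 1) u A.vac = (-(n : ℂ)⁻¹) • A.D (A.mode n u A.vac) := by
  have hn' : (n : ℂ) ≠ 0 := by exact_mod_cast hn
  rw [A.D_mode, A.D_vac, map_zero, zero_add, A.mode_D, smul_smul, neg_mul_neg,
    inv_mul_cancel₀ hn', one_smul]

/-- The formula `Y(u, x) 1 = e^{xD} u`, for the coefficient of `x^j`. -/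
theorem mode_vac_of_nat (j : ℕ) (u : V) :
    A.mode (-1 - j) u A.vac = ((j.factorial : ℂ)⁻¹) • (A.D ^ j) u := by
  induction j with
  | zero => simp [mode_neg_one_vac]
  | succ j ih =>
    have h : (-1 - (j : ℝ)) ≠ 0 := by
      have : (0 : ℝ) ≤ j := j.cast_nonneg
      linarith
    rw [show -1 - ((j + 1 : ℕ) : ℝ) = -1 - j - 1 by push_cast; ring, A.mode_vac_step h, ih,
      map_smul, smul_smul, pow_succ', Module.End.mul_apply, Nat.factorial_succ]
    congr 1
    push_cast
    have : (j : ℂ) + 1 ≠ 0 := by exact_mod_cast j.succ_ne_zero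
    have h2 : (-1 - (j : ℂ)) = -(j + 1) := by ring
    rw [h2]
    field_simp

/-- The series `Y(u, x) 1` contains nonnegative integral powers of `x` only: `mode_vac_step` moves
any other power to a negative one. -/
theorem mode_vac_of_ne {n : ℝ} (hn : ∀ j : ℕ, n ≠ -1 - j) (u : V) : A.mode n u A.vac = 0 := by
  obtain ⟨k, hk⟩ := exists_nat_gt (-1 - n)
  have : ∀ k : ℕ, ∀ n : ℝ, -1 - n < k → (∀ j : ℕ, n ≠ -1 - j) → A.mode n u A.vac = 0 := by
    intro k
    induction k with
    | zero => intro n h _; exact A.mode_vac_of_neg_one_lt (by push_cast at h; linarith) u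
    | succ k ih =>
      intro n h hn
      have h1 : n + 1 ≠ 0 := fun h' => hn 0 (by push_cast; linarith)
      have := A.mode_vac_step h1 u
      rw [add_sub_cancel_right, ih (n + 1) (by push_cast at h; linarith) (fun j hj => by
        refine hn (j + 1) ?_
        push_cast; linarith), map_zero, smul_zero] at this
      exact this
  exact this k n hk hn

end OpenStringVertexAlgebra

/-! ### Divided powers of `D` -/

/-- Commuting operators with the same value on a vector have powers with the same value on it. -/
theorem pow_apply_eq_of_commute {W : Type*} [AddCommGroup W] [Module ℂ W] {P Q : Module.End ℂ W}
    (hPQ : Commute P Q) {F : W} (h : P F = Q F) (t : ℕ) : (P ^ t) F = (Q ^ t) F := by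
  induction t with
  | zero => rfl
  | succ t ih =>
    rw [pow_succ, Module.End.mul_apply, h, ← Module.End.mul_apply, (hPQ.pow_left t).eq,
      Module.End.mul_apply, ih, pow_succ', Module.End.mul_apply]

/-- The binomial formula with divided powers. -/
theorem factorial_inv_smul_add_pow {W : Type*} [AddCommGroup W] [Module ℂ W]
    {P Q : Module.End ℂ W} (hPQ : Commute P Q) (t : ℕ) :
    ((t.factorial : ℂ)⁻¹) • (P + Q) ^ t = ∑ y ∈ Finset.HasAntidiagonal.antidiagonal t,
      ((y.1.factorial : ℂ)⁻¹ * (y.2.factorial : ℂ)⁻¹) • (P ^ y.1 * Q ^ y.2) := by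
  rw [hPQ.add_pow', Finset.smul_sum]
  refine Finset.sum_congr rfl fun y hy => ?_
  rw [← Nat.cast_smul_eq_nsmul ℂ, smul_smul]
  congr 1
  have h := Finset.HasAntidiagonal.mem_antidiagonal.1 hy
  have h1 := Nat.add_choose_mul_factorial_mul_factorial y.1 y.2
  rw [← Nat.choose_symm_add] at h1
  rw [← h, ← h1]
  push_cast
  have e1 : (y.1.factorial : ℂ) ≠ 0 := by exact_mod_cast y.1.factorial_ne_zero
  have e2 : (y.2.factorial : ℂ) ≠ 0 := by exact_mod_cast y.2.factorial_ne_zero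
  have e3 : ((y.1 + y.2).choose y.1 : ℂ) ≠ 0 := by
    exact_mod_cast (Nat.choose_pos (Nat.le_add_right _ _)).ne'
  field_simp

theorem choose_neg_real (r : ℝ) (n : ℕ) :
    Ring.choose (-r) n = (-1) ^ n * Ring.choose (r + n - 1) n := by
  rw [Ring.choose_neg, Int.negOnePow_def]
  simp [Units.smul_def]

namespace OpenStringVertexAlgebra

variable {V : Type*} [AddCommGroup V] [Module ℂ V] {𝒱 : ℝ → Submodule ℂ V}
  [DirectSum.Decomposition 𝒱] (A : OpenStringVertexAlgebra 𝒱)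

/-- `uₙ D^j / j! = ∑_{k + t = j} (D^k / k!) (-D)^t(u)ₙ / t!`. -/
theorem mode_D_pow_right (n : ℝ) (j : ℕ) (u v : V) :
    ((j.factorial : ℂ)⁻¹) • A.mode n u ((A.D ^ j) v) =
      ∑ y ∈ Finset.HasAntidiagonal.antidiagonal j, ((y.1.factorial : ℂ)⁻¹ *
        (Ring.choose n y.2 : ℝ)) • (A.D ^ y.1) (A.mode (n - y.2) u v) := by
  -- the operators on bilinear maps that apply `D` to the value, and to one of the arguments
  let Lo : Module.End ℂ (V → V → V) :=
    { toFun := fun F x y => A.D (F x y), map_add' := fun F G => by ext; simp,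
      map_smul' := fun c F => by ext; simp }
  let P1 : Module.End ℂ (V → V → V) :=
    { toFun := fun F x y => F (A.D x) y, map_add' := fun F G => rfl,
      map_smul' := fun c F => rfl }
  let P2 : Module.End ℂ (V → V → V) :=
    { toFun := fun F x y => F x (A.D y), map_add' := fun F G => rfl,
      map_smul' := fun c F => rfl }
  have c1 : Commute Lo P1 := rfl
  have c2 : Commute P2 Lo := rfl
  have c3 : Commute P2 P1 := rfl
  let F : V → V → V := fun x y => A.mode n x y
  have key : (P2 ^ j) F = ((Lo + -P1) ^ j) F := by
    refine pow_apply_eq_of_commute (c2.add_right c3.neg_right) ?_ j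
    funext x y
    exact eq_add_neg_of_add_eq (A.D_mode n x y).symm
  have pLo : ∀ (k : ℕ) (G : V → V → V) x y, (Lo ^ k) G x y = (A.D ^ k) (G x y) := by
    intro k
    induction k with
    | zero => intros; rfl
    | succ k ih => intro G x y; rw [pow_succ', pow_succ']; exact congrArg A.D (ih G x y)
  have pP1 : ∀ (k : ℕ) (G : V → V → V) x y, (P1 ^ k) G x y = G ((A.D ^ k) x) y := by
    intro k
    induction k with
    | zero => intros; rfl
    | succ k ih => intro G x y; rw [pow_succ', pow_succ]; exact ih G (A.D x) y
  have pP2 : ∀ (k : ℕ) (G : V → V → V) x y, (P2 ^ k) G x y = G x ((A.D ^ k) y) := by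
    intro k
    induction k with
    | zero => intros; rfl
    | succ k ih => intro G x y; rw [pow_succ', pow_succ]; exact ih G x (A.D y)
  have h1 := congrArg (fun T : Module.End ℂ (V → V → V) => T F u v)
    (factorial_inv_smul_add_pow c1.neg_right j)
  simp only [LinearMap.smul_apply, Pi.smul_apply, ← key, pP2] at h1
  refine h1.trans ?_
  rw [LinearMap.sum_apply, Finset.sum_apply, Finset.sum_apply]
  refine Finset.sum_congr rfl fun y _ => ?_
  rw [neg_pow P1, show (-1 : Module.End ℂ (V → V → V)) ^ y.2 =
    ((-1 : ℂ) ^ y.2) • (1 : Module.End ℂ (V → V → V)) by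
      rw [← neg_one_smul ℂ (1 : Module.End ℂ (V → V → V)), smul_pow, one_pow],
    smul_mul_assoc, one_mul, mul_smul_comm]
  simp only [LinearMap.smul_apply, Pi.smul_apply, Module.End.mul_apply, pLo, pP1, F]
  rw [A.mode_D_pow, map_smul, smul_smul, smul_smul]
  congr 1
  have e2 : (y.2.factorial : ℂ) ≠ 0 := by exact_mod_cast y.2.factorial_ne_zero
  push_cast
  have e3 : ((-1 : ℂ) ^ y.2) * (-1) ^ y.2 = 1 := by rw [← mul_pow]; simp
  field_simp
  linear_combination ((y.1.factorial : ℂ)⁻¹ * Ring.choose (n : ℂ) y.2) * e3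

/-- The conjugate of `u_p v_q` by the exponential of `D`, in degree `t`. -/
theorem sum_D_pow_mode_mode_D_pow (p q : ℝ) (t : ℕ) (u v w : V) :
    ∑ y ∈ Finset.HasAntidiagonal.antidiagonal t,
      ((y.1.factorial : ℂ)⁻¹ * (y.2.factorial : ℂ)⁻¹ * (-1) ^ y.2) •
        (A.D ^ y.1) (A.mode p u (A.mode q v ((A.D ^ y.2) w))) =
    ∑ y ∈ Finset.HasAntidiagonal.antidiagonal t,
      ((Ring.choose ((y.1 : ℝ) - p - 1) y.1 * Ring.choose ((y.2 : ℝ) - q - 1) y.2 : ℝ) : ℂ) •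
        A.mode (p - y.1) u (A.mode (q - y.2) v w) := by
  let Lo : Module.End ℂ (V → V → V → V) :=
    { toFun := fun F x y z => A.D (F x y z), map_add' := fun F G => by ext; simp,
      map_smul' := fun c F => by ext; simp }
  let P1 : Module.End ℂ (V → V → V → V) :=
    { toFun := fun F x y z => F (A.D x) y z, map_add' := fun F G => rfl,
      map_smul' := fun c F => rfl }
  let P2 : Module.End ℂ (V → V → V → V) :=
    { toFun := fun F x y z => F x (A.D y) z, map_add' := fun F G => rfl,
      map_smul' := fun c F => rfl }
  let P3 : Module.End ℂ (V → V → V → V) :=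
    { toFun := fun F x y z => F x y (A.D z), map_add' := fun F G => rfl,
      map_smul' := fun c F => rfl }
  have c03 : Commute Lo P3 := rfl
  have c12 : Commute P1 P2 := rfl
  have c10 : Commute P1 Lo := rfl
  have c20 : Commute P2 Lo := rfl
  have c13 : Commute P1 P3 := rfl
  have c23 : Commute P2 P3 := rfl
  let F : V → V → V → V := fun x y z => A.mode p x (A.mode q y z)
  have key : ((P1 + P2) ^ t) F = ((Lo + -P3) ^ t) F := by
    refine pow_apply_eq_of_commute ((c10.add_left c20).add_right
      (c13.neg_right.add_left c23.neg_right)) ?_ t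
    funext x y z
    change A.mode p (A.D x) (A.mode q y z) + A.mode p x (A.mode q (A.D y) z) =
      A.D (A.mode p x (A.mode q y z)) + -A.mode p x (A.mode q y (A.D z))
    rw [A.D_mode, A.D_mode, map_add]
    abel
  have pLo : ∀ (k : ℕ) (G : V → V → V → V) x y z, (Lo ^ k) G x y z = (A.D ^ k) (G x y z) := by
    intro k
    induction k with
    | zero => intros; rfl
    | succ k ih => intro G x y z; rw [pow_succ', pow_succ']; exact congrArg A.D (ih G x y z)
  have pP1 : ∀ (k : ℕ) (G : V → V → V → V) x y z, (P1 ^ k) G x y z = G ((A.D ^ k) x) y z := by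
    intro k
    induction k with
    | zero => intros; rfl
    | succ k ih => intro G x y z; rw [pow_succ', pow_succ]; exact ih G (A.D x) y z
  have pP2 : ∀ (k : ℕ) (G : V → V → V → V) x y z, (P2 ^ k) G x y z = G x ((A.D ^ k) y) z := by
    intro k
    induction k with
    | zero => intros; rfl
    | succ k ih => intro G x y z; rw [pow_succ', pow_succ]; exact ih G x (A.D y) z
  have pP3 : ∀ (k : ℕ) (G : V → V → V → V) x y z, (P3 ^ k) G x y z = G x y ((A.D ^ k) z) := by
    intro k
    induction k with
    | zero => intros; rfl
    | succ k ih => intro G x y z; rw [pow_succ', pow_succ]; exact ih G x y (A.D z)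
  have h1 := congrArg (fun T : Module.End ℂ (V → V → V → V) => T F u v w)
    (factorial_inv_smul_add_pow c03.neg_right t)
  have h2 := congrArg (fun T : Module.End ℂ (V → V → V → V) => T F u v w)
    (factorial_inv_smul_add_pow c12 t)
  have h3 : ((t.factorial : ℂ)⁻¹ • (P1 + P2) ^ t) F u v w =
      ((t.factorial : ℂ)⁻¹ • (Lo + -P3) ^ t) F u v w := by
    rw [LinearMap.smul_apply, LinearMap.smul_apply, key]
  have h4 := (h1.symm.trans h3.symm).trans h2
  simp only [LinearMap.sum_apply, Finset.sum_apply] at h4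
  refine Eq.trans (Finset.sum_congr rfl fun y _ => ?_) (h4.trans
    (Finset.sum_congr rfl fun y _ => ?_))
  · rw [neg_pow P3, show (-1 : Module.End ℂ (V → V → V → V)) ^ y.2 =
      ((-1 : ℂ) ^ y.2) • (1 : Module.End ℂ (V → V → V → V)) by
        rw [← neg_one_smul ℂ (1 : Module.End ℂ (V → V → V → V)), smul_pow, one_pow],
      smul_mul_assoc, one_mul, mul_smul_comm, smul_smul]
    simp only [LinearMap.smul_apply, Pi.smul_apply, Module.End.mul_apply, pLo, pP3, F]
  · simp only [LinearMap.smul_apply, Pi.smul_apply, Module.End.mul_apply, pP1, pP2, F]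
    rw [A.mode_D_pow, A.mode_D_pow, map_smul, smul_smul, smul_smul]
    congr 1
    have e1 : (y.1.factorial : ℂ) ≠ 0 := by exact_mod_cast y.1.factorial_ne_zero
    have e2 : (y.2.factorial : ℂ) ≠ 0 := by exact_mod_cast y.2.factorial_ne_zero
    rw [show (y.1 : ℝ) - p - 1 = -(p - y.1 + 1) by ring,
      show (y.2 : ℝ) - q - 1 = -(q - y.2 + 1) by ring, choose_neg_real, choose_neg_real,
      show p - (y.1 : ℝ) + 1 + y.1 - 1 = p by ring, show q - (y.2 : ℝ) + 1 + y.2 - 1 = q by ring]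
    push_cast
    field_simp

end OpenStringVertexAlgebra

/-! ### Matrix coefficients of products and iterates -/

/-- The linear functional on `V` that is `φ` on the homogeneous subspace of weight `c` and vanishes
on the others. -/
def homogeneousFunctional {V : Type*} [AddCommGroup V] [Module ℂ V] (𝒱 : ℝ → Submodule ℂ V)
    [DirectSum.Decomposition 𝒱] (c : ℝ) (φ : Module.Dual ℂ (𝒱 c)) : V →ₗ[ℂ] ℂ :=
  φ ∘ₗ (LinearMap.proj c : Completion 𝒱 →ₗ[ℂ] 𝒱 c) ∘ₗ embed 𝒱

theorem homogeneousFunctional_of_mem {V : Type*} [AddCommGroup V] [Module ℂ V]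
    {𝒱 : ℝ → Submodule ℂ V} [DirectSum.Decomposition 𝒱] {c : ℝ} (φ : Module.Dual ℂ (𝒱 c)) {v : V}
    (hv : v ∈ 𝒱 c) : homogeneousFunctional 𝒱 c φ v = φ ⟨v, hv⟩ := by
  have : embed 𝒱 v c = ⟨v, hv⟩ := by ext; rw [coe_embed_of_mem hv, if_pos rfl]
  simp [homogeneousFunctional, this]

namespace OpenStringVertexAlgebra

variable {V : Type*} [AddCommGroup V] [Module ℂ V] {𝒱 : ℝ → Submodule ℂ V}
  [DirectSum.Decomposition 𝒱] (A : OpenStringVertexAlgebra 𝒱)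

theorem dual_Y_apply {a b c : ℝ} {x y : V} (hx : x ∈ 𝒱 a) (hy : y ∈ 𝒱 b)
    (φ : Module.Dual ℂ (𝒱 c)) {r : ℝ} (hr : 0 < r) :
    φ (A.Y r x y c) = ((r ^ (c - a - b) : ℝ) : ℂ) *
      homogeneousFunctional 𝒱 c φ (A.mode (a + b - c - 1) x y) := by
  rw [← smul_eq_mul, ← map_smul, ← A.coe_Y_apply hx hy hr, homogeneousFunctional_of_mem φ]

theorem proj_Y {a b : ℝ} {x y : V} (hx : x ∈ 𝒱 a) (hy : y ∈ 𝒱 b) {r : ℝ} (hr : 0 < r) (m : ℝ) :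
    proj 𝒱 m (A.Y r x y) = ((r ^ (m - a - b) : ℝ) : ℂ) • A.mode (a + b - m - 1) x y := by
  rw [proj_apply, A.coe_Y_apply hx hy hr]

/-- The summands of a matrix coefficient of a product of two vertex operators, which are indexed by
the weight of the intermediate vector, in terms of the coefficients of the formal vertex operators.
The weight determines the sum `s` of the two indices. -/
theorem dual_Y_proj_Y {a b d c s : ℝ} {x y z : V} (hx : x ∈ 𝒱 a) (hy : y ∈ 𝒱 b) (hz : z ∈ 𝒱 d)
    (hc : c = a + b + d - s - 2) (φ : Module.Dual ℂ (𝒱 c)) {r₁ r₂ : ℝ} (h1 : 0 < r₁) (h2 : 0 < r₂)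
    (q : ℝ) : φ (A.Y r₁ x (proj 𝒱 (b + d - 1 - q) (A.Y r₂ y z)) c) =
      ((r₁ ^ (-(s - q) - 1) * r₂ ^ (-q - 1) : ℝ) : ℂ) *
        homogeneousFunctional 𝒱 c φ (A.mode (s - q) x (A.mode q y z)) := by
  have e1 : b + d - (b + d - 1 - q) - 1 = q := by ring
  have e2 : b + d - 1 - q - b - d = -q - 1 := by ring
  rw [A.proj_Y hy hz h2, e1, e2, map_smul, Pi.smul_apply, map_smul,
    A.dual_Y_apply hx (A.mode_mem hy hz q) φ h1,
    show a + (b + d - q - 1) - c - 1 = s - q by rw [hc]; ring,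
    show c - a - (b + d - q - 1) = -(s - q) - 1 by rw [hc]; ring, smul_eq_mul]
  push_cast
  ring

/-- The analogue of `dual_Y_proj_Y` for an iterate of two vertex operators. -/
theorem dual_Y_proj_Y_left {a b d c s : ℝ} {x y z : V} (hx : x ∈ 𝒱 a) (hy : y ∈ 𝒱 b)
    (hz : z ∈ 𝒱 d) (hc : c = a + b + d - s - 2) (φ : Module.Dual ℂ (𝒱 c)) {r₀ r₂ : ℝ}
    (h0 : 0 < r₀) (h2 : 0 < r₂) (q : ℝ) :
    φ (A.Y r₂ (proj 𝒱 (a + b - 1 - q) (A.Y r₀ x y)) z c) =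
      ((r₀ ^ (-q - 1) * r₂ ^ (-(s - q) - 1) : ℝ) : ℂ) *
        homogeneousFunctional 𝒱 c φ (A.mode (s - q) (A.mode q x y) z) := by
  have e1 : a + b - (a + b - 1 - q) - 1 = q := by ring
  have e2 : a + b - 1 - q - a - b = -q - 1 := by ring
  rw [A.proj_Y hx hy h0, e1, e2, map_smul, LinearMap.smul_apply, Pi.smul_apply, map_smul,
    A.dual_Y_apply (A.mode_mem hx hy q) hz φ h2,
    show a + b - q - 1 + d - c - 1 = s - q by rw [hc]; ring,
    show c - (a + b - q - 1) - d = -(s - q) - 1 by rw [hc]; ring, smul_eq_mul]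
  push_cast
  ring

theorem summable_product {a b d c s : ℝ} {x y z : V} (hx : x ∈ 𝒱 a) (hy : y ∈ 𝒱 b) (hz : z ∈ 𝒱 d)
    (hc : c = a + b + d - s - 2) (φ : Module.Dual ℂ (𝒱 c)) {r₁ r₂ : ℝ} (h2 : 0 < r₂)
    (h12 : r₂ < r₁) :
    Summable fun q : ℝ => ‖homogeneousFunctional 𝒱 c φ (A.mode (s - q) x (A.mode q y z))‖ *
      (r₁ ^ (-(s - q) - 1) * r₂ ^ (-q - 1)) := by
  have h := A.product_summable 1 ![x, y] ![r₁, r₂] z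
    (DirectSum.lof ℂ ℝ (fun n => Module.Dual ℂ (𝒱 n)) c φ)
    (by intro i j hij; fin_cases i <;> fin_cases j <;> simp at hij ⊢; exact h12)
    (by intro i; fin_cases i <;> simp <;> linarith)
  have hinj : Function.Injective fun q : ℝ => (fun _ : Fin 1 => b + d - 1 - q) := by
    intro q q' hq
    have := congrFun hq 0
    simpa using this
  refine (h.comp_injective hinj).norm.congr fun q => ?_
  simp only [Function.comp_apply, productTerm, pairing_lof]
  have := A.dual_Y_proj_Y hx hy hz hc φ (h2.trans h12) h2 q
  have h3 : 0 < r₁ := h2.trans h12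
  refine (congrArg norm this).trans ?_
  rw [norm_mul, Complex.norm_real, Real.norm_of_nonneg (by positivity), mul_comm]

theorem summable_iterate {a b d c s : ℝ} {x y z : V} (hx : x ∈ 𝒱 a) (hy : y ∈ 𝒱 b) (hz : z ∈ 𝒱 d)
    (hc : c = a + b + d - s - 2) (φ : Module.Dual ℂ (𝒱 c)) {r₀ r₂ : ℝ} (h0 : 0 < r₀)
    (h02 : r₀ < r₂) :
    Summable fun q : ℝ => ‖homogeneousFunctional 𝒱 c φ (A.mode (s - q) (A.mode q x y) z)‖ *
      (r₀ ^ (-q - 1) * r₂ ^ (-(s - q) - 1)) := by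
  have h := A.iterate_summable x y z
    (DirectSum.lof ℂ ℝ (fun n => Module.Dual ℂ (𝒱 n)) c φ) r₀ r₂ h0 h02
  refine ((Equiv.subLeft (a + b - 1)).summable_iff.2 h).norm.congr fun q => ?_
  simp only [Function.comp_apply, pairing_lof, Equiv.subLeft_apply]
  have h3 : 0 < r₂ := h0.trans h02
  rw [A.dual_Y_proj_Y_left hx hy hz hc φ h0 h3 q, norm_mul,
    Complex.norm_real, Real.norm_of_nonneg (by positivity), mul_comm]

/-- Associativity, in terms of the coefficients of the formal vertex operators. -/
theorem tsum_product_eq_tsum_iterate {a b d c s : ℝ} {x y z : V} (hx : x ∈ 𝒱 a) (hy : y ∈ 𝒱 b)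
    (hz : z ∈ 𝒱 d) (hc : c = a + b + d - s - 2) (φ : Module.Dual ℂ (𝒱 c)) {r₁ r₂ : ℝ}
    (h12 : r₂ < r₁) (h : r₁ - r₂ < r₂) :
    ∑' q : ℝ, ((r₁ ^ (-(s - q) - 1) * r₂ ^ (-q - 1) : ℝ) : ℂ) *
        homogeneousFunctional 𝒱 c φ (A.mode (s - q) x (A.mode q y z)) =
      ∑' q : ℝ, (((r₁ - r₂) ^ (-q - 1) * r₂ ^ (-(s - q) - 1) : ℝ) : ℂ) *
        homogeneousFunctional 𝒱 c φ (A.mode (s - q) (A.mode q x y) z) := by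
  have h2 : 0 < r₂ := by linarith
  have h3 := A.associativity x y z
    (DirectSum.lof ℂ ℝ (fun n => Module.Dual ℂ (𝒱 n)) c φ) r₁ r₂ h12 h (by linarith)
  rw [← (Equiv.subLeft (b + d - 1)).tsum_eq, ← (Equiv.subLeft (a + b - 1)).tsum_eq
    (fun m : ℝ => pairing 𝒱 _ (A.Y r₂ (proj 𝒱 m _) z))] at h3
  simp only [pairing_lof, Equiv.subLeft_apply] at h3
  simp only [A.dual_Y_proj_Y hx hy hz hc φ (h2.trans h12) h2,
    A.dual_Y_proj_Y_left hx hy hz hc φ (sub_pos.2 h12) h2] at h3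
  exact h3

/-- Convergence of a product of three vertex operators, the last one applied to the vacuum: since
`Y(w, r₃) 1 = e^{r₃ D} w`, the innermost summation is over the powers of `D`. -/
theorem summable_triple_product {a b d c s : ℝ} {x y z : V} (hx : x ∈ 𝒱 a) (hy : y ∈ 𝒱 b)
    (hz : z ∈ 𝒱 d) (hc : c = a + b + d - s - 2) (φ : Module.Dual ℂ (𝒱 c)) {r₁ r₂ r₃ : ℝ}
    (h3 : 0 < r₃) (h23 : r₃ < r₂) (h12 : r₂ < r₁) (k : ℕ) :
    Summable fun y' : ℤ × ℕ => ‖homogeneousFunctional 𝒱 c φ ((A.D ^ k) (A.mode y'.1 x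
        (A.mode (s + k + y'.2 - y'.1) y ((A.D ^ y'.2) z))))‖ *
      (r₁ ^ (-(y'.1 : ℝ) - 1) * r₂ ^ (-(s + k + y'.2 - y'.1) - 1) *
        (r₃ ^ y'.2 * (y'.2.factorial : ℝ)⁻¹)) := by
  have h2 : 0 < r₂ := h3.trans h23
  have h1 : 0 < r₁ := h2.trans h12
  -- the functional `φ ∘ D^k` on the vectors of weight `c - k`
  let ψ : Module.Dual ℂ (𝒱 (c - k)) := homogeneousFunctional 𝒱 c φ ∘ₗ (A.D ^ k) ∘ₗ
    (𝒱 (c - k)).subtype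
  have h := A.product_summable 2 ![x, y, z] ![r₁, r₂, r₃] A.vac
    (DirectSum.lof ℂ ℝ (fun n => Module.Dual ℂ (𝒱 n)) (c - k) ψ)
    (by
      intro i j hij
      fin_cases i <;> fin_cases j <;> simp at hij ⊢ <;> linarith)
    (by intro i; fin_cases i <;> simp <;> linarith)
  have hinj : Function.Injective fun y' : ℤ × ℕ =>
      (![b + (d + y'.2) - 1 - (s + k + y'.2 - y'.1), d + 0 - 1 - (-1 - y'.2)] : Fin 2 → ℝ) := by
    intro q q' hq
    have e1 := congrFun hq 1
    have e0 := congrFun hq 0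
    simp only [Matrix.cons_val_zero, Matrix.cons_val_one] at e0 e1
    have e2 : (q.2 : ℝ) = q'.2 := by linarith
    have e3 : (q.1 : ℝ) = q'.1 := by linarith
    exact Prod.ext (by exact_mod_cast e3) (by exact_mod_cast e2)
  refine (h.comp_injective hinj).norm.congr fun q => ?_
  obtain ⟨p, j⟩ := q
  simp only [Function.comp_apply, productTerm, pairing_lof]
  have hD := A.D_pow_mem hz j
  have e1 : proj 𝒱 (d + 0 - 1 - (-1 - (j : ℝ))) (A.Y r₃ z A.vac) =
      ((r₃ ^ j * (j.factorial : ℝ)⁻¹ : ℝ) : ℂ) • (A.D ^ j) z := by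
    rw [A.proj_Y hz A.vac_mem h3, show d + 0 - (d + 0 - 1 - (-1 - (j : ℝ))) - 1 = -1 - j by ring,
      A.mode_vac_of_nat, smul_smul, show d + 0 - 1 - (-1 - (j : ℝ)) - d - 0 = j by ring,
      Real.rpow_natCast]
    push_cast
    rfl
  have e2 := A.dual_Y_proj_Y (s := s + k + j) hx hy hD (by rw [hc]; ring) ψ h1 h2 (s + k + j - p)
  have e3 : ψ (A.Y r₁ x (proj 𝒱 (b + (d + j) - 1 - (s + k + j - p)) (A.Y r₂ y
      (proj 𝒱 (d + 0 - 1 - (-1 - (j : ℝ))) (A.Y r₃ z A.vac)))) (c - k)) =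
      ((r₁ ^ (-(p : ℝ) - 1) * r₂ ^ (-(s + k + j - p) - 1) *
        (r₃ ^ j * (j.factorial : ℝ)⁻¹) : ℝ) : ℂ) *
      homogeneousFunctional 𝒱 c φ ((A.D ^ k) (A.mode p x
        (A.mode (s + k + j - p) y ((A.D ^ j) z)))) := by
    rw [e1]
    simp only [map_smul, Pi.smul_apply]
    rw [e2, sub_sub_cancel, homogeneousFunctional_of_mem ψ (by
      have := A.mode_mem hx (A.mode_mem hy hD (s + k + j - p)) p
      convert this using 2
      rw [hc]; ring), smul_eq_mul]
    push_cast
    simp only [ψ, LinearMap.comp_apply, Submodule.subtype_apply]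
    ring
  refine (congrArg norm e3).trans ?_
  rw [norm_mul, Complex.norm_real, Real.norm_of_nonneg (by positivity), mul_comm]

end OpenStringVertexAlgebra

namespace OpenStringVertexAlgebra

variable {V : Type*} [AddCommGroup V] [Module ℂ V] {𝒱 : ℝ → Submodule ℂ V}
  [DirectSum.Decomposition 𝒱] {A : OpenStringVertexAlgebra 𝒱}

/-! ### Moving the origin in a product of two vertex operators -/

/-- The double series obtained by conjugating `u_p v` with the exponential of `D / 4`. -/
def conjTerm (A : OpenStringVertexAlgebra 𝒱) (ψ : V →ₗ[ℂ] ℂ) (s p : ℝ) (u v w : V)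
    (y : ℕ × ℕ) : ℂ :=
  (((1 / 4) ^ (y.1 + y.2) * (3 / 4) ^ (-(s + y.1 + y.2 - p) - 1) : ℝ) : ℂ) *
    ψ (((y.1.factorial : ℂ)⁻¹ * (y.2.factorial : ℂ)⁻¹ * (-1) ^ y.2) •
      (A.D ^ y.1) (A.mode p u (A.mode (s + y.1 + y.2 - p) v ((A.D ^ y.2) w))))

/-- Conjugation with the exponential of `D / 4` is a translation by `1/4`: it re-expands the product
of two vertex operators around `1/4`. -/
theorem tsum_conjTerm (ψ : V →ₗ[ℂ] ℂ) (s : ℝ) (u v w : V) (K m : ℕ)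
    (hK : ∀ p : ℤ, p < -(K : ℤ) - 1 → ψ (A.mode p u (A.mode (s - p) v w)) = 0)
    (hs : Summable (conjTerm A ψ s ((-K - 1 + m : ℤ) : ℝ) u v w)) :
    ∑' y, conjTerm A ψ s ((-K - 1 + m : ℤ) : ℝ) u v w y =
      ∑ y ∈ Finset.HasAntidiagonal.antidiagonal m,
        ψ (A.mode ((-K - 1 + y.1 : ℤ) : ℝ) u (A.mode (s - ((-K - 1 + y.1 : ℤ) : ℝ)) v w)) *
          ((Ring.choose ((K : ℝ) - y.1) y.2 * (1 / 4) ^ y.2 : ℝ) : ℂ) := by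
  set p : ℤ := -K - 1 + m with hp
  -- the value of the `i`-th row of the re-summed double series
  let row : ℕ → ℂ := fun i => ψ (A.mode ((p - i : ℤ) : ℝ) u (A.mode (s - ((p - i : ℤ) : ℝ)) v w)) *
      ((Ring.choose ((i : ℝ) - p - 1) i * (1 / 4) ^ i : ℝ) : ℂ)
  let e : ℕ → ℝ := fun i => p - s - i - 1
  let D : ℕ × ℕ → ℂ := fun y => row y.1 *
    ((Ring.choose (e y.1) y.2 * (3 / 4) ^ (e y.1 - y.2) * (1 / 4) ^ y.2 : ℝ) : ℂ)
  have hrow : ∀ i, HasSum (fun j => D (i, j)) (row i) := by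
    intro i
    have h := hasSum_choose_rpow (e i) (x := 3 / 4) (t := 1 / 4)
      (by rw [abs_of_pos] <;> norm_num)
    rw [show (3 / 4 + 1 / 4 : ℝ) = 1 by norm_num, Real.one_rpow] at h
    have h2 := ((Complex.hasSum_ofReal).2 h).mul_left (row i)
    rwa [Complex.ofReal_one, mul_one] at h2
  have hrow0 : ∀ i, m < i → row i = 0 := by
    intro i hi
    simp only [row]
    rw [hK _ (by lia), zero_mul]
  have hD : Summable D := by
    refine Summable.of_norm ?_
    rw [summable_prod_of_nonneg (fun _ => norm_nonneg _)]
    refine ⟨fun i => (hrow i).summable.norm, ?_⟩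
    refine summable_of_ne_finset_zero (s := Finset.range (m + 1)) fun i hi => ?_
    have : row i = 0 := hrow0 i (by simpa using hi)
    simp [D, this]
  have hanti : ∀ t, ∑ y ∈ Finset.HasAntidiagonal.antidiagonal t, conjTerm A ψ s p u v w y =
      ∑ y ∈ Finset.HasAntidiagonal.antidiagonal t, D y := by
    intro t
    have h := congrArg (fun x => (((1 / 4) ^ t * (3 / 4) ^ (-(s + t - p) - 1) : ℝ) : ℂ) * ψ x)
      (A.sum_D_pow_mode_mode_D_pow p (s + t - p) t u v w)
    simp only [map_sum, Finset.mul_sum] at h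
    refine Eq.trans (Finset.sum_congr rfl fun y hy => ?_) (h.trans
      (Finset.sum_congr rfl fun y hy => ?_))
    · have h1 := Finset.HasAntidiagonal.mem_antidiagonal.1 hy
      rw [conjTerm, ← h1, Nat.cast_add, add_assoc]
    · have h1 : (t : ℝ) = y.1 + y.2 := by
        exact_mod_cast (Finset.HasAntidiagonal.mem_antidiagonal.1 hy).symm
      have h2 := Finset.HasAntidiagonal.mem_antidiagonal.1 hy
      simp only [D, row, e]
      rw [show (y.2 : ℝ) - (s + t - p) - 1 = p - s - y.1 - 1 by rw [h1]; ring,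
        show -(s + t - p) - 1 = p - s - y.1 - 1 - y.2 by rw [h1]; ring,
        show s + t - p - y.2 = s - ((p - y.1 : ℤ) : ℝ) by push_cast; rw [h1]; ring,
        show (p : ℝ) - y.1 = ((p - y.1 : ℤ) : ℝ) by push_cast; ring, map_smul, smul_eq_mul, ← h2,
        pow_add]
      push_cast
      ring
  have h1 := hasSum_antidiagonal hs.hasSum
  simp only [hanti] at h1
  rw [h1.unique (hasSum_antidiagonal hD.hasSum), hD.tsum_prod' (fun i => (hrow i).summable)]
  simp only [(hrow _).tsum_eq]
  rw [tsum_eq_sum (s := Finset.range (m + 1)) (fun i hi => hrow0 i (by simpa using hi)),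
    ← Finset.Nat.sum_antidiagonal_eq_sum_range_succ_mk (fun y => row y.1),
    ← Finset.Nat.sum_antidiagonal_swap]
  refine Finset.sum_congr rfl fun y hy => ?_
  have h2 := Finset.HasAntidiagonal.mem_antidiagonal.1 hy
  simp only [row, Prod.fst_swap]
  have h3 : p - (y.2 : ℤ) = -K - 1 + y.1 := by rw [hp]; lia
  rw [h3, show (y.2 : ℝ) - p - 1 = K - y.1 by
    have : (p : ℝ) - y.2 = -K - 1 + y.1 := by exact_mod_cast h3
    linarith]

/-- The re-expansion around `1/4` of the product of two vertex operators at `z` and `1` converges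
outside the disc with center `1/4` and radius `3/4`: it is dominated by matrix coefficients of the
product of three vertex operators at `r⁻¹`, `3/4` and `1/4`, the last one applied to the vacuum. -/
theorem summable_reexpanded_product (hA : A.GradingRestricted) {a b d c s : ℝ} {u v w : V}
    (hu : u ∈ 𝒱 a) (hv : v ∈ 𝒱 b) (hw : w ∈ 𝒱 d) (hc : c = a + b + d - s - 2)
    (φ : Module.Dual ℂ (𝒱 c)) {K : ℕ}
    (hK : ∀ p : ℤ, p < -(K : ℤ) - 1 →
      homogeneousFunctional 𝒱 c φ (A.mode p u (A.mode (s - p) v w)) = 0) {r : ℝ} (hr0 : 0 < r)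
    (hr : r < 4 / 3) :
    Summable fun m : ℕ => ‖∑ y ∈ Finset.HasAntidiagonal.antidiagonal m,
      homogeneousFunctional 𝒱 c φ (A.mode ((-K - 1 + y.1 : ℤ) : ℝ) u
        (A.mode (s - ((-K - 1 + y.1 : ℤ) : ℝ)) v w)) *
          ((Ring.choose ((K : ℝ) - y.1) y.2 * (1 / 4) ^ y.2 : ℝ) : ℂ)‖ * r ^ m := by
  set ψ := homogeneousFunctional 𝒱 c φ with hψ
  have hR : 3 / 4 < r⁻¹ := by
    rwa [lt_inv_comm₀ (by norm_num) hr0, show (3 / 4 : ℝ)⁻¹ = 4 / 3 by norm_num]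
  have hk : ∀ k : ℕ, Summable fun x : ℕ × ℕ =>
      ‖conjTerm A ψ s ((-K - 1 + x.1 : ℤ) : ℝ) u v w (k, x.2)‖ * r ^ x.1 := by
    intro k
    have h := A.summable_triple_product hu hv hw hc φ (r₁ := r⁻¹) (r₂ := 3 / 4) (r₃ := 1 / 4)
      (by norm_num) (by norm_num) hR k
    have hinj : Function.Injective fun x : ℕ × ℕ => ((-K - 1 + x.1 : ℤ), x.2) := by
      rintro ⟨x, x'⟩ ⟨y, y'⟩ hxy
      simpa using hxy
    refine ((h.comp_injective hinj).mul_left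
      ((1 / 4) ^ k * (k.factorial : ℝ)⁻¹ * r ^ K)).congr fun x => ?_
    simp only [Function.comp_apply, conjTerm, ← hψ]
    have e1 : (r⁻¹) ^ (-(((-K - 1 + x.1 : ℤ) : ℝ)) - 1) = r ^ x.1 * (r ^ K)⁻¹ := by
      rw [Real.inv_rpow hr0.le, ← Real.rpow_neg hr0.le,
        show -(-(((-K - 1 + x.1 : ℤ) : ℝ)) - 1) = (x.1 : ℝ) - K by push_cast; ring,
        Real.rpow_sub hr0, Real.rpow_natCast, Real.rpow_natCast, div_eq_mul_inv]
    have e2 : r ^ K ≠ 0 := by positivity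
    rw [e1, map_smul, norm_mul, norm_smul, norm_mul, norm_mul, norm_inv, norm_inv, norm_pow,
      norm_neg, norm_one, one_pow, Complex.norm_natCast, Complex.norm_natCast, Complex.norm_real,
      Real.norm_of_nonneg (by positivity), pow_add]
    field_simp
  have htot : Summable fun x : ℕ × (ℕ × ℕ) =>
      ‖conjTerm A ψ s ((-K - 1 + x.2.1 : ℤ) : ℝ) u v w (x.1, x.2.2)‖ * r ^ x.2.1 := by
    rw [summable_prod_of_nonneg (fun _ => by positivity)]
    refine ⟨hk, ?_⟩
    obtain ⟨-, L, hL⟩ := hA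
    obtain ⟨k₀, hk₀⟩ := exists_nat_gt (c - L)
    refine summable_of_ne_finset_zero (s := Finset.range k₀) fun k hk' => ?_
    have hk1 : (k₀ : ℝ) ≤ k := by exact_mod_cast not_lt.1 (fun h => hk' (Finset.mem_range.2 h))
    -- the operator `D^k` starts from the weight `c - k`, where there are no vectors
    have h0 : ∀ x : ℕ × ℕ, conjTerm A ψ s ((-K - 1 + x.1 : ℤ) : ℝ) u v w (k, x.2) = 0 := by
      intro x
      have h1 := A.mode_mem hu (A.mode_mem hv (A.D_pow_mem hw x.2)
        (s + k + x.2 - ((-K - 1 + x.1 : ℤ) : ℝ))) ((-K - 1 + x.1 : ℤ) : ℝ)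
      rw [hL _ (by push_cast; linarith), Submodule.mem_bot] at h1
      rw [conjTerm, h1]
      simp
    simp only [h0, norm_zero, zero_mul, tsum_zero]
  have htot2 : Summable fun x : ℕ × (ℕ × ℕ) =>
      ‖conjTerm A ψ s ((-K - 1 + x.1 : ℤ) : ℝ) u v w x.2‖ * r ^ x.1 := by
    let E : ℕ × (ℕ × ℕ) ≃ ℕ × (ℕ × ℕ) :=
      { toFun := fun x => (x.2.1, (x.1, x.2.2)), invFun := fun x => (x.2.1, (x.1, x.2.2)),
        left_inv := fun x => rfl, right_inv := fun x => rfl }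
    exact E.summable_iff.2 htot
  refine Summable.of_nonneg_of_le (fun m => by positivity) (fun m => ?_) htot2.prod
  have hm : Summable fun y => ‖conjTerm A ψ s ((-K - 1 + m : ℤ) : ℝ) u v w y‖ * r ^ m :=
    htot2.prod_factor m
  have hm' : Summable fun y => ‖conjTerm A ψ s ((-K - 1 + m : ℤ) : ℝ) u v w y‖ :=
    (summable_mul_right_iff (by positivity : r ^ m ≠ 0)).1 hm
  rw [← tsum_conjTerm ψ s u v w K m hK hm'.of_norm]
  refine (mul_le_mul_of_nonneg_right (norm_tsum_le_tsum_norm hm')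
    (by positivity : 0 ≤ r ^ m)).trans_eq ?_
  change _ = ∑' y, ‖conjTerm A ψ s ((-K - 1 + m : ℤ) : ℝ) u v w y‖ * r ^ m
  rw [tsum_mul_right]

/-! ### Elements of the meromorphic center -/

/-- The number `e^{(-x-1) π i}` by which the substitution of `-x` changes the coefficient of
index `x`. -/
def skewSign (x : ℝ) : ℂ := Complex.exp ((-(x : ℂ) - 1) * Real.pi * Complex.I)

theorem skewSign_intCast (p : ℤ) : skewSign p = (-1 : ℂ) ^ (-p - 1) := by
  rw [skewSign, ← Complex.exp_pi_mul_I, ← Complex.exp_int_mul]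
  congr 1
  push_cast
  ring

theorem mode_eq_zero_of_mem_center {u : V} (hu : u ∈ A.meromorphicCenter) {n : ℝ}
    (hn : ∀ k : ℤ, n ≠ k) (v : V) : A.mode n u v = 0 := by
  rw [hu.2.1 n hn]; rfl

/-- The skew-symmetry of the elements of the meromorphic center, as a finite sum. -/
theorem mode_right_of_mem_center {u : V} (hu : u ∈ A.meromorphicCenter) (v : V) (n : ℝ) (J : ℕ)
    (hJ : ∀ j : ℕ, J ≤ j → A.mode (n + j) u v = 0) :
    A.mode n v u = ∑ j ∈ Finset.range J,
      (skewSign (n + j) * (j.factorial : ℂ)⁻¹) • (A.D ^ j) (A.mode (n + j) u v) := by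
  refine eq_of_forall_pairing (𝒱 := 𝒱) fun f => ?_
  refine (hu.2.2 v n f).unique ?_
  rw [map_sum, map_sum]
  refine (hasSum_sum_of_ne_finset_zero (s := Finset.range J) (f := fun j : ℕ =>
    pairing 𝒱 f (embed 𝒱 ((skewSign (n + j) * (j.factorial : ℂ)⁻¹) •
      (A.D ^ j) (A.mode (n + j) u v)))) fun j hj => ?_).congr_fun fun j => ?_
  · rw [hJ j (by simpa using hj)]
    simp
  · simp only [skewSign]
    push_cast
    rw [one_div]

theorem mode_right_eq_zero_of_mem_center {u : V} (hu : u ∈ A.meromorphicCenter) (v : V) {n : ℝ}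
    (hn : ∀ j : ℕ, A.mode (n + j) u v = 0) : A.mode n v u = 0 := by
  rw [mode_right_of_mem_center hu v n 0 fun j _ => hn j, Finset.sum_range_zero]

theorem mode_right_eq_zero_of_ne_intCast {u : V} (hu : u ∈ A.meromorphicCenter) (v : V) {n : ℝ}
    (hn : ∀ k : ℤ, n ≠ k) : A.mode n v u = 0 :=
  mode_right_eq_zero_of_mem_center hu v fun j => mode_eq_zero_of_mem_center hu
    (fun k hk => hn (k - j) (by push_cast; linarith)) v

end OpenStringVertexAlgebra

/-! ### Expansions of the matrix coefficients with an element of the center -/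

theorem tsum_eq_tsum_of_injective {ι κ : Type*} {G : κ → ℂ} {e : ι → κ}
    (he : Function.Injective e) (h : ∀ x, (∀ k, x ≠ e k) → G x = 0) :
    ∑' x, G x = ∑' k, G (e k) := by
  refine (he.tsum_eq fun x hx => ?_).symm
  by_contra hc
  exact hx (h x fun k hk => hc ⟨k, hk.symm⟩)

theorem sum_range_succ_eq_sum_antidiagonal_snd {M : Type*} [AddCommMonoid M] (F : ℕ → M) (m : ℕ) :
    ∑ j ∈ Finset.range (m + 1), F j = ∑ y ∈ Finset.HasAntidiagonal.antidiagonal m, F y.2 := by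
  rw [← Finset.Nat.sum_antidiagonal_eq_sum_range_succ_mk (fun y => F y.1),
    ← Finset.Nat.sum_antidiagonal_swap]
  rfl

namespace OpenStringVertexAlgebra

variable {V : Type*} [AddCommGroup V] [Module ℂ V] {𝒱 : ℝ → Submodule ℂ V}
  [DirectSum.Decomposition 𝒱] {A : OpenStringVertexAlgebra 𝒱}

/-- The effect of skew-symmetry on iterates: an iterate of `v` and `u` at distance `1 - z`, around
the point `z`, is the analytic continuation of the iterate of `u` and `v` around the point `1`. -/
theorem tsum_iterate_skew {u : V} (hu : u ∈ A.meromorphicCenter) (v w : V) (ψ : V →ₗ[ℂ] ℂ)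
    (s : ℝ) {N : ℕ} (hN : ∀ p : ℤ, N ≤ p → A.mode p u v = 0)
    (hs : ∀ r : ℝ, 0 < r → r < 1 →
      Summable fun p : ℤ => ‖ψ (A.mode (s - p) (A.mode p u v) w)‖ * r ^ (-p - 1))
    {z : ℝ} (h1 : 2 / 3 < z) (h2 : z < 1) :
    ∑' q : ℝ, (((1 - z) ^ (-q - 1) * z ^ (-(s - q) - 1) : ℝ) : ℂ) *
        ψ (A.mode (s - q) (A.mode q v u) w) =
      ∑' p : ℤ, ψ (A.mode (s - p) (A.mode p u v) w) * ((z - 1 : ℝ) : ℂ) ^ (-p - 1) := by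
  have hz : 0 < z := by linarith
  set t : ℝ := 1 - z with ht
  have ht0 : 0 < t := by linarith
  have hinj : Function.Injective fun n : ℕ => (N : ℤ) - 1 - n := fun a b hab => by simpa using hab
  have hinj' : Function.Injective fun n : ℕ => (((N : ℤ) - 1 - n : ℤ) : ℝ) :=
    Int.cast_injective.comp hinj
  have h0 : ∀ q : ℝ, (∀ n : ℕ, q ≠ (((N : ℤ) - 1 - n : ℤ) : ℝ)) → A.mode q v u = 0 := by
    intro q hq
    by_cases hint : ∃ k : ℤ, q = k
    · obtain ⟨k, rfl⟩ := hint
      have hk : (N : ℤ) ≤ k := by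
        by_contra! hlt
        exact hq (N - 1 - k).toNat (by congr 1; lia)
      refine mode_right_eq_zero_of_mem_center hu v fun j => ?_
      have := hN (k + j) (by lia)
      push_cast at this
      exact this
    · push Not at hint
      exact mode_right_eq_zero_of_ne_intCast hu v hint
  rw [tsum_eq_tsum_of_injective hinj' (fun q hq => by rw [h0 q hq]; simp),
    tsum_eq_tsum_of_injective hinj (fun p hp => by
      rw [hN p (by
        by_contra! hlt
        exact hp (N - 1 - p).toNat (by lia))]
      simp)]
  set c : ℕ → ℂ := fun n => ψ (A.mode (s - ((N - 1 - n : ℤ) : ℝ)) (A.mode ((N - 1 - n : ℤ) : ℝ) u v)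
    w) * ((z - 1 : ℝ) : ℂ) ^ (-((N : ℤ) - 1 - n) - 1) with hc
  have key := hasSum_reexpand (N - s - 2) c (x := z) (t := t)
    (by rw [abs_of_pos ht0]; linarith) (by
      rw [abs_of_pos ht0]
      have hzt : 0 < z - t := by linarith
      have hr := hs (t / (z - t)) (by positivity) (by rw [div_lt_one hzt]; linarith)
      refine ((hr.comp_injective hinj).mul_left ((z - t) ^ (-s - 2))).congr fun n => ?_
      simp only [Function.comp_apply, hc]
      have e1 : ‖((z - 1 : ℝ) : ℂ) ^ (-((N : ℤ) - 1 - n) - 1)‖ = t ^ (-((N : ℤ) - 1 - n) - 1) := by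
        rw [norm_zpow, Complex.norm_real, Real.norm_of_nonpos (by linarith), ht, neg_sub]
      rw [norm_mul, e1, div_zpow,
        show (N : ℝ) - s - 2 - n = (-s - 2) - ((-((N : ℤ) - 1 - n) - 1 : ℤ) : ℝ) by
          push_cast; ring, Real.rpow_sub hzt (-s - 2), Real.rpow_intCast]
      field_simp)
  refine Eq.trans (tsum_congr fun m => ?_) (key.tsum_eq.trans (tsum_congr fun n => ?_))
  · rw [mode_right_of_mem_center hu v _ (m + 1) (fun j hj => by
      have := hN ((N : ℤ) - 1 - m + j) (by lia)
      push_cast at this ⊢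
      exact this), sum_range_succ_eq_sum_antidiagonal_snd, map_sum, LinearMap.sum_apply, map_sum,
      Finset.mul_sum, Finset.mul_sum]
    refine Finset.sum_congr rfl fun y hy => ?_
    have hm : (m : ℝ) = y.1 + y.2 := by
      exact_mod_cast (Finset.HasAntidiagonal.mem_antidiagonal.1 hy).symm
    set p : ℤ := (N : ℤ) - 1 - y.1 with hp
    have hpr : (p : ℝ) = N - 1 - y.1 := by rw [hp]; push_cast; ring
    have hq : (((N : ℤ) - 1 - m : ℤ) : ℝ) = p - y.2 := by
      push_cast; rw [hm, hpr]; ring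
    have e0 : (y.2.factorial : ℂ) ≠ 0 := by exact_mod_cast y.2.factorial_ne_zero
    have e1 : t ^ (-((p : ℝ) - y.2) - 1) = t ^ (-p - 1) * t ^ y.2 := by
      rw [show -((p : ℝ) - y.2) - 1 = ((-p - 1 : ℤ) : ℝ) + (y.2 : ℝ) by push_cast; ring,
        Real.rpow_add ht0, Real.rpow_intCast, Real.rpow_natCast]
    have e2 : ((z - 1 : ℝ) : ℂ) ^ (-p - 1) = (-1) ^ (-p - 1) * (t : ℂ) ^ (-p - 1) := by
      rw [← mul_zpow]
      congr 1
      rw [ht]; push_cast; ring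
    have e3 : Ring.choose ((N : ℝ) - s - 2 - y.1) y.2 =
        (-1) ^ y.2 * Ring.choose (s - (p - y.2)) y.2 := by
      rw [show (N : ℝ) - s - 2 - y.1 = -(s - p + 1) by rw [hpr]; ring, choose_neg_real]
      congr 2
      ring
    rw [hq, map_smul, LinearMap.smul_apply, map_smul, A.mode_D_pow, map_smul, smul_eq_mul,
      smul_eq_mul, sub_add_cancel, e1, skewSign_intCast]
    simp only [hc]
    rw [← hp, e2, e3, show s - ((p : ℝ) - y.2) - y.2 = s - p by ring,
      show -(s - ((p : ℝ) - y.2)) - 1 = N - s - 2 - m by rw [hm, hpr]; ring]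
    push_cast
    field_simp
  · rw [show z + t = 1 by rw [ht]; ring, Real.one_rpow, Complex.ofReal_one, mul_one]

/-- The Jacobi identity for an element of the meromorphic center, for matrix coefficients. -/
theorem jacobiDefect_of_mem_center (hA : A.GradingRestricted) {a b d c s : ℝ} {u v w : V}
    (hu₀ : u ∈ A.meromorphicCenter) (hu : u ∈ 𝒱 a) (hv : v ∈ 𝒱 b) (hw : w ∈ 𝒱 d)
    (hc : c = a + b + d - s - 2) (φ : Module.Dual ℂ (𝒱 c)) (l m : ℤ) :
    jacobiDefect (fun p => homogeneousFunctional 𝒱 c φ (A.mode p u (A.mode (s - p) v w)))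
      (fun p => homogeneousFunctional 𝒱 c φ (A.mode (s - p) (A.mode p u v) w))
      (fun p => homogeneousFunctional 𝒱 c φ (A.mode (s - p) v (A.mode p u w))) l m = 0 := by
  set ψ := homogeneousFunctional 𝒱 c φ with hψ
  obtain ⟨N₁, hN₁⟩ := hA.mode_truncation v w
  obtain ⟨N₂, hN₂⟩ := hA.mode_truncation u v
  obtain ⟨N₃, hN₃⟩ := hA.mode_truncation u w
  obtain ⟨K, hK⟩ := exists_nat_ge (N₁ - s)
  obtain ⟨N, hN⟩ := exists_nat_ge N₂
  obtain ⟨M, hM⟩ := exists_nat_ge N₃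
  have hN' : ∀ p : ℤ, N ≤ p → A.mode p u v = 0 := fun p hp =>
    hN₂ p (hN.trans (by exact_mod_cast hp))
  have hM' : ∀ p : ℤ, M ≤ p → A.mode p u w = 0 := fun p hp =>
    hN₃ p (hM.trans (by exact_mod_cast hp))
  have hK' : ∀ p : ℤ, p < -(K : ℤ) - 1 → ψ (A.mode p u (A.mode (s - p) v w)) = 0 := by
    intro p hp
    have hp' : (p : ℝ) < -K - 1 := by exact_mod_cast hp
    rw [hN₁ (s - p) (by linarith), map_zero, map_zero]
  have inj1 : Function.Injective fun p : ℤ => s - (p : ℝ) := fun p q h => by simpa using h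
  have inj2 : Function.Injective fun p : ℤ => (p : ℝ) := Int.cast_injective
  have hgs : ∀ r : ℝ, 0 < r → r < 1 →
      Summable fun p : ℤ => ‖ψ (A.mode (s - p) (A.mode p u v) w)‖ * r ^ (-p - 1) := by
    intro r h0 h1
    refine ((A.summable_iterate hu hv hw hc φ h0 h1).comp_injective inj2).congr fun p => ?_
    simp only [Function.comp_apply, Real.one_rpow, mul_one]
    rw [← Real.rpow_intCast]
    push_cast
    rfl
  have hint : ∀ q : ℝ, (∀ p : ℤ, q ≠ s - p) → ∀ y, A.mode (s - q) u y = 0 := fun q hq y =>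
    mode_eq_zero_of_mem_center hu₀ (fun k hk => hq k (by linarith)) y
  refine jacobiDefect_eq_zero_of_convergence (K := K) (N := N) (M := M) hK'
    (fun p hp => by rw [hN' p hp]; simp) (fun p hp => by rw [hM' p hp]; simp) ?_ hgs ?_ ?_ ?_ ?_ l m
  · intro r hr
    refine ((A.summable_product hu hv hw hc φ one_pos hr).comp_injective inj1).congr fun p => ?_
    simp only [Function.comp_apply, Real.one_rpow, mul_one, sub_sub_cancel]
    rw [← Real.rpow_intCast]
    push_cast
    rfl
  · intro r h0 h1
    have hc' : c = b + a + d - s - 2 := by rw [hc]; ring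
    refine ((A.summable_product hv hu hw hc' φ h0 h1).comp_injective inj2).congr fun p => ?_
    simp only [Function.comp_apply, Real.one_rpow, one_mul]
    rw [← Real.rpow_intCast]
    push_cast
    rfl
  · intro r h0 h1
    exact summable_reexpanded_product hA hu hv hw hc φ hK' h0 h1
  · intro z h1 h2
    have h := A.tsum_product_eq_tsum_iterate hu hv hw hc φ (r₁ := z) (r₂ := 1) h1 (by linarith)
    rw [tsum_eq_tsum_of_injective inj1 (fun q hq => by rw [hint q hq]; simp),
      tsum_eq_tsum_of_injective inj2 (fun q hq => by
        rw [mode_eq_zero_of_mem_center hu₀ hq]; simp)] at h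
    refine Eq.trans (tsum_congr fun p => ?_) (h.trans (tsum_congr fun p => ?_))
    · simp only [Real.one_rpow, mul_one, sub_sub_cancel]
      rw [mul_comm, ← Complex.ofReal_zpow, ← Real.rpow_intCast]
      push_cast
      rfl
    · simp only [Real.one_rpow, mul_one]
      rw [mul_comm, ← Complex.ofReal_zpow, ← Real.rpow_intCast]
      push_cast
      rfl
  · intro z h1 h2
    have h := A.tsum_product_eq_tsum_iterate hv hu hw (by rw [hc]; ring : c = b + a + d - s - 2) φ
      (r₁ := 1) (r₂ := z) h2 (by linarith)
    rw [tsum_iterate_skew hu₀ v w ψ s hN' hgs h1 h2, tsum_eq_tsum_of_injective inj2 (fun q hq => by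
      rw [mode_eq_zero_of_mem_center hu₀ hq]; simp)] at h
    rw [← h]
    refine tsum_congr fun p => ?_
    simp only [Real.one_rpow, one_mul]
    rw [mul_comm, ← Complex.ofReal_zpow, ← Real.rpow_intCast]
    push_cast
    rfl

/-! ### The grading of the meromorphic center -/

theorem embed_mode_left {b : ℝ} {v : V} (hv : v ∈ 𝒱 b) (n a : ℝ) (u : V) :
    (embed 𝒱 (A.mode n u v) (a + b - n - 1) : V) = A.mode n (embed 𝒱 u a) v := by
  have : (𝒱 (a + b - n - 1)).subtype ∘ₗ LinearMap.proj (a + b - n - 1) ∘ₗ embed 𝒱 ∘ₗ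
      (A.mode n).flip v = (A.mode n).flip v ∘ₗ (𝒱 a).subtype ∘ₗ LinearMap.proj a ∘ₗ embed 𝒱 := by
    refine linearMap_ext_of_homogeneous (𝒱 := 𝒱) fun k u hu => ?_
    simp only [LinearMap.comp_apply, LinearMap.flip_apply, LinearMap.proj_apply,
      Submodule.subtype_apply]
    rw [coe_embed_of_mem hu, coe_embed_of_mem (A.mode_mem hu hv n)]
    by_cases h : a = k
    · rw [if_pos h, if_pos (by rw [h])]
    · rw [if_neg h, if_neg (fun h' => h (by linarith))]; simp
  exact LinearMap.congr_fun this u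

theorem embed_mode_right {b : ℝ} {v : V} (hv : v ∈ 𝒱 b) (n a : ℝ) (u : V) :
    (embed 𝒱 (A.mode n v u) (a + b - n - 1) : V) = A.mode n v (embed 𝒱 u a) := by
  have : (𝒱 (a + b - n - 1)).subtype ∘ₗ LinearMap.proj (a + b - n - 1) ∘ₗ embed 𝒱 ∘ₗ
      A.mode n v = A.mode n v ∘ₗ (𝒱 a).subtype ∘ₗ LinearMap.proj a ∘ₗ embed 𝒱 := by
    refine linearMap_ext_of_homogeneous (𝒱 := 𝒱) fun k u hu => ?_
    simp only [LinearMap.comp_apply, LinearMap.proj_apply, Submodule.subtype_apply]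
    rw [coe_embed_of_mem hu, coe_embed_of_mem (A.mode_mem hv hu n)]
    by_cases h : a = k
    · rw [if_pos h, if_pos (by rw [h]; ring)]
    · rw [if_neg h, if_neg (fun h' => h (by linarith))]; simp
  exact LinearMap.congr_fun this u

theorem embed_D_pow (j : ℕ) (a : ℝ) (u : V) :
    (embed 𝒱 ((A.D ^ j) u) (a + j) : V) = (A.D ^ j) (embed 𝒱 u a) := by
  have : (𝒱 (a + j)).subtype ∘ₗ LinearMap.proj (a + j) ∘ₗ embed 𝒱 ∘ₗ
      (A.D ^ j) = (A.D ^ j) ∘ₗ (𝒱 a).subtype ∘ₗ LinearMap.proj a ∘ₗ embed 𝒱 := by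
    refine linearMap_ext_of_homogeneous (𝒱 := 𝒱) fun k u hu => ?_
    simp only [LinearMap.comp_apply, LinearMap.proj_apply, Submodule.subtype_apply]
    rw [coe_embed_of_mem hu, coe_embed_of_mem (A.D_pow_mem hu j)]
    by_cases h : a = k
    · rw [if_pos h, if_pos (by rw [h])]
    · rw [if_neg h, if_neg (fun h' => h (by linarith))]; simp
  exact LinearMap.congr_fun this u

/-- Skew-symmetry has to be checked for homogeneous vectors only, and there as a finite sum. -/
theorem mem_center_of_skew {u : V} (h1 : u ∈ ⨆ k : ℤ, 𝒱 (k : ℝ))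
    (h2 : ∀ n : ℝ, (∀ k : ℤ, n ≠ k) → A.mode n u = 0)
    (h3 : ∀ b, ∀ v ∈ 𝒱 b, ∀ n : ℝ, ∃ J : ℕ, (∀ j : ℕ, J ≤ j → A.mode (n + j) u v = 0) ∧
      A.mode n v u = ∑ j ∈ Finset.range J,
        (skewSign (n + j) * (j.factorial : ℂ)⁻¹) • (A.D ^ j) (A.mode (n + j) u v)) :
    u ∈ A.meromorphicCenter := by
  refine ⟨h1, h2, fun v n f => ?_⟩
  induction v using DirectSum.Decomposition.inductionOn 𝒱 with
  | zero => simp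
  | add v v' hv hv' =>
    simpa only [map_add, LinearMap.add_apply, smul_add] using hv.add hv'
  | homogeneous v =>
    obtain ⟨J, hJ, h⟩ := h3 _ v v.2 n
    rw [h, map_sum, map_sum]
    refine (hasSum_sum_of_ne_finset_zero (s := Finset.range J) (f := fun j : ℕ =>
      pairing 𝒱 f (embed 𝒱 ((skewSign (n + j) * (j.factorial : ℂ)⁻¹) •
        (A.D ^ j) (A.mode (n + j) u v)))) fun j hj => ?_).congr_fun fun j => ?_
    · rw [hJ j (by simpa using hj)]
      simp
    · simp only [skewSign]
      push_cast
      rw [one_div]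

theorem embed_eq_zero_of_mem_iSup {u : V} (hu : u ∈ ⨆ k : ℤ, 𝒱 (k : ℝ)) {a : ℝ}
    (ha : ∀ k : ℤ, a ≠ k) : (embed 𝒱 u a : V) = 0 := by
  induction hu using Submodule.iSup_induction' with
  | mem k x hx => rw [coe_embed_of_mem hx, if_neg (ha k)]
  | zero => simp
  | add x y _ _ hx hy => simp [hx, hy]

/-- The meromorphic center is a graded subspace: its conditions hold in each weight separately. -/
theorem embed_mem_center (hA : A.GradingRestricted) {u : V} (hu : u ∈ A.meromorphicCenter)
    (a : ℝ) : (embed 𝒱 u a : V) ∈ A.meromorphicCenter := by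
  by_cases ha : ∃ k : ℤ, a = k
  swap
  · push Not at ha
    rw [embed_eq_zero_of_mem_iSup hu.1 ha]
    exact zero_mem _
  obtain ⟨k, rfl⟩ := ha
  refine mem_center_of_skew (Submodule.mem_iSup_of_mem k (embed 𝒱 u k).2) (fun n hn => ?_)
    fun b v hv n => ?_
  · refine linearMap_ext_of_homogeneous (𝒱 := 𝒱) fun b v hv => ?_
    rw [← embed_mode_left hv, mode_eq_zero_of_mem_center hu hn]
    simp
  · obtain ⟨N, hN⟩ := hA.mode_truncation u v
    obtain ⟨J, hJ⟩ := exists_nat_ge (N - n)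
    have hJ' : ∀ j : ℕ, J ≤ j → A.mode (n + j) u v = 0 := fun j hj => hN _ (by
      have : (J : ℝ) ≤ j := by exact_mod_cast hj
      linarith)
    refine ⟨J, fun j hj => ?_, ?_⟩
    · rw [← embed_mode_left hv, hJ' j hj]
      simp
    · rw [← embed_mode_right hv, mode_right_of_mem_center hu v n J hJ', map_sum, Finset.sum_apply,
        Submodule.coe_sum]
      refine Finset.sum_congr rfl fun j _ => ?_
      rw [← embed_mode_left hv, ← embed_D_pow, map_smul, Pi.smul_apply, Submodule.coe_smul,
        show (k : ℝ) + b - (n + j) - 1 + j = k + b - n - 1 by ring]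

/-- Induction over the homogeneous elements of the center; their weights are integers. -/
theorem center_induction (hA : A.GradingRestricted) {p : V → Prop} (h0 : p 0)
    (hadd : ∀ u v, p u → p v → p (u + v))
    (hhom : ∀ (k : ℤ), ∀ u ∈ A.meromorphicCenter, u ∈ 𝒱 k → p u) {u : V}
    (hu : u ∈ A.meromorphicCenter) : p u := by
  classical
  rw [← DirectSum.sum_support_decompose 𝒱 u]
  refine Finset.sum_induction _ p hadd h0 fun a _ => ?_
  change p (embed 𝒱 u a)
  by_cases ha : ∃ k : ℤ, a = k
  · obtain ⟨k, rfl⟩ := ha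
    exact hhom k _ (embed_mem_center hA hu k) (embed 𝒱 u k).2
  · push Not at ha
    rwa [embed_eq_zero_of_mem_iSup hu.1 ha]

theorem isInternal_center (hA : A.GradingRestricted) : DirectSum.IsInternal
    fun k : ℤ => (𝒱 (k : ℝ)).comap A.meromorphicCenter.subtype := by
  rw [DirectSum.isInternal_submodule_iff_iSupIndep_and_iSup_eq_top]
  constructor
  · have h1 : iSupIndep fun k : ℤ => 𝒱 (k : ℝ) :=
      (DirectSum.Decomposition.isInternal 𝒱).submodule_iSupIndep.comp Int.cast_injective
    refine fun k => Submodule.disjoint_def.2 fun x hx hx' => Subtype.ext ?_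
    refine Submodule.disjoint_def.1 (h1 k) x hx ?_
    have h2 := Submodule.mem_map_of_mem (f := A.meromorphicCenter.subtype) hx'
    simp only [Submodule.map_iSup] at h2
    exact iSup₂_mono (fun j _ => Submodule.map_comap_le _ _) h2
  · rw [eq_top_iff]
    rintro ⟨u, hu⟩ -
    have : ∀ u ∈ A.meromorphicCenter, ∃ x : A.meromorphicCenter, (x : V) = u ∧
        x ∈ ⨆ k : ℤ, (𝒱 (k : ℝ)).comap A.meromorphicCenter.subtype := by
      intro u hu
      refine center_induction hA (p := fun u => ∃ x : A.meromorphicCenter, (x : V) = u ∧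
        x ∈ ⨆ k : ℤ, (𝒱 (k : ℝ)).comap A.meromorphicCenter.subtype) ⟨0, rfl, zero_mem _⟩
        ?_ ?_ hu
      · rintro _ _ ⟨x, rfl, hx⟩ ⟨y, rfl, hy⟩
        exact ⟨x + y, rfl, add_mem hx hy⟩
      · intro k u hu huk
        exact ⟨⟨u, hu⟩, rfl, Submodule.mem_iSup_of_mem k huk⟩
    obtain ⟨x, hx, hx'⟩ := this u hu
    rwa [show (⟨u, hu⟩ : A.meromorphicCenter) = x from Subtype.ext hx.symm]

/-- For the vacuum, skew-symmetry is the formula `Y(v, x) 1 = e^{xD} v`. -/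
theorem vac_mem_center : A.vac ∈ A.meromorphicCenter := by
  refine mem_center_of_skew (Submodule.mem_iSup_of_mem 0 (by simpa using A.vac_mem))
    (fun n hn => ?_) fun b v _ n => ?_
  · ext v
    rw [A.mode_vac_left, if_neg (fun h => hn (-1) (by simpa using h))]
    rfl
  · by_cases h : ∃ j : ℕ, n = -1 - j
    · obtain ⟨j, rfl⟩ := h
      refine ⟨j + 1, fun i hi => ?_, ?_⟩
      · rw [A.mode_vac_left, if_neg]
        have : (j : ℝ) + 1 ≤ i := by exact_mod_cast hi
        linarith
      · have e1 : skewSign (-1) = 1 := by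
          have := skewSign_intCast (-1)
          simpa using this
        rw [A.mode_vac_of_nat, Finset.sum_eq_single j, sub_add_cancel, A.mode_vac_left, if_pos rfl,
          e1, one_mul]
        · intro i _ hi
          rw [A.mode_vac_left, if_neg, map_zero, smul_zero]
          intro h'
          exact hi (by exact_mod_cast (by linarith : (i : ℝ) = j))
        · intro hj
          exact absurd (Finset.self_mem_range_succ j) hj
    · push Not at h
      refine ⟨0, fun j _ => ?_, ?_⟩
      · rw [A.mode_vac_left, if_neg (fun h' => h j (by linarith))]
      · rw [A.mode_vac_of_ne h, Finset.sum_range_zero]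

end OpenStringVertexAlgebra

/-! ### The Jacobi identity for an element of the meromorphic center -/

theorem cast_choose_int_real (n : ℤ) (i : ℕ) :
    Ring.choose (n : ℝ) i = ((Ring.choose n i : ℤ) : ℝ) :=
  (Ring.map_choose (Int.castRingHom ℝ) n i).symm

/-- Summation over a triangle. -/
theorem sum_range_sum_antidiagonal {M : Type*} [AddCommMonoid M] (F : ℕ × ℕ → M) (N : ℕ)
    (hF : ∀ y : ℕ × ℕ, N ≤ y.1 + y.2 → F y = 0) :
    ∑ j ∈ Finset.range N, ∑ y ∈ Finset.HasAntidiagonal.antidiagonal j, F y =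
      ∑ j ∈ Finset.range N, ∑ i ∈ Finset.range N, F (j, i) := by
  have h1 : ∑ y ∈ Finset.range N ×ˢ Finset.range N with y.1 + y.2 < N, F y =
      ∑ j ∈ Finset.range N, ∑ i ∈ Finset.range N, F (j, i) := by
    rw [← Finset.sum_product']
    exact Finset.sum_filter_of_ne fun y _ hy => by by_contra! h; exact hy (hF y h)
  rw [← h1, ← Finset.sum_fiberwise_of_maps_to (t := Finset.range N)
    (g := fun y : ℕ × ℕ => y.1 + y.2) (fun y hy => by simpa using (Finset.mem_filter.1 hy).2)]
  refine Finset.sum_congr rfl fun j hj => Finset.sum_congr ?_ fun y _ => rfl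
  ext y
  simp only [Finset.HasAntidiagonal.mem_antidiagonal, Finset.mem_filter, Finset.mem_product,
    Finset.mem_range] at hj ⊢
  lia

namespace OpenStringVertexAlgebra

variable {V : Type*} [AddCommGroup V] [Module ℂ V] {𝒱 : ℝ → Submodule ℂ V}
  [DirectSum.Decomposition 𝒱] {A : OpenStringVertexAlgebra 𝒱}

/-- The `i`-th term of the difference of the two sides of the component form of the Jacobi
identity. -/
def jacobiTerm (A : OpenStringVertexAlgebra 𝒱) (l m : ℤ) (n : ℝ) (u v w : V) (i : ℕ) : V :=
  ((-1 : ℤ) ^ i * Ring.choose l i) • A.mode (m + l - i) u (A.mode (n + i) v w) -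
    ((l.negOnePow : ℤ) * (-1 : ℤ) ^ i * Ring.choose l i) •
      A.mode (n + l - i) v (A.mode (m + i) u w) -
    (Ring.choose m i) • A.mode (m + n - i) (A.mode (l + i) u v) w

theorem GradingRestricted.mode_add_nat_eventually (hA : A.GradingRestricted) (x : ℝ) (u v : V) :
    ∀ᶠ i : ℕ in Filter.atTop, A.mode (x + i) u v = 0 := by
  obtain ⟨N, hN⟩ := hA.mode_truncation u v
  filter_upwards [Filter.eventually_ge_atTop ⌈N - x⌉₊] with i hi
  exact hN _ (by linarith [Nat.ceil_le.1 hi])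

theorem finite_support_of_eventually {M : Type*} [Zero M] {t : ℕ → M}
    (h : ∀ᶠ i in Filter.atTop, t i = 0) : t.support.Finite := by
  rw [← Nat.cofinite_eq_atTop, Filter.eventually_cofinite] at h
  exact h

theorem finsum_eq_zero_of_add {M : Type*} [AddCommMonoid M] {t t₁ t₂ : ℕ → M}
    (h : ∀ i, t i = t₁ i + t₂ i) (h₁ : t₁.support.Finite) (h₂ : t₂.support.Finite)
    (e₁ : ∑ᶠ i, t₁ i = 0) (e₂ : ∑ᶠ i, t₂ i = 0) : ∑ᶠ i, t i = 0 := by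
  rw [finsum_congr h, finsum_add_distrib h₁ h₂, e₁, e₂, add_zero]

theorem jacobiTerm_eventually (hA : A.GradingRestricted) (l m : ℤ) (n : ℝ) (u v w : V) :
    ∀ᶠ i in Filter.atTop, jacobiTerm A l m n u v w i = 0 := by
  filter_upwards [hA.mode_add_nat_eventually n v w, hA.mode_add_nat_eventually m u w,
    hA.mode_add_nat_eventually l u v] with i h1 h2 h3
  simp [jacobiTerm, h1, h2, h3]

theorem finsum_jacobiTerm_of_homogeneous (hA : A.GradingRestricted) {a b d : ℝ} {u v w : V}
    (hu₀ : u ∈ A.meromorphicCenter) (hu : u ∈ 𝒱 a) (hv : v ∈ 𝒱 b) (hw : w ∈ 𝒱 d) (l m : ℤ)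
    (n : ℝ) : ∑ᶠ i, jacobiTerm A l m n u v w i = 0 := by
  have hmem : ∀ i, jacobiTerm A l m n u v w i ∈ 𝒱 (a + b + d - (m + l + n) - 2) := by
    intro i
    refine sub_mem (sub_mem (zsmul_mem ?_ _) (zsmul_mem ?_ _)) (zsmul_mem ?_ _)
    · convert A.mode_mem hu (A.mode_mem hv hw (n + i)) (m + l - i) using 2; ring
    · convert A.mode_mem hv (A.mode_mem hu hw (m + i)) (n + l - i) using 2; ring
    · convert A.mode_mem (A.mode_mem hu hv (l + i)) hw (m + n - i) using 2; ring
  have hsum : ∑ᶠ i, jacobiTerm A l m n u v w i ∈ 𝒱 (a + b + d - (m + l + n) - 2) :=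
    finsum_induction (· ∈ 𝒱 (a + b + d - (m + l + n) - 2)) (zero_mem _)
      (fun _ _ => add_mem) hmem
  refine eq_of_forall_dual (𝒱 := 𝒱) hsum (zero_mem _) fun φ => ?_
  rw [← homogeneousFunctional_of_mem φ, ← homogeneousFunctional_of_mem φ (zero_mem _), map_zero]
  have hfin := finite_support_of_eventually (jacobiTerm_eventually hA l m n u v w)
  have key := jacobiDefect_of_mem_center hA hu₀ hu hv hw (s := m + l + n) rfl φ l m
  set ψ := homogeneousFunctional 𝒱 _ φ with hψ
  have hmap : ψ (∑ᶠ i, jacobiTerm A l m n u v w i) = ∑ᶠ i, ψ (jacobiTerm A l m n u v w i) :=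
    AddMonoidHom.map_finsum ψ.toAddMonoidHom hfin
  have hs : ∀ t : ℕ → ℂ, (∀ᶠ i in Filter.atTop, t i = 0) → Summable t := fun t ht =>
    summable_of_hasFiniteSupport (finite_support_of_eventually ht)
  have e1 : ∀ i : ℕ, (m : ℝ) + l + n - (m + l - i) = n + i := fun i => by ring
  have e2 : ∀ i : ℕ, (m : ℝ) + l + n - (m + i) = n + l - i := fun i => by ring
  have e3 : ∀ i : ℕ, (m : ℝ) + l + n - (l + i) = m + n - i := fun i => by ring
  have hvw := hA.mode_add_nat_eventually n v w
  have huw := hA.mode_add_nat_eventually m u w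
  have huv := hA.mode_add_nat_eventually l u v
  rw [← key, hmap, ← tsum_eq_finsum (L := .unconditional ℕ), jacobiDefect]
  · push_cast
    simp only [e1, e2, e3]
    rw [← Summable.tsum_sub, ← Summable.tsum_sub]
    · refine tsum_congr fun i => ?_
      simp only [jacobiTerm, map_sub, ← Int.cast_smul_eq_zsmul ℂ, map_smul, smul_eq_mul]
      push_cast
      rfl
    · exact hs _ (by filter_upwards [hvw, huw] with i h1 h2; simp [h1, h2])
    · exact hs _ (by filter_upwards [huv] with i h1; simp [h1])
    · exact hs _ (by filter_upwards [hvw] with i h1; simp [h1])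
    · exact hs _ (by filter_upwards [huw] with i h1; simp [h1])
  · refine finite_support_of_eventually ?_
    filter_upwards [jacobiTerm_eventually hA l m n u v w] with i h
    rw [h, map_zero]

theorem finsum_jacobiTerm (hA : A.GradingRestricted) {u : V} (hu : u ∈ A.meromorphicCenter)
    (l m : ℤ) (n : ℝ) (v w : V) : ∑ᶠ i, jacobiTerm A l m n u v w i = 0 := by
  have hfin := fun u v w =>
    finite_support_of_eventually (jacobiTerm_eventually hA l m n u v w)
  refine center_induction hA (p := fun u => ∑ᶠ i, jacobiTerm A l m n u v w i = 0)
    (by simp [jacobiTerm]) (fun u u' hu hu' => ?_) (fun k u hu huk => ?_) hu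
  · refine finsum_eq_zero_of_add (fun i => ?_) (hfin _ _ _) (hfin _ _ _) hu hu'
    simp only [jacobiTerm, map_add, LinearMap.add_apply, smul_add]
    abel
  · induction v using DirectSum.Decomposition.inductionOn 𝒱 with
    | zero => simp [jacobiTerm]
    | add v v' hv hv' =>
      refine finsum_eq_zero_of_add (fun i => ?_) (hfin _ _ _) (hfin _ _ _) hv hv'
      simp only [jacobiTerm, map_add, LinearMap.add_apply, smul_add]
      abel
    | homogeneous v =>
      induction w using DirectSum.Decomposition.inductionOn 𝒱 with
      | zero => simp [jacobiTerm]
      | add w w' hw hw' =>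
        refine finsum_eq_zero_of_add (fun i => ?_) (hfin _ _ _) (hfin _ _ _) hw hw'
        simp only [jacobiTerm, map_add, smul_add]
        abel
      | homogeneous w => exact finsum_jacobiTerm_of_homogeneous hA hu huk v.2 w.2 l m n

/-- The Jacobi identity for an element of the meromorphic center and two arbitrary vectors. -/
theorem jacobi_of_mem_center (hA : A.GradingRestricted) {u : V} (hu : u ∈ A.meromorphicCenter)
    (l m : ℤ) (n : ℝ) (v w : V) :
    (∑ᶠ i : ℕ, ((-1 : ℤ) ^ i * Ring.choose l i) • A.mode (m + l - i) u (A.mode (n + i) v w)) -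
      (∑ᶠ i : ℕ, ((l.negOnePow : ℤ) * (-1 : ℤ) ^ i * Ring.choose l i) •
        A.mode (n + l - i) v (A.mode (m + i) u w)) =
      ∑ᶠ i : ℕ, (Ring.choose m i) • A.mode (m + n - i) (A.mode (l + i) u v) w := by
  have hvw := hA.mode_add_nat_eventually n v w
  have huw := hA.mode_add_nat_eventually m u w
  have huv := hA.mode_add_nat_eventually l u v
  have h := finsum_jacobiTerm hA hu l m n v w
  simp only [jacobiTerm] at h
  rwa [finsum_sub_distrib, finsum_sub_distrib, sub_eq_zero] at h
  · exact finite_support_of_eventually (by filter_upwards [hvw] with i h1; simp [h1])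
  · exact finite_support_of_eventually (by filter_upwards [huw] with i h1; simp [h1])
  · exact finite_support_of_eventually (by filter_upwards [hvw, huw] with i h1 h2; simp [h1, h2])
  · exact finite_support_of_eventually (by filter_upwards [huv] with i h1; simp [h1])

theorem finsum_eq_sum_range {M : Type*} [AddCommMonoid M] {t : ℕ → M} (N : ℕ)
    (h : ∀ i, N ≤ i → t i = 0) : ∑ᶠ i, t i = ∑ i ∈ Finset.range N, t i :=
  finsum_eq_sum_of_support_subset _ fun i hi => by
    simp only [Finset.coe_range, Set.mem_Iio]
    by_contra! hc
    exact hi (h i hc)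

/-- The commutator formula. -/
theorem commutator_of_mem_center (hA : A.GradingRestricted) {u : V}
    (hu : u ∈ A.meromorphicCenter) (m : ℤ) (n : ℝ) (v w : V) (N : ℕ)
    (hN : ∀ i : ℕ, N ≤ i → A.mode i u v = 0) :
    A.mode m u (A.mode n v w) - A.mode n v (A.mode m u w) =
      ∑ i ∈ Finset.range N, (Ring.choose m i) • A.mode (m + n - i) (A.mode i u v) w := by
  have h := jacobi_of_mem_center hA hu 0 m n v w
  rw [finsum_eq_single _ 0, finsum_eq_single _ 0, finsum_eq_sum_range N] at h
  · simpa using h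
  · intro i hi
    simp [hN i hi]
  · intro i hi
    simp [Ring.choose_zero_ite, hi]
  · intro i hi
    simp [Ring.choose_zero_ite, hi]

/-- The associator formula. -/
theorem associator_of_mem_center (hA : A.GradingRestricted) {u : V}
    (hu : u ∈ A.meromorphicCenter) (l : ℤ) (n : ℝ) (v w : V) (N : ℕ)
    (hN : ∀ i : ℕ, N ≤ i → A.mode (n + i) v w = 0) (hN' : ∀ i : ℕ, N ≤ i → A.mode i u w = 0) :
    A.mode n (A.mode l u v) w =
      ∑ i ∈ Finset.range N, (((-1 : ℤ) ^ i * Ring.choose l i) •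
          A.mode (l - i) u (A.mode (n + i) v w) -
        ((l.negOnePow : ℤ) * (-1 : ℤ) ^ i * Ring.choose l i) •
          A.mode (n + l - i) v (A.mode i u w)) := by
  have h := jacobi_of_mem_center hA hu l 0 n v w
  rw [finsum_eq_sum_range N, finsum_eq_sum_range N, finsum_eq_single _ 0] at h
  · rw [Finset.sum_sub_distrib]
    simpa using h.symm
  · intro i hi
    simp [Ring.choose_zero_ite, hi]
  · intro i hi
    simp [hN' i hi]
  · intro i hi
    simp [hN i hi]

/-! ### The meromorphic center is closed under the vertex operators -/

theorem skewSign_add_intCast (x : ℝ) (k : ℤ) : skewSign (x + k) = (-1) ^ k * skewSign x := by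
  rw [skewSign, skewSign, show ((-1 : ℂ)) ^ k = Complex.exp (k * -(Real.pi * Complex.I)) by
    rw [Complex.exp_int_mul, Complex.exp_neg_pi_mul_I], ← Complex.exp_add]
  congr 1
  push_cast
  ring

theorem coe_negOnePow_eq_zpow (n : ℤ) : ((n.negOnePow : ℤ) : ℂ) = (-1) ^ n := by
  rw [Int.coe_negOnePow]
  obtain ⟨k, rfl | rfl⟩ := n.eq_nat_or_neg
  · simp
  · rw [Int.natAbs_neg, Int.natAbs_natCast, zpow_neg, zpow_natCast, ← inv_pow, inv_neg_one]

theorem skewSign_add_natCast (x : ℝ) (i : ℕ) : skewSign (x + i) = (-1) ^ i * skewSign x := by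
  simpa using skewSign_add_intCast x i

/-- Skew-symmetry is inherited by `u_n v`: the commutator formula expresses `w_k u_n v` through
`u_n (w_k v)` and the `(u_i w)_{n+k-i} v`, skew-symmetry for `v` turns these into divided powers of
`D` applied to vectors on which `v` and `u` act, and the associator formula collects the result. -/
theorem mode_right_mode (hA : A.GradingRestricted) {u v : V} (hu : u ∈ A.meromorphicCenter)
    (hv : v ∈ A.meromorphicCenter) (n : ℤ) (k : ℝ) (w : V) (N : ℕ)
    (huw : ∀ i : ℕ, N ≤ i → A.mode i u w = 0) (hvw : ∀ i : ℕ, N ≤ i → A.mode (k + i) v w = 0)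
    (hvuw : ∀ i < N, ∀ j : ℕ, N ≤ j → A.mode (n + k - i + j) v (A.mode i u w) = 0) :
    A.mode k w (A.mode n u v) = ∑ j ∈ Finset.range N,
      (skewSign (k + j) * (j.factorial : ℂ)⁻¹) • (A.D ^ j) (A.mode (k + j) (A.mode n u v) w) := by
  have h1 : A.mode n u (A.mode k w v) = ∑ j ∈ Finset.range N, ∑ i ∈ Finset.range N,
      (skewSign (k + j) * (j.factorial : ℂ)⁻¹ * ((-1 : ℤ) ^ i * Ring.choose n i : ℤ)) •
        (A.D ^ j) (A.mode (n - i) u (A.mode (k + j + i) v w)) := by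
    rw [← sum_range_sum_antidiagonal (fun y : ℕ × ℕ =>
      (skewSign (k + y.1) * (y.1.factorial : ℂ)⁻¹ * ((-1 : ℤ) ^ y.2 * Ring.choose n y.2 : ℤ)) •
        (A.D ^ y.1) (A.mode (n - y.2) u (A.mode (k + y.1 + y.2) v w))) N (fun y hy => by
          have := hvw (y.1 + y.2) hy
          push_cast at this
          rw [add_assoc, this]
          simp), mode_right_of_mem_center hv w k N hvw, map_sum]
    refine Finset.sum_congr rfl fun j _ => ?_
    rw [map_smul, mul_smul, A.mode_D_pow_right, Finset.smul_sum]
    refine Finset.sum_congr rfl fun y hy => ?_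
    have hj : (j : ℝ) = y.1 + y.2 := by
      exact_mod_cast (Finset.HasAntidiagonal.mem_antidiagonal.1 hy).symm
    rw [hj, ← add_assoc, skewSign_add_natCast _ y.2, smul_smul, cast_choose_int_real]
    congr 1
    push_cast
    ring
  have h2 : ∀ i < N, A.mode (n + k - i) (A.mode i u w) v = ∑ j ∈ Finset.range N,
      (skewSign (k + j) * (j.factorial : ℂ)⁻¹ * (-1) ^ n * (-1) ^ i) •
        (A.D ^ j) (A.mode (k + j + n - i) v (A.mode i u w)) := by
    intro i hi
    rw [mode_right_of_mem_center hv _ _ N (hvuw i hi)]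
    refine Finset.sum_congr rfl fun j _ => ?_
    have e1 : (n : ℝ) + k - i + j = k + j + n - i := by ring
    have e2 : (n : ℝ) + k - i + j = k + j + ((n - i : ℤ) : ℝ) := by push_cast; ring
    have e3 : (-1 : ℂ) ^ (n - (i : ℤ)) = (-1) ^ n * (-1) ^ i := by
      rw [zpow_sub₀ (by norm_num), zpow_natCast, div_eq_mul_inv, ← inv_pow]
      norm_num
    rw [e2, skewSign_add_intCast, ← e2, e1, e3]
    congr 1
    ring
  have h3 := commutator_of_mem_center hA hu n k w v N huw
  rw [sub_eq_iff_eq_add, ← sub_eq_iff_eq_add'] at h3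
  have h4 : ∑ i ∈ Finset.range N, Ring.choose n i • A.mode (n + k - i) (A.mode i u w) v =
      ∑ j ∈ Finset.range N, ∑ i ∈ Finset.range N, Ring.choose n i •
        (skewSign (k + j) * (j.factorial : ℂ)⁻¹ * (-1) ^ n * (-1) ^ i) •
          (A.D ^ j) (A.mode (k + j + n - i) v (A.mode i u w)) := by
    rw [Finset.sum_comm]
    exact Finset.sum_congr rfl fun i hi => by
      rw [h2 i (Finset.mem_range.1 hi), Finset.smul_sum]
  rw [← h3, h1, h4, ← Finset.sum_sub_distrib]
  refine Finset.sum_congr rfl fun j _ => ?_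
  rw [associator_of_mem_center hA hu n (k + j) v w N (fun i hi => ?_) huw, map_sum,
    Finset.smul_sum, ← Finset.sum_sub_distrib]
  · refine Finset.sum_congr rfl fun i _ => ?_
    simp only [← Int.cast_smul_eq_zsmul ℂ, map_sub, map_smul, smul_sub, smul_smul]
    congr 2
    push_cast
    rw [coe_negOnePow_eq_zpow]
    ring
  · have := hvw (j + i) (by lia)
    push_cast at this
    rwa [add_assoc]

/-- The coefficients of a vertex operator of an element of the meromorphic center preserve the
meromorphic center; integrality of the powers follows from the associator formula. -/
theorem mode_mem_center (hA : A.GradingRestricted) {u v : V} (hu : u ∈ A.meromorphicCenter)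
    (hv : v ∈ A.meromorphicCenter) (n : ℝ) : A.mode n u v ∈ A.meromorphicCenter := by
  by_cases hn : ∃ k : ℤ, n = k
  swap
  · push Not at hn
    rw [mode_eq_zero_of_mem_center hu hn]
    exact zero_mem _
  obtain ⟨n, rfl⟩ := hn
  refine mem_center_of_skew ?_ (fun k hk => ?_) fun b w _ k => ?_
  · refine center_induction hA (p := fun u => A.mode n u v ∈ ⨆ k : ℤ, 𝒱 (k : ℝ)) (by simp)
      (fun u u' h h' => by rw [map_add]; exact add_mem h h') (fun a u _ hua => ?_) hu
    refine center_induction hA (p := fun v => A.mode n u v ∈ ⨆ k : ℤ, 𝒱 (k : ℝ)) (by simp)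
      (fun v v' h h' => by rw [map_add]; exact add_mem h h') (fun b v _ hvb => ?_) hv
    refine Submodule.mem_iSup_of_mem (a + b - n - 1) ?_
    have := A.mode_mem hua hvb n
    push_cast
    exact this
  · ext w
    obtain ⟨N, hN⟩ := Filter.eventually_atTop.1 ((hA.mode_add_nat_eventually k v w).and
      (hA.mode_add_nat_eventually 0 u w))
    rw [associator_of_mem_center hA hu n k v w N (fun i hi => (hN i hi).1)
      (fun i hi => by simpa using (hN i hi).2)]
    refine Finset.sum_eq_zero fun i _ => ?_
    rw [mode_eq_zero_of_mem_center hv (fun j hj => hk (j - i) (by push_cast; linarith)),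
      mode_eq_zero_of_mem_center hv (n := k + n - i)
        (fun j hj => hk (j - n + i) (by push_cast; linarith))]
    simp
  · have h1 := hA.mode_add_nat_eventually 0 u w
    obtain ⟨N₀, hN₀⟩ := Filter.eventually_atTop.1 h1
    have h2 : ∀ᶠ j : ℕ in Filter.atTop, ∀ i ∈ Finset.range N₀,
        A.mode (n + k - i + j) v (A.mode i u w) = 0 :=
      (Filter.eventually_all_finset _).2 fun i _ => hA.mode_add_nat_eventually _ _ _
    obtain ⟨N, hN⟩ := Filter.eventually_atTop.1 ((h1.and (hA.mode_add_nat_eventually k v w)).and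
      (h2.and (hA.mode_add_nat_eventually k (A.mode n u v) w)))
    refine ⟨N, fun j hj => (hN j hj).2.2, mode_right_mode hA hu hv n k w N
      (fun i hi => by simpa using (hN i hi).1.1) (fun i hi => (hN i hi).1.2) fun i _ j hj => ?_⟩
    by_cases hi : i < N₀
    · exact (hN j hj).2.1 i (Finset.mem_range.2 hi)
    · have := hN₀ i (not_lt.1 hi)
      rw [zero_add] at this
      rw [this, map_zero]

/-- The operator `D` preserves the meromorphic center, as `D u = u_{-2} 1`. -/
theorem D_mem_center (hA : A.GradingRestricted) {u : V} (hu : u ∈ A.meromorphicCenter) :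
    A.D u ∈ A.meromorphicCenter := by
  have h := A.mode_vac_of_nat 1 u
  simp only [Nat.factorial_one, Nat.cast_one, inv_one, one_smul, pow_one] at h
  rw [← h]
  exact mode_mem_center hA hu vac_mem_center _

end OpenStringVertexAlgebra

end OpenString

end

theorem theorem2p3 {V : Type*} [AddCommGroup V] [Module ℂ V]
    (𝒱 : ℝ → Submodule ℂ V) [DirectSum.Decomposition 𝒱]
    (A : OpenString.OpenStringVertexAlgebra 𝒱) (hA : A.GradingRestricted) :
    ∃ (hY : ∀ n : ℝ, ∀ u ∈ A.meromorphicCenter, ∀ v ∈ A.meromorphicCenter,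
        A.mode n u v ∈ A.meromorphicCenter)
      (hD : ∀ u ∈ A.meromorphicCenter, A.D u ∈ A.meromorphicCenter)
      (h1 : A.vac ∈ A.meromorphicCenter),
      -- only integral powers occur for elements of the center
      (∀ n : ℝ, (∀ k : ℤ, n ≠ k) →
        ∀ u ∈ A.meromorphicCenter, ∀ v ∈ A.meromorphicCenter, A.mode n u v = 0) ∧
      OpenString.IsGradingRestrictedVertexAlgebra
        (fun k : ℤ => (𝒱 (k : ℝ)).comap A.meromorphicCenter.subtype)
        (fun k : ℤ => OpenString.restrictBilinear A.meromorphicCenter (A.mode k) (hY k))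
        ⟨A.vac, h1⟩ (A.D.restrict hD) ∧
      OpenString.IsModule
        (fun k : ℤ => (𝒱 (k : ℝ)).comap A.meromorphicCenter.subtype)
        (fun k : ℤ => OpenString.restrictBilinear A.meromorphicCenter (A.mode k) (hY k))
        ⟨A.vac, h1⟩ (A.D.restrict hD)
        𝒱 (fun k : ℤ => (A.mode k).domRestrict A.meromorphicCenter) A.D ∧
      OpenString.IsIntertwiningOperator
        𝒱 (fun k : ℤ => (A.mode k).domRestrict A.meromorphicCenter) A.D
        𝒱 (fun k : ℤ => (A.mode k).domRestrict A.meromorphicCenter) A.D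
        𝒱 (fun k : ℤ => (A.mode k).domRestrict A.meromorphicCenter) A.D
        A.mode := by
  have hY := fun n (u : V) (hu : u ∈ A.meromorphicCenter) (v : V)
      (hv : v ∈ A.meromorphicCenter) =>
    OpenString.OpenStringVertexAlgebra.mode_mem_center hA hu hv n
  have hD := fun (u : V) (hu : u ∈ A.meromorphicCenter) =>
    OpenString.OpenStringVertexAlgebra.D_mem_center hA hu
  have h1 : A.vac ∈ A.meromorphicCenter := OpenString.OpenStringVertexAlgebra.vac_mem_center
  have htrunc : ∀ u v : V, ∃ N : ℤ, ∀ n : ℤ, N ≤ n → A.mode n u v = 0 := by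
    intro u v
    obtain ⟨N, hN⟩ := hA.mode_truncation u v
    exact ⟨⌈N⌉, fun n hn => hN n (Int.ceil_le.1 hn)⟩
  have hDb : ∀ (n : ℝ) (u v : V), A.D (A.mode n u v) - A.mode n u (A.D v) = A.mode n (A.D u) v :=
    fun n u v => by rw [A.D_mode, add_sub_cancel_left]
  have hDd : ∀ (n : ℤ) (u v : V),
      A.mode n (A.D u) v = (-(n : ℂ)) • A.mode ((n - 1 : ℤ) : ℝ) u v := fun n u v => by
    rw [A.mode_D]
    push_cast
    rfl
  have hvac : ∀ (n : ℤ) (v : V), A.mode n A.vac v = if n = -1 then v else 0 := fun n v => by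
    rw [A.mode_vac_left]
    exact if_congr (by exact_mod_cast Iff.rfl) rfl rfl
  have hjac : ∀ (l m : ℤ) (n : ℝ), ∀ u ∈ A.meromorphicCenter, ∀ v w : V,
      (∑ᶠ i : ℕ, ((-1 : ℤ) ^ i * Ring.choose l i) •
          A.mode ((m + l - i : ℤ) : ℝ) u (A.mode (n + i) v w)) -
        (∑ᶠ i : ℕ, ((l.negOnePow : ℤ) * (-1 : ℤ) ^ i * Ring.choose l i) •
          A.mode (n + l - i) v (A.mode ((m + i : ℤ) : ℝ) u w)) =
        ∑ᶠ i : ℕ, (Ring.choose m i) • A.mode (m + n - i) (A.mode ((l + i : ℤ) : ℝ) u v) w := by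
    intro l m n u hu v w
    push_cast
    exact OpenString.OpenStringVertexAlgebra.jacobi_of_mem_center hA hu l m n v w
  have hjac' : ∀ (l m n : ℤ), ∀ u ∈ A.meromorphicCenter, ∀ v w : V,
      (∑ᶠ i : ℕ, ((-1 : ℤ) ^ i * Ring.choose l i) •
          A.mode ((m + l - i : ℤ) : ℝ) u (A.mode ((n + i : ℤ) : ℝ) v w)) -
        (∑ᶠ i : ℕ, ((l.negOnePow : ℤ) * (-1 : ℤ) ^ i * Ring.choose l i) •
          A.mode ((n + l - i : ℤ) : ℝ) v (A.mode ((m + i : ℤ) : ℝ) u w)) =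
        ∑ᶠ i : ℕ, (Ring.choose m i) •
          A.mode ((m + n - i : ℤ) : ℝ) (A.mode ((l + i : ℤ) : ℝ) u v) w := by
    intro l m n u hu v w
    push_cast
    exact OpenString.OpenStringVertexAlgebra.jacobi_of_mem_center hA hu l m n v w
  have hbot : ∃ N : ℤ, ∀ n : ℤ, n < N → 𝒱 (n : ℝ) = ⊥ := by
    obtain ⟨-, L, hL⟩ := hA
    exact ⟨⌊L⌋, fun n hn => hL n (lt_of_lt_of_le (by exact_mod_cast hn) (Int.floor_le L))⟩
  have hwt : ∀ (a n : ℤ) (b : ℝ), ∀ u ∈ 𝒱 (a : ℝ), ∀ v ∈ 𝒱 b, A.mode n u v ∈ 𝒱 (a + b - n - 1) :=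
    fun a n b u hu v hv => A.mode_mem hu hv n
  refine ⟨hY, hD, h1, fun n hn u hu v _ =>
    OpenString.OpenStringVertexAlgebra.mode_eq_zero_of_mem_center hu hn v, ?_, ?_, ?_⟩
  · refine
      { graded := OpenString.OpenStringVertexAlgebra.isInternal_center hA
        finiteDimensional := fun n => ?_
        lower_truncation := ?_
        vac_mem := ?_
        D_weight := fun n u hu => ?_
        truncation := fun u v => ?_
        identity := fun n v => ?_
        creation_nonneg := fun u n hn => ?_
        creation := fun u => ?_
        weight := fun a b n u hu v hv => ?_
        D_derivative := fun n u v => Subtype.ext (hDd n u v)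
        D_bracket := fun n u v => Subtype.ext (hDb n u v)
        jacobi := fun l m n u v w => ?_ }
    · have := hA.1 n
      exact FiniteDimensional.of_injective
        (A.meromorphicCenter.subtype.restrict (p := (𝒱 (n : ℝ)).comap A.meromorphicCenter.subtype)
          (q := 𝒱 (n : ℝ)) fun x hx => hx)
        fun x y hxy => Subtype.ext (Subtype.ext (by
          have := congrArg Subtype.val hxy
          exact this))
    · obtain ⟨N, hN⟩ := hbot
      refine ⟨N, fun n hn => ?_⟩
      rw [hN n hn, Submodule.comap_bot, Submodule.ker_subtype]
    · simpa using A.vac_mem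
    · have := A.D_weight n u hu
      simpa using this
    · obtain ⟨N, hN⟩ := htrunc u v
      exact ⟨N, fun n hn => Subtype.ext (hN n hn)⟩
    · ext
      refine (hvac n v).trans ?_
      split_ifs <;> rfl
    · exact Subtype.ext (A.mode_vac_of_neg_one_lt (by
        have : (0 : ℝ) ≤ n := by exact_mod_cast hn
        linarith) u)
    · ext
      have := A.mode_neg_one_vac u
      rw [show (-1 : ℝ) = ((-1 : ℤ) : ℝ) by norm_num] at this
      exact this
    · change A.mode n u v ∈ 𝒱 ((a + b - n - 1 : ℤ) : ℝ)
      push_cast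
      exact hwt a n b u hu v hv
    · refine A.meromorphicCenter.subtype_injective ?_
      have hmap : ∀ t : ℕ → A.meromorphicCenter, A.meromorphicCenter.subtype (∑ᶠ i, t i) =
          ∑ᶠ i, (t i : V) := fun t => AddMonoidHom.map_finsum_of_injective
        A.meromorphicCenter.subtype.toAddMonoidHom A.meromorphicCenter.subtype_injective t
      rw [map_sub, hmap, hmap, hmap]
      exact hjac' l m n u u.2 v w
  · exact
      { graded := DirectSum.Decomposition.isInternal 𝒱
        finiteDimensional := hA.1
        lower_truncation := hA.2
        D_weight := A.D_weight
        truncation := fun u w => htrunc u w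
        identity := fun n w => hvac n w
        weight := fun a n b u hu w hw => hwt a n b u hu w hw
        D_derivative := fun n u w => hDd n u w
        D_bracket := fun n u w => hDb n u w
        jacobi := fun l m n u v w => hjac' l m n u u.2 v w }
  · exact
      { truncation := hA.mode_truncation
        jacobi := fun l m n u v w => hjac l m n u u.2 v w
        D_derivative := A.mode_D
        D_bracket := hDb
        weight := fun a b n u hu v hv => A.mode_mem hu hv n }
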